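/- Let $R$ be a commutative ring with unity and let $X$ be a smooth $n$-manifold (Hausdorff, second countable, without boundary, not necessarily compact or orientable). Notation. A Borel–Moore $k$-chain on $X$ is a formal sum $c=\sum_\sigma a_\sigma\sigma$, possibly infinite, of singular $k$-simplices $\sigma\colon\Delta^k\to X$ with coefficients $a_\sigma\in R$ such that every point of $X$ has an open neighborhood meeting the images of only finitely many $\sigma$ with $a_\sigma\neq0$. With the usual boundary operator these form a chain complex $S^{\mathrm{lf}}_*(X;R)$, whose homology is the Borel–Moore homology $H^{\mathrm{lf}}_*(X;R)$. For $U\subset X$, the chains all of whose simplices (those with $a_\sigma\ne0$) lie in $U$ form a subcomplex $S^{\mathrm{lf}}_{\{U\};*}(X;R)$, and $H^{\mathrm{lf}}_*(X,\{U\};R)$ denotes the homology of the quotient complex $S^{\mathrm{lf}}_*(X;R)/S^{\mathrm{lf}}_{\{U\};*}(X;R)$. For $A\subset B\subset X$ and $\mu\in H^{\mathrm{lf}}_k(X,\{X-B\};R)$, $\mu|_A\in H^{\mathrm{lf}}_k(X,\{X-A\};R)$ denotes the image of $\mu$ under the homomorphism induced by $X-B\subset X-A$; for $A=\{x\}$ we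 write $\mu|_x$. For $\mu\in H^{\mathrm{lf}}_k(X;R)$, $\mu|_x$ is the image of $\mu$ under the quotient homomorphism to $H^{\mathrm{lf}}_k(X,\{X-\{x\}\};R)$. An $R$-orientation on $X$ is a collection $(\mu_x)_{x\in X}$ of generators $\mu_x$ of the $R$-modules $H^{\mathrm{lf}}_n(X,\{X-\{x\}\};R)$ such that for every $x\in X$ there are a neighborhood $U$ of $x$ and a class $\mu_U\in H^{\mathrm{lf}}_n(X,\{X-U\};R)$ with $\mu_U|_y=\mu_y$ for all $y\in U$. Proposition (Fundamental Class). Let $A\subset X$ be a closed subset. (1) For every $k>n$, $H^{\mathrm{lf}}_k(X,\{X-A\};R)=0$. (2) An element $\mu_A\in H^{\mathrm{lf}}_n(X,\{X-A\};R)$ is zero if and only if $\mu_A|_x=0\in H^{\mathrm{lf}}_n(X,\{X-\{x\}\};R)$ for all $x\in A$. (3) If $(\mu_x)_{x\in X}$ is an $R$-orientation on $X$, there exists a unique $\mu_A\in H^{\mathrm{lf}}_n(X,\{X-A\};R)$ such that $\mu_A|_x=\mu_x$ for all $x\in A$. In particular (the case $A=X$), an $R$-orientation $(\mu_x)_{x\in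 X}$ on $X$ determines a unique fundamental class $[X]\in H^{\mathrm{lf}}_n(X;R)$ with $[X]|_x=\mu_x$ for all $x\in X$. -/

import Mathlib

open CategoryTheory
open scoped Manifold ContDiff Topology

namespace BorelMoore

noncomputable section

/-! ### Singular simplices and locally finite chains -/

/-- Singular `k`-simplices of `X`: continuous maps from the standard `k`-simplex to `X`. -/
abbrev Simplex (k : ℕ) (X : Type*) [TopologicalSpace X] : Type _ :=
  C(stdSimplex ℝ (Fin (k + 1)), X)

/-- The affine inclusion of the standard `k`-simplex as the `p`-th face of the standard
`(k+1)`-simplex; the vertex `q` goes to `q` if `q < p` and to `q + 1` if `q ≥ p`. -/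
def faceInclusion (k : ℕ) (p : Fin (k + 2)) :
    C(stdSimplex ℝ (Fin (k + 1)), stdSimplex ℝ (Fin (k + 2))) :=
  ⟨stdSimplex.map p.succAbove, stdSimplex.continuous_map _⟩

section Chains

variable {X : Type*} [TopologicalSpace X]

/-- The `p`-th face of a singular simplex. -/
def face {k : ℕ} (p : Fin (k + 2)) (σ : Simplex (k + 1) X) : Simplex k X :=
  σ.comp (faceInclusion k p)

theorem range_face_subset {k : ℕ} (p : Fin (k + 2)) (σ : Simplex (k + 1) X) :
    Set.range (face p σ) ⊆ Set.range σ := by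
  rintro _ ⟨t, rfl⟩
  exact ⟨_, rfl⟩

theorem face_face {k : ℕ} {i j : Fin (k + 2)} (h : i ≤ j) (σ : Simplex (k + 2) X) :
    face i (face j.succ σ) = face j (face i.castSucc σ) := by
  ext t
  simp only [face, faceInclusion, ContinuousMap.comp_apply, ContinuousMap.coe_mk,
    stdSimplex.map_comp_apply]
  congr 2
  funext q
  exact congrArg (fun f => SimplexCategory.Hom.toOrderHom f q) (SimplexCategory.δ_comp_δ h)

/-- A family of coefficients `c` on the singular `k`-simplices of `X` is locally finite if every
point has an open neighborhood that meets only finitely many of the simplices appearing in `c`. -/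
def IsLocallyFinite {R : Type*} [Zero R] {k : ℕ} (c : Simplex k X → R) : Prop :=
  ∀ x : X, ∃ U : Set X, IsOpen U ∧ x ∈ U ∧
    {σ : Simplex k X | c σ ≠ 0 ∧ (Set.range σ ∩ U).Nonempty}.Finite

theorem IsLocallyFinite.finite_meets {R : Type*} [Zero R] {k : ℕ} {c : Simplex k X → R}
    (hc : IsLocallyFinite c) {K : Set X} (hK : IsCompact K) :
    {σ : Simplex k X | c σ ≠ 0 ∧ (Set.range σ ∩ K).Nonempty}.Finite := by
  choose U hUo hxU hfin using hc
  obtain ⟨t, ht⟩ := hK.elim_finite_subcover U hUo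
    (fun x _ => Set.mem_iUnion.2 ⟨x, hxU x⟩)
  refine (t.finite_toSet.biUnion (fun x _ => hfin x)).subset ?_
  rintro σ ⟨h0, y, hy, hyK⟩
  obtain ⟨x, hx, hyx⟩ := Set.mem_iUnion₂.1 (ht hyK)
  exact Set.mem_biUnion hx ⟨h0, y, hy, hyx⟩

end Chains

variable (R : Type*) [CommRing R] (X : Type*) [TopologicalSpace X]

/-- The module of Borel-Moore (locally finite) singular `k`-chains on `X`. -/
def chains (k : ℕ) : Submodule R (Simplex k X → R) where
  carrier := {c | IsLocallyFinite c}
  zero_mem' x := ⟨Set.univ, isOpen_univ, trivial, by simp⟩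
  add_mem' {a b} ha hb x := by
    obtain ⟨U, hU, hxU, hfU⟩ := ha x
    obtain ⟨V, hV, hxV, hfV⟩ := hb x
    refine ⟨U ∩ V, hU.inter hV, ⟨hxU, hxV⟩, (hfU.union hfV).subset ?_⟩
    rintro σ ⟨h0, y, hy, hyU, hyV⟩
    by_cases h : a σ = 0
    · exact Or.inr ⟨by simpa [h] using h0, y, hy, hyV⟩
    · exact Or.inl ⟨h, y, hy, hyU⟩
  smul_mem' r a ha x := by
    obtain ⟨U, hU, hxU, hfU⟩ := ha x
    refine ⟨U, hU, hxU, hfU.subset ?_⟩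
    rintro σ ⟨h0, hσ⟩
    exact ⟨fun h => h0 (by simp [h]), hσ⟩

section Push

variable {R X}

theorem finite_fiber {k m : ℕ} {f : Simplex k X → Simplex m X}
    (hf : ∀ σ, Set.range (f σ) ⊆ Set.range σ) (c : chains R X k) (τ : Simplex m X) :
    {σ : Simplex k X | c.1 σ ≠ 0 ∧ f σ = τ}.Finite := by
  refine (c.2.finite_meets (isCompact_range τ.continuous)).subset ?_
  rintro σ ⟨h0, rfl⟩
  obtain ⟨y, hy⟩ := Set.range_nonempty (f σ)
  exact ⟨h0, y, hf σ hy, hy⟩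

/-- The coefficient of `τ` in `∑_σ c(σ) f(σ)`. -/
def pushFun {k m : ℕ} (f : Simplex k X → Simplex m X) (c : Simplex k X → R) (τ : Simplex m X) :
    R :=
  ∑ᶠ σ ∈ {σ | f σ = τ}, c σ

open scoped Classical in
theorem pushFun_eq_sum {k m : ℕ} (f : Simplex k X → Simplex m X) (c : Simplex k X → R)
    (τ : Simplex m X) (F : Finset (Simplex k X)) (hF : ∀ σ, c σ ≠ 0 → f σ = τ → σ ∈ F) :
    pushFun f c τ = ∑ σ ∈ F, if f σ = τ then c σ else 0 := by
  rw [pushFun, finsum_mem_def, finsum_eq_sum_of_support_subset (s := F)]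
  · exact Finset.sum_congr rfl fun σ _ => by simp [Set.indicator_apply]
  · intro σ hσ
    rw [Function.mem_support, Set.indicator_apply] at hσ
    by_cases h : f σ = τ
    · exact hF σ (by simpa [h] using hσ) h
    · exact absurd (by simp [h]) hσ

/-- If `f(σ)` is carried by `σ` for every `σ`, then `∑_σ c(σ) σ ↦ ∑_σ c(σ) f(σ)` is a
well-defined homomorphism on locally finite chains. -/
def push {k m : ℕ} (f : Simplex k X → Simplex m X)
    (hf : ∀ σ, Set.range (f σ) ⊆ Set.range σ) : chains R X k →ₗ[R] chains R X m where
  toFun c := ⟨pushFun f c.1, fun x => by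
    obtain ⟨U, hU, hxU, hfU⟩ := c.2 x
    refine ⟨U, hU, hxU, (hfU.image f).subset ?_⟩
    rintro τ ⟨h0, y, hy, hyU⟩
    obtain ⟨σ, hσ, hσ0⟩ := exists_ne_zero_of_finsum_mem_ne_zero h0
    have hτ : f σ = τ := hσ
    exact ⟨σ, ⟨hσ0, y, hf σ (by rw [hτ]; exact hy), hyU⟩, hτ⟩⟩
  map_add' a b := by
    ext τ
    refine finsum_mem_add_distrib' ?_ ?_
    · exact (finite_fiber hf a τ).subset fun σ hσ => ⟨hσ.2, hσ.1⟩
    · exact (finite_fiber hf b τ).subset fun σ hσ => ⟨hσ.2, hσ.1⟩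
  map_smul' r a := by
    ext τ
    classical
    have hF : ∀ σ, a.1 σ ≠ 0 → f σ = τ → σ ∈ (finite_fiber hf a τ).toFinset :=
      fun σ h0 hσ => (finite_fiber hf a τ).mem_toFinset.2 ⟨h0, hσ⟩
    change pushFun f (r • a.1) τ = r • pushFun f a.1 τ
    rw [pushFun_eq_sum f a.1 τ _ hF, pushFun_eq_sum f (r • a.1) τ _ (fun σ h0 hσ =>
      hF σ (fun h => h0 (by simp [h])) hσ), Finset.smul_sum]
    exact Finset.sum_congr rfl fun σ _ => by simp

theorem push_apply {k m : ℕ} (f : Simplex k X → Simplex m X)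
    (hf : ∀ σ, Set.range (f σ) ⊆ Set.range σ) (c : chains R X k) (τ : Simplex m X) :
    (push f hf c).1 τ = ∑ᶠ σ ∈ {σ | f σ = τ}, c.1 σ := rfl

theorem push_push {k l m : ℕ} (f : Simplex k X → Simplex l X)
    (hf : ∀ σ, Set.range (f σ) ⊆ Set.range σ) (g : Simplex l X → Simplex m X)
    (hg : ∀ σ, Set.range (g σ) ⊆ Set.range σ) (c : chains R X k) :
    push g hg (push f hf c) =
      push (g ∘ f) (fun σ => (hg (f σ)).trans (hf σ)) c := by
  classical
  ext ρ
  have hfin := c.2.finite_meets (isCompact_range ρ.continuous)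
  set F := hfin.toFinset with hFdef
  have hF : ∀ σ, c.1 σ ≠ 0 → g (f σ) = ρ → σ ∈ F := by
    rintro σ h0 rfl
    obtain ⟨y, hy⟩ := Set.range_nonempty (g (f σ))
    exact hfin.mem_toFinset.2 ⟨h0, y, hf σ (hg _ hy), hy⟩
  change pushFun g (pushFun f c.1) ρ = pushFun (g ∘ f) c.1 ρ
  rw [pushFun_eq_sum (g ∘ f) c.1 ρ F hF, pushFun_eq_sum g _ ρ (F.image f)]
  · have : ∀ τ ∈ F.image f, (if g τ = ρ then pushFun f c.1 τ else 0) =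
        ∑ σ ∈ F, if f σ = τ then (if g τ = ρ then c.1 σ else 0) else 0 := by
      intro τ _
      by_cases h : g τ = ρ
      · rw [if_pos h, pushFun_eq_sum f c.1 τ F]
        · simp [h]
        · rintro σ h0 rfl
          exact hF σ h0 h
      · simp [h]
    rw [Finset.sum_congr rfl this, Finset.sum_comm]
    refine Finset.sum_congr rfl fun σ hσ => ?_
    rw [Finset.sum_ite_eq, if_pos (Finset.mem_image_of_mem f hσ)]
    rfl
  · intro τ h0 hτ
    obtain ⟨σ, hσ, hσ0⟩ := exists_ne_zero_of_finsum_mem_ne_zero h0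
    have hστ : f σ = τ := hσ
    exact Finset.mem_image.2 ⟨σ, hF σ hσ0 (by rw [hστ, hτ]), hστ⟩

end Push

/-- The boundary homomorphism `∂ ∑ a_σ σ = ∑_σ ∑_p (-1)^p a_σ (σ ∘ ι_p)`. -/
def boundary (k : ℕ) : chains R X (k + 1) →ₗ[R] chains R X k :=
  ∑ p : Fin (k + 2), (-1 : R) ^ (p : ℕ) • push (face p) (range_face_subset p)

theorem boundary_boundary (k : ℕ) (c : chains R X (k + 2)) :
    boundary R X k (boundary R X (k + 1) c) = 0 := by
  simp only [boundary, LinearMap.sum_apply, LinearMap.smul_apply, map_sum, map_smul, smul_smul,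
    Finset.smul_sum, push_push, ← Finset.sum_product', ← pow_add]
  rw [Finset.univ_product_univ]
  let S : Finset (Fin (k + 3) × Fin (k + 2)) := {x | (x.1 : ℕ) ≤ (x.2 : ℕ)}
  rw [← Finset.sum_add_sum_compl S, ← eq_neg_iff_add_eq_zero, ← Finset.sum_neg_distrib]
  let φ : ∀ x : Fin (k + 3) × Fin (k + 2), x ∈ S → Fin (k + 3) × Fin (k + 2) := fun x hx =>
    (x.2.succ, Fin.castLT x.1 (lt_of_le_of_lt (Finset.mem_filter.mp hx).right x.2.is_lt))
  apply Finset.sum_bij φ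
  · intro x hx
    simp_rw [S, φ, Finset.compl_filter, Finset.mem_filter_univ, Fin.val_succ,
      Fin.val_castLT] at hx ⊢
    lia
  · rintro ⟨i, j⟩ hx ⟨i', j'⟩ hx' h
    rw [Prod.mk_inj]
    have h1 : j.succ = j'.succ := congrArg Prod.fst h
    have h2 := congrArg Fin.val (congrArg Prod.snd h)
    exact ⟨Fin.ext h2, Fin.succ_injective _ h1⟩
  · rintro ⟨i', j'⟩ hx'
    simp_rw [S, Finset.compl_filter, Finset.mem_filter_univ, not_le] at hx'
    have h0 : i' ≠ 0 := by
      rintro rfl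
      simp at hx'
    refine ⟨(Fin.castSucc j', i'.pred h0), ?_, ?_⟩
    · simpa [S] using Nat.le_sub_one_of_lt hx'
    · simp only [φ, Fin.castLT_castSucc, Fin.succ_pred]
  · rintro ⟨i, j⟩ hx
    have hij : (i : ℕ) ≤ (j : ℕ) := (Finset.mem_filter.mp hx).right
    have hfun : (face (X := X) j ∘ face i) =
        face (Fin.castLT i (lt_of_le_of_lt hij j.is_lt)) ∘ face j.succ := by
      funext σ
      have := face_face (i := Fin.castLT i (lt_of_le_of_lt hij j.is_lt)) (j := j)
        (Fin.le_def.2 (by simpa using hij)) σ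
      rw [Fin.castSucc_castLT] at this
      exact this.symm
    simp only [φ, hfun, Fin.val_succ, Fin.val_castLT, ← neg_smul]
    congr 1
    ring

/-! ### Subcomplexes, quotient complexes and their homology -/

/-- The chains all of whose simplices are contained in some member of the collection `𝒜`. -/
def subchains (𝒜 : Set (Set X)) (k : ℕ) : Submodule R (chains R X k) where
  carrier := {c | ∀ σ : Simplex k X, c.1 σ ≠ 0 → ∃ U ∈ 𝒜, Set.range σ ⊆ U}
  zero_mem' σ h := absurd rfl h
  add_mem' {a b} ha hb σ h := by
    by_cases h0 : a.1 σ = 0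
    · exact hb σ fun h1 => h (by simp [h0, h1])
    · exact ha σ h0
  smul_mem' r a ha σ h := ha σ fun h0 => h (by simp [h0])

variable {X} in
theorem push_mem_subchains (𝒜 : Set (Set X)) {k m : ℕ} (f : Simplex k X → Simplex m X)
    (hf : ∀ σ, Set.range (f σ) ⊆ Set.range σ) (c : chains R X k)
    (hc : c ∈ subchains R X 𝒜 k) : push f hf c ∈ subchains R X 𝒜 m := by
  intro τ h0
  obtain ⟨σ, hσ, hσ0⟩ := exists_ne_zero_of_finsum_mem_ne_zero h0
  obtain ⟨U, hU, hσU⟩ := hc σ hσ0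
  have hστ : f σ = τ := hσ
  exact ⟨U, hU, hστ ▸ (hf σ).trans hσU⟩

theorem subchains_le_comap_boundary (𝒜 : Set (Set X)) (k : ℕ) :
    subchains R X 𝒜 (k + 1) ≤ (subchains R X 𝒜 k).comap (boundary R X k) := by
  intro c hc
  simp only [Submodule.mem_comap, boundary, LinearMap.sum_apply, LinearMap.smul_apply]
  exact Submodule.sum_mem _ fun p _ =>
    Submodule.smul_mem _ _ (push_mem_subchains R 𝒜 _ _ c hc)

variable {X} in
theorem subchains_mono {U V : Set X} (h : U ⊆ V) (k : ℕ) :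
    subchains R X {U} k ≤ subchains R X {V} k := by
  intro c hc σ h0
  obtain ⟨W, rfl, hW⟩ := hc σ h0
  exact ⟨V, rfl, hW.trans h⟩

/-- The Borel-Moore chain complex of `X`. -/
def complex : ChainComplex (ModuleCat R) ℕ :=
  ChainComplex.of (fun k => ModuleCat.of R (chains R X k))
    (fun k => ModuleCat.ofHom (boundary R X k))
    (fun k => by
      ext c : 2
      exact boundary_boundary R X k c)

/-- The boundary homomorphism induced on the quotient of all chains by the chains in `𝒜`. -/
def relBoundary (𝒜 : Set (Set X)) (k : ℕ) :
    (chains R X (k + 1) ⧸ subchains R X 𝒜 (k + 1)) →ₗ[R]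
      (chains R X k ⧸ subchains R X 𝒜 k) :=
  Submodule.mapQ _ _ (boundary R X k) (subchains_le_comap_boundary R X 𝒜 k)

/-- The quotient complex of the Borel-Moore chain complex of `X` by the subcomplex of chains
in `𝒜`. -/
def relComplex (𝒜 : Set (Set X)) : ChainComplex (ModuleCat R) ℕ :=
  ChainComplex.of (fun k => ModuleCat.of R (chains R X k ⧸ subchains R X 𝒜 k))
    (fun k => ModuleCat.ofHom (relBoundary R X 𝒜 k))
    (fun k => by
      ext c : 3
      change Submodule.Quotient.mk (boundary R X k (boundary R X (k + 1) c)) = 0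
      rw [boundary_boundary, Submodule.Quotient.mk_zero])

theorem complex_d (k : ℕ) :
    (complex R X).d (k + 1) k = ModuleCat.ofHom (boundary R X k) :=
  ChainComplex.of_d (fun k => ModuleCat.of R (chains R X k))
    (fun k => ModuleCat.ofHom (boundary R X k)) k

theorem relComplex_d (𝒜 : Set (Set X)) (k : ℕ) :
    (relComplex R X 𝒜).d (k + 1) k = ModuleCat.ofHom (relBoundary R X 𝒜 k) :=
  ChainComplex.of_d (fun k => ModuleCat.of R (chains R X k ⧸ subchains R X 𝒜 k))
    (fun k => ModuleCat.ofHom (relBoundary R X 𝒜 k)) k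

/-- The Borel-Moore homology module of `X` in degree `k`. -/
abbrev homology (k : ℕ) : ModuleCat R := (complex R X).homology k

/-- The relative Borel-Moore homology module of `(X, 𝒜)` in degree `k`. -/
abbrev relHomology (𝒜 : Set (Set X)) (k : ℕ) : ModuleCat R := (relComplex R X 𝒜).homology k

/-- The quotient map from the Borel-Moore chain complex to the relative one. -/
def toRelComplex (𝒜 : Set (Set X)) : complex R X ⟶ relComplex R X 𝒜 :=
  ChainComplex.ofHom
    (fun k => ModuleCat.ofHom (subchains R X 𝒜 k).mkQ)
    (fun k => by
      rw [complex_d, relComplex_d]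
      rfl)

variable {X}

/-- The homomorphism of quotient complexes induced by an inclusion `U ⊆ V`. -/
def relComplexMap {U V : Set X} (h : U ⊆ V) : relComplex R X {U} ⟶ relComplex R X {V} :=
  ChainComplex.ofHom
    (fun k => ModuleCat.ofHom (Submodule.mapQ _ _ LinearMap.id (subchains_mono R h k)))
    (fun k => by
      rw [relComplex_d, relComplex_d]
      ext c : 2
      obtain ⟨c, rfl⟩ := Submodule.Quotient.mk_surjective _ c
      rfl)

/-- For `A ⊆ B`, the restriction to `A` of a class relative to the complement of `B`: its image
under the homomorphism induced by the inclusion `(X, X - B) ⟶ (X, X - A)`. -/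
def restrict {A B : Set X} (h : A ⊆ B) (k : ℕ) :
    relHomology R X {Bᶜ} k →ₗ[R] relHomology R X {Aᶜ} k :=
  (HomologicalComplex.homologyMap (relComplexMap R (Set.compl_subset_compl.2 h)) k).hom

/-- The restriction to `A` of an absolute class: its image under the homomorphism induced by the
quotient map to the complex relative to the complement of `A`. -/
def restrictAbs (A : Set X) (k : ℕ) : homology R X k →ₗ[R] relHomology R X {Aᶜ} k :=
  (HomologicalComplex.homologyMap (toRelComplex R X {Aᶜ}) k).hom

variable (X)

/-- An `R`-orientation in dimension `n`: a choice, for every `x`, of a generator of the local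
homology module at `x`, such that every point has a neighborhood `U` with a class relative to
the complement of `U` that restricts to the chosen generator at every point of `U`. -/
structure Orientation (n : ℕ) where
  /-- The local orientation at a point. -/
  loc : ∀ x : X, relHomology R X {({x} : Set X)ᶜ} n
  generates : ∀ x : X, Submodule.span R {loc x} = ⊤
  locally_consistent : ∀ x : X, ∃ U ∈ 𝓝 x, ∃ μ : relHomology R X {Uᶜ} n,
    ∀ (y : X) (hy : y ∈ U), restrict R (Set.singleton_subset_iff.2 hy) n μ = loc y

end

end BorelMoore

/-! All three assertions become statements about chains. With `cyc A k` the chains whose boundary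
avoids `A`, and `bnd A k` the chains that are a boundary up to a chain avoiding `A`, relative
homology is `cyc` modulo `bnd`. Restricting a class to a smaller set does not change its
representing chain (`Represents.restrict`).

The engine is excision, hence Mayer-Vietoris for closed sets, valid for finite and for locally
finite chains alike. It rests on barycentric subdivision. Subdivision and its homotopies are
carried: each simplex goes to a finite chain inside its own image. A coefficient of the result then
depends only on the simplices meeting one compact set, so such operators, and identities between
them, extend from finite to locally finite chains (`lfExtend`).

Vanishing above degree `n` begins with boxes in `ℝⁿ`. Imposing the constraints one coordinate at a
time writes a box as an intersection of two half-slabs with no homology, and Mayer-Vietoris shifts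
the degree by one for each coordinate (`cyc_le_bnd_slab`). Finite unions of boxes follow, then
compact sets, because the boundary of a finite relative cycle avoids a whole neighborhood of the
compact set. Excision moves the result into charts, and truncation replaces a locally finite chain
near a compact set by a finite one (`cyc_le_bnd_image`). Compact induction with Mayer-Vietoris
reaches all compact subsets of the manifold.

In degree `n`, a class vanishing at a point vanishes near it, so the same induction shows that
classes over compact sets are detected at points. Detection at points in turn gives the agreement on
overlaps that is needed to glue local classes over compact sets.

For a closed, noncompact `A`, the manifold is covered by two sets `E` and `F`, each a union of
compact pieces with disjoint, locally finite open neighborhoods. Locally finite chains chosen piece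
by piece assemble into one such chain (`exists_patch`), so the compact results hold for closed
subsets of `E` and of `F`. One more Mayer-Vietoris step for `A ∩ E` and `A ∩ F` finishes. The
absolute class is the case where the complement is empty and the subcomplex divided out is zero. -/

namespace BorelMoore

noncomputable section

/-! ### Alternating sums of faces -/

/-- The alternating sum of a family of face maps. -/
def altSum (R : Type*) [CommRing R] {S T : Type*} {k : ℕ} (f : Fin (k + 2) → S → T) :
    (S →₀ R) →ₗ[R] (T →₀ R) :=
  ∑ p : Fin (k + 2), (-1 : R) ^ (p : ℕ) • Finsupp.lmapDomain R R (f p)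

section AltSum

variable {R : Type*} [CommRing R]

theorem altSum_single {S T : Type*} {k : ℕ} (f : Fin (k + 2) → S → T) (s : S) (r : R) :
    altSum R f (Finsupp.single s r) =
      ∑ p : Fin (k + 2), (-1 : R) ^ (p : ℕ) • Finsupp.single (f p s) r := by
  simp [altSum, LinearMap.sum_apply, Finsupp.mapDomain_single]

/-- The simplicial identity `hfg` cancels terms in pairs: for `i ≤ j`, the term deleting `i` then
`j` matches the one deleting `j + 1` then `i`, whose sign is opposite. The map `φ` below is this
bijection. -/
theorem altSum_altSum {S T U : Type*} {k : ℕ} (f : Fin (k + 3) → S → T) (g : Fin (k + 2) → T → U)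
    (hfg : ∀ (i j : Fin (k + 2)), i ≤ j → ∀ s, g i (f j.succ s) = g j (f i.castSucc s))
    (c : S →₀ R) : altSum R g (altSum R f c) = 0 := by
  have hcomp : ∀ (a : S → T) (b : T → U) (x : S →₀ R),
      Finsupp.lmapDomain R R b (Finsupp.lmapDomain R R a x) =
        Finsupp.lmapDomain R R (b ∘ a) x := fun a b x => by
    simp [Finsupp.lmapDomain_apply, Finsupp.mapDomain_comp]
  simp only [altSum, LinearMap.sum_apply, LinearMap.smul_apply, map_sum, map_smul, smul_smul,
    Finset.smul_sum, hcomp, ← Finset.sum_product', ← pow_add]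
  rw [Finset.univ_product_univ]
  let S : Finset (Fin (k + 3) × Fin (k + 2)) := {x | (x.1 : ℕ) ≤ (x.2 : ℕ)}
  rw [← Finset.sum_add_sum_compl S, ← eq_neg_iff_add_eq_zero, ← Finset.sum_neg_distrib]
  let φ : ∀ x : Fin (k + 3) × Fin (k + 2), x ∈ S → Fin (k + 3) × Fin (k + 2) := fun x hx =>
    (x.2.succ, Fin.castLT x.1 (lt_of_le_of_lt (Finset.mem_filter.mp hx).right x.2.is_lt))
  apply Finset.sum_bij φ
  · intro x hx
    simp_rw [S, φ, Finset.compl_filter, Finset.mem_filter_univ, Fin.val_succ,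
      Fin.val_castLT] at hx ⊢
    lia
  · rintro ⟨i, j⟩ hx ⟨i', j'⟩ hx' h
    rw [Prod.mk_inj]
    have h1 : j.succ = j'.succ := congrArg Prod.fst h
    have h2 := congrArg Fin.val (congrArg Prod.snd h)
    exact ⟨Fin.ext h2, Fin.succ_injective _ h1⟩
  · rintro ⟨i', j'⟩ hx'
    simp_rw [S, Finset.compl_filter, Finset.mem_filter_univ, not_le] at hx'
    have h0 : i' ≠ 0 := by
      rintro rfl
      simp at hx'
    refine ⟨(Fin.castSucc j', i'.pred h0), ?_, ?_⟩
    · simpa [S] using Nat.le_sub_one_of_lt hx'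
    · simp only [φ, Fin.castLT_castSucc, Fin.succ_pred]
  · rintro ⟨i, j⟩ hx
    have hij : (i : ℕ) ≤ (j : ℕ) := (Finset.mem_filter.mp hx).right
    have hfun : (g j ∘ f i) =
        g (Fin.castLT i (lt_of_le_of_lt hij j.is_lt)) ∘ f j.succ := by
      funext σ
      have := hfg (Fin.castLT i (lt_of_le_of_lt hij j.is_lt)) j
        (Fin.le_def.2 (by simpa using hij)) σ
      rw [Fin.castSucc_castLT] at this
      exact this.symm
    simp only [φ, hfun, Fin.val_succ, Fin.val_castLT, ← neg_smul]
    congr 1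
    ring

theorem altSum_lmapDomain {S T S' T' : Type*} {k : ℕ} (f : Fin (k + 2) → S → T)
    (f' : Fin (k + 2) → S' → T') (a : S → S') (b : T → T')
    (h : ∀ p s, f' p (a s) = b (f p s)) (c : S →₀ R) :
    altSum R f' (Finsupp.lmapDomain R R a c) = Finsupp.lmapDomain R R b (altSum R f c) := by
  induction c using Finsupp.induction_linear with
  | zero => simp
  | add x y hx hy => simp only [map_add, hx, hy]
  | single s r =>
    simp only [Finsupp.lmapDomain_apply, Finsupp.mapDomain_single, altSum_single,
      Finsupp.mapDomain_finsetSum, Finsupp.mapDomain_smul, h]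

theorem altSum_mem_supported {S T : Type*} {k : ℕ} (f : Fin (k + 2) → S → T) {P : Set S}
    {Q : Set T} (h : ∀ p, ∀ s ∈ P, f p s ∈ Q) {c : S →₀ R} (hc : c ∈ Finsupp.supported R R P) :
    altSum R f c ∈ Finsupp.supported R R Q := by
  simp only [altSum, LinearMap.sum_apply, LinearMap.smul_apply]
  refine Submodule.sum_mem _ fun p _ => Submodule.smul_mem _ _ ?_
  have := Finsupp.lmapDomain_supported (M := R) (R := R) (f p) P
  refine Finsupp.supported_mono (Set.image_subset_iff.2 (h p)) (this ▸ Submodule.mem_map_of_mem hc)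

theorem linearCombination_mem_of_supported {S M : Type*} [AddCommGroup M] [Module R M]
    (f : S → M) {P : Set S} (N : Submodule R M) (h : ∀ s ∈ P, f s ∈ N) {c : S →₀ R}
    (hc : c ∈ Finsupp.supported R R P) : Finsupp.linearCombination R f c ∈ N := by
  rw [Finsupp.linearCombination_apply]
  exact Submodule.sum_mem _ fun s hs => Submodule.smul_mem _ _ (h s (hc hs))

theorem linearMap_mem_of_supported {S M : Type*} [AddCommGroup M] [Module R M]
    (f : (S →₀ R) →ₗ[R] M) {P : Set S} (N : Submodule R M)
    (h : ∀ s ∈ P, f (Finsupp.single s 1) ∈ N) {c : S →₀ R}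
    (hc : c ∈ Finsupp.supported R R P) : f c ∈ N := by
  have : f = Finsupp.linearCombination R fun s => f (Finsupp.single s 1) := by
    ext s; simp
  rw [this]
  exact linearCombination_mem_of_supported _ N h hc

end AltSum

/-! ### Chains of vertex tuples -/

/-- Finite chains of `(m+1)`-tuples of elements of `Z`. -/
abbrev TupleChain (R : Type*) [CommRing R] (Z : Type*) (m : ℕ) : Type _ :=
  (Fin (m + 1) → Z) →₀ R

section Tuple

variable {R : Type*} [CommRing R] {Z Z' W W' : Type*}

/-- The boundary of a chain of tuples. -/
def tupleBoundary (m : ℕ) : TupleChain R Z (m + 1) →ₗ[R] TupleChain R Z m :=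
  altSum R fun p v => v ∘ p.succAbove

theorem tupleBoundary_tupleBoundary {m : ℕ} (c : TupleChain R Z (m + 2)) :
    tupleBoundary m (tupleBoundary (m + 1) c) = 0 := by
  refine altSum_altSum _ _ (fun i j h v => ?_) c
  funext q
  exact congrArg v (congrArg (fun f => SimplexCategory.Hom.toOrderHom f q)
    (SimplexCategory.δ_comp_δ h))

/-- The chain map induced by a function on vertices. -/
def tupleMap (f : Z → Z') (m : ℕ) : TupleChain R Z m →ₗ[R] TupleChain R Z' m :=
  Finsupp.lmapDomain R R fun v => f ∘ v

theorem tupleMap_single (f : Z → Z') {m : ℕ} (v : Fin (m + 1) → Z) (r : R) :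
    tupleMap f m (Finsupp.single v r) = Finsupp.single (f ∘ v) r := by
  simp [tupleMap, Finsupp.mapDomain_single]

theorem tupleBoundary_tupleMap (f : Z → Z') {m : ℕ} (c : TupleChain R Z (m + 1)) :
    tupleBoundary m (tupleMap f (m + 1) c) = tupleMap f m (tupleBoundary m c) := by
  rw [tupleBoundary, tupleBoundary, tupleMap, tupleMap]
  exact altSum_lmapDomain (fun (p : Fin (m + 2)) (v : Fin (m + 2) → Z) => v ∘ p.succAbove)
    (fun (p : Fin (m + 2)) (v : Fin (m + 2) → Z') => v ∘ p.succAbove) (fun v => f ∘ v)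
    (fun v => f ∘ v) (fun _ _ => rfl) c

/-- The cone with apex `b`. -/
def cone (b : Z) (m : ℕ) : TupleChain R Z m →ₗ[R] TupleChain R Z (m + 1) :=
  Finsupp.lmapDomain R R fun v => (Fin.cons b v : Fin (m + 2) → Z)

theorem cone_single (b : Z) {m : ℕ} (v : Fin (m + 1) → Z) (r : R) :
    cone b m (Finsupp.single v r) = Finsupp.single (Fin.cons b v : Fin (m + 2) → Z) r := by
  simp [cone, Finsupp.mapDomain_single]

theorem tupleMap_cone (f : Z → Z') (b : Z) {m : ℕ} (c : TupleChain R Z m) :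
    tupleMap f (m + 1) (cone b m c) = cone (f b) m (tupleMap f m c) := by
  induction c using Finsupp.induction_linear with
  | zero => simp
  | add x y hx hy => simp only [map_add, hx, hy]
  | single v r =>
    rw [cone_single, tupleMap_single, tupleMap_single, cone_single]
    congr 1
    funext i
    refine Fin.cases ?_ (fun i => ?_) i <;> simp

theorem cons_comp_zero_succAbove (b : Z) {m : ℕ} (v : Fin (m + 1) → Z) :
    (Fin.cons b v : Fin (m + 2) → Z) ∘ (0 : Fin (m + 2)).succAbove = v := by
  funext i; simp

theorem cons_comp_succ_succAbove (b : Z) {m : ℕ} (v : Fin (m + 2) → Z) (p : Fin (m + 2)) :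
    (Fin.cons b v : Fin (m + 3) → Z) ∘ p.succ.succAbove =
      (Fin.cons b (v ∘ p.succAbove) : Fin (m + 2) → Z) := by
  funext i
  refine Fin.cases ?_ (fun i => ?_) i <;> simp

/-- Deleting the apex returns the base. Every other face is the cone over a face of the base, with
its sign shifted by one. -/
theorem tupleBoundary_cone_succ (b : Z) {m : ℕ} (c : TupleChain R Z (m + 1)) :
    tupleBoundary (m + 1) (cone b (m + 1) c) = c - cone b m (tupleBoundary m c) := by
  induction c using Finsupp.induction_linear with
  | zero => simp
  | add x y hx hy => simp only [map_add, hx, hy]; abel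
  | single v r =>
    rw [cone_single]
    simp only [tupleBoundary, altSum_single, map_sum, map_smul, cone_single]
    rw [Fin.sum_univ_succ]
    simp only [cons_comp_zero_succAbove, cons_comp_succ_succAbove, Fin.val_zero, pow_zero,
      one_smul, Fin.val_succ, pow_succ, mul_neg, mul_one, neg_smul, Finset.sum_neg_distrib]
    abel

/-- The augmentation. -/
def augmentation : TupleChain R Z 0 →ₗ[R] R := Finsupp.linearCombination R fun _ => 1

/-- In the lowest degree the last face is the apex itself, so the augmentation replaces the coned
boundary. -/
theorem tupleBoundary_cone_zero (b : Z) (c : TupleChain R Z 0) :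
    tupleBoundary 0 (cone b 0 c) = c - Finsupp.single (fun _ => b) (augmentation c) := by
  induction c using Finsupp.induction_linear with
  | zero => simp
  | add x y hx hy => simp only [map_add, hx, hy, Finsupp.single_add]; abel
  | single v r =>
    rw [cone_single]
    have hs : ∀ g : Fin (0 + 2) → TupleChain R Z 0, ∑ p, g p = g 0 + g 1 := Fin.sum_univ_two
    simp only [tupleBoundary, altSum_single, augmentation, Finsupp.linearCombination_single, hs]
    have h1 : (Fin.cons b v : Fin 2 → Z) ∘ (1 : Fin 2).succAbove = fun _ => b := by
      funext i; fin_cases i; rfl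
    rw [cons_comp_zero_succAbove, h1]
    simp [sub_eq_add_neg]

theorem augmentation_tupleBoundary (c : TupleChain R Z 1) :
    augmentation (tupleBoundary 0 c) = 0 := by
  induction c using Finsupp.induction_linear with
  | zero => simp
  | add x y hx hy => simp only [map_add, hx, hy, add_zero]
  | single v r =>
    have hs : ∀ g : Fin (0 + 2) → TupleChain R Z 0, ∑ p, g p = g 0 + g 1 := Fin.sum_univ_two
    rw [tupleBoundary, altSum_single, hs, map_add, map_smul, map_smul, augmentation,
      Finsupp.linearCombination_single, Finsupp.linearCombination_single]
    simp

/-- A chain homotopy between two chain maps of chains of tuples, obtained by coning off. -/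
def coneHomotopy (φ ψ : ∀ m, TupleChain R Z m →ₗ[R] TupleChain R Z' m)
    (b : ∀ m, (Fin (m + 1) → Z) → Z') : ∀ m, TupleChain R Z m →ₗ[R] TupleChain R Z' (m + 1)
  | 0 => Finsupp.linearCombination R fun v =>
      cone (b 0 v) 0 (ψ 0 (Finsupp.single v 1) - φ 0 (Finsupp.single v 1))
  | m + 1 => Finsupp.linearCombination R fun v =>
      cone (b (m + 1) v) (m + 1) (ψ (m + 1) (Finsupp.single v 1) - φ (m + 1) (Finsupp.single v 1) -
        coneHomotopy φ ψ b m (tupleBoundary m (Finsupp.single v 1)))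

variable (φ ψ : ∀ m, TupleChain R Z m →ₗ[R] TupleChain R Z' m) (b : ∀ m, (Fin (m + 1) → Z) → Z')

theorem tupleBoundary_coneHomotopy_zero
    (haug : ∀ c, augmentation (ψ 0 c) = augmentation (φ 0 c)) (c : TupleChain R Z 0) :
    tupleBoundary 0 (coneHomotopy φ ψ b 0 c) = ψ 0 c - φ 0 c := by
  suffices h : tupleBoundary 0 ∘ₗ coneHomotopy φ ψ b 0 = ψ 0 - φ 0 from LinearMap.congr_fun h c
  refine Finsupp.lhom_ext' fun v => LinearMap.ext_ring ?_
  simp [coneHomotopy, tupleBoundary_cone_zero, haug]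

/-- This is the acyclic models argument: the chain to be filled is already a cycle by the homotopy
formula one degree lower, and a cone fills a cycle. -/
theorem tupleBoundary_coneHomotopy_succ
    (haug : ∀ c, augmentation (ψ 0 c) = augmentation (φ 0 c))
    (hφ : ∀ m c, tupleBoundary m (φ (m + 1) c) = φ m (tupleBoundary m c))
    (hψ : ∀ m c, tupleBoundary m (ψ (m + 1) c) = ψ m (tupleBoundary m c)) :
    ∀ (m : ℕ) (c : TupleChain R Z (m + 1)),
    tupleBoundary (m + 1) (coneHomotopy φ ψ b (m + 1) c) +
      coneHomotopy φ ψ b m (tupleBoundary m c) = ψ (m + 1) c - φ (m + 1) c := by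
  intro m
  suffices h : tupleBoundary (m + 1) ∘ₗ coneHomotopy φ ψ b (m + 1) +
      coneHomotopy φ ψ b m ∘ₗ tupleBoundary m = ψ (m + 1) - φ (m + 1) from
    fun c => LinearMap.congr_fun h c
  refine Finsupp.lhom_ext' fun v => LinearMap.ext_ring ?_
  -- The chain being coned is a cycle, so the correction term in the cone formula vanishes. In the
  -- lowest degree equality of augmentations plays the role of the previous instance of the theorem.
  have key : tupleBoundary m (ψ (m + 1) (Finsupp.single v 1) - φ (m + 1) (Finsupp.single v 1) -
        coneHomotopy φ ψ b m (tupleBoundary m (Finsupp.single v 1))) = 0 := by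
    cases m with
    | zero =>
      rw [map_sub, map_sub, tupleBoundary_coneHomotopy_zero φ ψ b haug, hφ, hψ, sub_self]
    | succ m =>
      have ih := tupleBoundary_coneHomotopy_succ haug hφ hψ m
        (tupleBoundary (m + 1) (Finsupp.single v 1))
      rw [tupleBoundary_tupleBoundary, map_zero, add_zero] at ih
      rw [map_sub, map_sub, ih, hφ, hψ, sub_self]
  simp only [LinearMap.coe_comp, Function.comp_apply, LinearMap.add_apply, LinearMap.sub_apply,
    Finsupp.lsingle_apply]
  conv_lhs => enter [1, 2]; rw [coneHomotopy]
  rw [Finsupp.linearCombination_single, one_smul, tupleBoundary_cone_succ, key, map_zero]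
  abel

/-- Naturality survives the recursion as soon as the apices correspond under `f'`. With face
inclusions as the vertex maps, it makes the universal chains on the various `Δ^k` compatible. -/
theorem tupleMap_coneHomotopy (f : Z → W) (f' : Z' → W')
    (φ' ψ' : ∀ m, TupleChain R W m →ₗ[R] TupleChain R W' m) (b' : ∀ m, (Fin (m + 1) → W) → W')
    (hφ : ∀ m c, tupleMap f' m (φ m c) = φ' m (tupleMap f m c))
    (hψ : ∀ m c, tupleMap f' m (ψ m c) = ψ' m (tupleMap f m c))
    (hb : ∀ m v, f' (b m v) = b' m (f ∘ v)) (m : ℕ) (c : TupleChain R Z m) :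
    tupleMap f' (m + 1) (coneHomotopy φ ψ b m c) = coneHomotopy φ' ψ' b' m (tupleMap f m c) := by
  suffices h : ∀ m, tupleMap f' (m + 1) ∘ₗ coneHomotopy φ ψ b m =
      coneHomotopy φ' ψ' b' m ∘ₗ tupleMap f m from LinearMap.congr_fun (h m) c
  intro m
  induction m with
  | zero =>
    refine Finsupp.lhom_ext' fun v => LinearMap.ext_ring ?_
    simp [coneHomotopy, tupleMap_single, tupleMap_cone, hφ, hψ, hb]
  | succ m ih =>
    refine Finsupp.lhom_ext' fun v => LinearMap.ext_ring ?_
    have ih' := fun c => LinearMap.congr_fun ih c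
    simp only [LinearMap.coe_comp, Function.comp_apply] at ih'
    simp [coneHomotopy, tupleMap_single, tupleMap_cone, hφ, hψ, hb, ih', ← tupleBoundary_tupleMap]

/-- Barycentric subdivision of chains of tuples, relative to a choice `b` of barycenters. -/
def tupleSd (b : ∀ m, (Fin (m + 1) → Z) → Z) : ∀ m, TupleChain R Z m →ₗ[R] TupleChain R Z m
  | 0 => LinearMap.id
  | m + 1 => Finsupp.linearCombination R fun v =>
      cone (b (m + 1) v) m (tupleSd b m (tupleBoundary m (Finsupp.single v 1)))

/-- The subdivided boundary is a cycle by the previous degree, so coning it off has exactly it as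
boundary. For edges, the augmentation of a boundary is zero. -/
theorem tupleBoundary_tupleSd (b : ∀ m, (Fin (m + 1) → Z) → Z) :
    ∀ (m : ℕ) (c : TupleChain R Z (m + 1)),
    tupleBoundary m (tupleSd b (m + 1) c) = tupleSd b m (tupleBoundary m c) := by
  intro m
  suffices h : tupleBoundary m ∘ₗ tupleSd b (m + 1) = tupleSd b m ∘ₗ tupleBoundary (R := R) m from
    fun c => LinearMap.congr_fun h c
  refine Finsupp.lhom_ext' fun v => LinearMap.ext_ring ?_
  simp only [LinearMap.coe_comp, Function.comp_apply, Finsupp.lsingle_apply]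
  conv_lhs => enter [2]; rw [tupleSd]
  rw [Finsupp.linearCombination_single, one_smul]
  cases m with
  | zero =>
    rw [tupleBoundary_cone_zero]
    simp [tupleSd, augmentation_tupleBoundary]
  | succ m =>
    rw [tupleBoundary_cone_succ, tupleBoundary_tupleSd b m, tupleBoundary_tupleBoundary]
    simp

theorem tupleMap_tupleSd (f : Z → W) (b : ∀ m, (Fin (m + 1) → Z) → Z)
    (b' : ∀ m, (Fin (m + 1) → W) → W) (hb : ∀ m v, f (b m v) = b' m (f ∘ v)) (m : ℕ)
    (c : TupleChain R Z m) :
    tupleMap f m (tupleSd b m c) = tupleSd b' m (tupleMap f m c) := by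
  suffices h : ∀ m, tupleMap f m ∘ₗ tupleSd b m =
      tupleSd b' m ∘ₗ tupleMap (R := R) f m from LinearMap.congr_fun (h m) c
  intro m
  induction m with
  | zero => rfl
  | succ m ih =>
    refine Finsupp.lhom_ext' fun v => LinearMap.ext_ring ?_
    have ih' := fun c => LinearMap.congr_fun ih c
    simp only [LinearMap.coe_comp, Function.comp_apply] at ih'
    simp [tupleSd, tupleMap_single, tupleMap_cone, hb, ih', ← tupleBoundary_tupleMap]

theorem tupleSd_mem_supported (b : ∀ m, (Fin (m + 1) → Z) → Z) (Q : Set Z)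
    (hQ : ∀ m v, (∀ i, v i ∈ Q) → b m v ∈ Q) :
    ∀ (m : ℕ) {c : TupleChain R Z m}, c ∈ Finsupp.supported R R {v | ∀ i, v i ∈ Q} →
    tupleSd b m c ∈ Finsupp.supported R R {v : Fin (m + 1) → Z | ∀ i, v i ∈ Q}
  | 0, _, hc => hc
  | m + 1, c, hc => by
    refine linearCombination_mem_of_supported _ _ (fun v hv => ?_) hc
    have h1 : tupleBoundary m (Finsupp.single v (1 : R)) ∈
        Finsupp.supported R R {v : Fin (m + 1) → Z | ∀ i, v i ∈ Q} :=
      altSum_mem_supported _ (P := {v}) (by rintro p _ rfl i; exact hv _)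
        (Finsupp.single_mem_supported R 1 rfl)
    refine linearMap_mem_of_supported (cone _ m) _ (fun w hw => ?_)
      (tupleSd_mem_supported b Q hQ m h1)
    rw [cone_single]
    refine Finsupp.single_mem_supported R 1 fun i => ?_
    refine Fin.cases ?_ (fun i => ?_) i
    · simpa using hQ _ _ hv
    · simpa using hw i

/-- The mesh estimate. A new tuple is a barycenter followed by a tuple from a subdivided face. The
latter has small spread by recursion, and its distance to the barycenter is controlled because a
closed ball about the barycenter is stable under taking further barycenters. -/
theorem tupleSd_mem_supported_dist {Z : Type*} [PseudoMetricSpace Z]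
    (b : ∀ m, (Fin (m + 1) → Z) → Z)
    (hball : ∀ z r m v, (∀ i, v i ∈ Metric.closedBall z r) → b m v ∈ Metric.closedBall z r)
    (hb : ∀ m v D, (∀ i j, dist (v i) (v j) ≤ D) →
      ∀ i, dist (b m v) (v i) ≤ (m / (m + 1) : ℝ) * D) (D : ℝ) :
    ∀ (m : ℕ) {c : TupleChain R Z m},
      c ∈ Finsupp.supported R R {v | ∀ i j, dist (v i) (v j) ≤ D} →
    tupleSd b m c ∈ Finsupp.supported R R
      {v : Fin (m + 1) → Z | ∀ i j, dist (v i) (v j) ≤ (m / (m + 1) : ℝ) * D}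
  | 0, c, hc => by
    have : ∀ v : Fin 1 → Z, ∀ i j, dist (v i) (v j) = 0 := fun v i j => by
      rw [Subsingleton.elim i j, dist_self]
    simp only [this, CharP.cast_eq_zero, zero_div, zero_mul, le_refl, implies_true, Set.ofPred_true,
      Finsupp.supported_univ, Submodule.mem_top]
  | m + 1, c, hc => by
    refine linearCombination_mem_of_supported _ _ (fun v hv => ?_) hc
    have hD : 0 ≤ D := dist_nonneg.trans (hv 0 0)
    have hbv := hb _ v D hv
    set r : ℝ := ((m + 1 : ℕ) / ((m + 1 : ℕ) + 1) : ℝ) * D with hr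
    -- The contraction factor increases with the dimension, so the bound for faces is at least as
    -- good as the one wanted.
    have hle : (m / (m + 1) : ℝ) * D ≤ r := by
      rw [hr]
      refine mul_le_mul_of_nonneg_right ?_ hD
      rw [div_le_div_iff₀ (by positivity) (by positivity)]
      push_cast
      nlinarith
    have h1 : ∀ P : Set (Fin (m + 1) → Z), (∀ p : Fin (m + 2), v ∘ p.succAbove ∈ P) →
        tupleBoundary m (Finsupp.single v (1 : R)) ∈ Finsupp.supported R R P := fun P hP =>
      altSum_mem_supported _ (P := {v}) (by rintro p _ rfl; exact hP p)
        (Finsupp.single_mem_supported R 1 rfl)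
    have h2 := tupleSd_mem_supported_dist b hball hb D m (h1 _ fun p i j => hv _ _)
    -- The ball about the barycenter contains every vertex of `v`, hence every vertex of the
    -- subdivided faces.
    have h3 := tupleSd_mem_supported b (Metric.closedBall (b (m + 1) v) r) (hball _ _) m
      (h1 _ fun p i => Metric.mem_closedBall'.2 (hbv _))
    have h4 : tupleSd b m (tupleBoundary m (Finsupp.single v (1 : R))) ∈
        Finsupp.supported R R ({v : Fin (m + 1) → Z |
          ∀ i j, dist (v i) (v j) ≤ (m / (m + 1) : ℝ) * D} ∩
          {w | ∀ i, w i ∈ Metric.closedBall (b (m + 1) v) r}) := by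
      rw [Finsupp.supported_inter]
      exact ⟨h2, h3⟩
    refine linearMap_mem_of_supported (cone _ m) _ (fun w hw => ?_) h4
    rw [cone_single]
    refine Finsupp.single_mem_supported R 1 fun i j => ?_
    have hr0 : 0 ≤ r := by positivity
    refine Fin.cases ?_ (fun i => ?_) i <;> refine Fin.cases ?_ (fun j => ?_) j
    · simpa using hr0
    · simpa [dist_comm] using Metric.mem_closedBall'.1 (hw.2 j)
    · simpa using Metric.mem_closedBall.1 (hw.2 i)
    · simpa using (hw.1 i j).trans hle

end Tuple

/-! ### Affine simplices in the standard simplex -/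

/-- The affine singular simplex of the standard simplex with given vertices. -/
def affine {k m : ℕ} (w : Fin (m + 1) → stdSimplex ℝ (Fin (k + 1))) :
    Simplex m (stdSimplex ℝ (Fin (k + 1))) where
  toFun t := ⟨∑ i, t.1 i • (w i).1, (convex_stdSimplex ℝ _).sum_mem (fun i _ => t.2.1 i) t.2.2
    fun i _ => (w i).2⟩
  continuous_toFun := by
    refine Continuous.subtype_mk (continuous_finsetSum _ fun i _ => ?_) _
    exact ((continuous_apply i).comp continuous_subtype_val).smul continuous_const

theorem affine_apply {k m : ℕ} (w : Fin (m + 1) → stdSimplex ℝ (Fin (k + 1)))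
    (t : stdSimplex ℝ (Fin (m + 1))) : (affine w t).1 = ∑ i, t.1 i • (w i).1 := rfl

theorem affine_map {j k m : ℕ} (w : Fin (m + 1) → stdSimplex ℝ (Fin (k + 1)))
    (f : Fin (j + 1) → Fin (m + 1)) (t : stdSimplex ℝ (Fin (j + 1))) :
    affine w (stdSimplex.map f t) = affine (w ∘ f) t := by
  apply Subtype.ext
  rw [affine_apply, affine_apply]
  have h : ∀ i, (stdSimplex.map f t).1 i = ∑ j, if f j = i then t.1 j else 0 := fun i => by
    change FunOnFinite.linearMap ℝ ℝ f t i = _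
    rw [FunOnFinite.linearMap_apply_apply, Finset.sum_filter]
    rfl
  simp only [h, Finset.sum_smul, ite_smul, zero_smul]
  rw [Finset.sum_comm]
  simp

/-- The vertices of the standard simplex. -/
def vertices (k : ℕ) (i : Fin (k + 1)) : stdSimplex ℝ (Fin (k + 1)) := stdSimplex.vertex i

theorem affine_vertices (k : ℕ) (t : stdSimplex ℝ (Fin (k + 1))) : affine (vertices k) t = t := by
  apply Subtype.ext
  rw [affine_apply]
  funext j
  simp [vertices, Finset.sum_apply, Pi.single_apply]

theorem affine_affine {j k m : ℕ} (u : Fin (k + 1) → stdSimplex ℝ (Fin (j + 1)))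
    (w : Fin (m + 1) → stdSimplex ℝ (Fin (k + 1))) (t : stdSimplex ℝ (Fin (m + 1))) :
    affine u (affine w t) = affine (affine u ∘ w) t := by
  apply Subtype.ext
  simp only [affine_apply, Function.comp_apply, Finset.sum_apply, Pi.smul_apply, smul_eq_mul,
    Finset.sum_smul, Finset.smul_sum]
  rw [Finset.sum_comm]
  simp only [mul_smul]

theorem affine_const {k m : ℕ} (z : stdSimplex ℝ (Fin (k + 1))) (t : stdSimplex ℝ (Fin (m + 1))) :
    affine (fun _ => z) t = z := by
  apply Subtype.ext
  rw [affine_apply, ← Finset.sum_smul, t.2.2, one_smul]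

theorem faceInclusion_apply (k : ℕ) (p : Fin (k + 2)) (t : stdSimplex ℝ (Fin (k + 1))) :
    faceInclusion k p t = affine (vertices (k + 1) ∘ p.succAbove) t := by
  rw [← affine_map, affine_vertices]
  rfl

theorem faceInclusion_comp_vertices (k : ℕ) (p : Fin (k + 2)) :
    faceInclusion k p ∘ vertices k = vertices (k + 1) ∘ p.succAbove := by
  funext i
  exact stdSimplex.map_vertex _ _

theorem affine_faceInclusion {k m : ℕ} (w : Fin (m + 2) → stdSimplex ℝ (Fin (k + 1)))
    (p : Fin (m + 2)) (t : stdSimplex ℝ (Fin (m + 1))) :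
    affine w (faceInclusion m p t) = affine (w ∘ p.succAbove) t :=
  affine_map w _ t

theorem faceInclusion_affine {k m : ℕ} (w : Fin (m + 1) → stdSimplex ℝ (Fin (k + 1)))
    (p : Fin (k + 2)) (t : stdSimplex ℝ (Fin (m + 1))) :
    faceInclusion k p (affine w t) = affine (faceInclusion k p ∘ w) t := by
  rw [faceInclusion_apply, affine_affine]
  congr 2
  funext i
  exact (faceInclusion_apply k p _).symm

/-- The barycenter of a tuple of points. -/
def bary (k m : ℕ) (w : Fin (m + 1) → stdSimplex ℝ (Fin (k + 1))) : stdSimplex ℝ (Fin (k + 1)) :=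
  affine w stdSimplex.barycenter

theorem affine_mem_closedBall {k m : ℕ} {w : Fin (m + 1) → stdSimplex ℝ (Fin (k + 1))}
    {z : stdSimplex ℝ (Fin (k + 1))} {r : ℝ} (h : ∀ i, w i ∈ Metric.closedBall z r)
    (t : stdSimplex ℝ (Fin (m + 1))) : affine w t ∈ Metric.closedBall z r := by
  have := (convex_closedBall z.1 r).sum_mem (t := Finset.univ) (w := t.1)
    (z := fun i => (w i).1) (fun i _ => t.2.1 i) t.2.2 (fun i _ => h i)
  exact this

/-- The difference between the barycenter and a vertex is the average of the differences `v j - v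
i`. The one with `j = i` is zero, so only `m` of the `m + 1` terms contribute. -/
theorem dist_bary_le (k m : ℕ) (v : Fin (m + 1) → stdSimplex ℝ (Fin (k + 1))) (D : ℝ)
    (h : ∀ i j, dist (v i) (v j) ≤ D) (i : Fin (m + 1)) :
    dist (bary k m v) (v i) ≤ (m / (m + 1) : ℝ) * D := by
  have hm : (0 : ℝ) < m + 1 := by positivity
  change dist (bary k m v).1 (v i).1 ≤ _
  have h1 : (bary k m v).1 - (v i).1 = ((m : ℝ) + 1)⁻¹ • ∑ j, ((v j).1 - (v i).1) := by
    rw [bary, affine_apply, Finset.sum_sub_distrib, smul_sub, Finset.smul_sum]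
    congr 1
    · refine Finset.sum_congr rfl fun j _ => ?_
      rw [stdSimplex.barycenter_apply, Fintype.card_fin]
      push_cast; rfl
    · rw [Finset.sum_const, Finset.card_univ, Fintype.card_fin, ← Nat.cast_smul_eq_nsmul ℝ,
        smul_smul]
      push_cast
      rw [inv_mul_cancel₀ hm.ne', one_smul]
  rw [dist_eq_norm, h1, norm_smul, Real.norm_of_nonneg (by positivity), div_eq_inv_mul, mul_assoc]
  refine mul_le_mul_of_nonneg_left ?_ (by positivity)
  rw [← Finset.sum_erase Finset.univ (a := i) (sub_self (v i).1)]
  refine (norm_sum_le_of_le _ (n := fun _ => D) fun j _ => ?_).trans (le_of_eq ?_)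
  · rw [← dist_eq_norm]; exact h j i
  · rw [Finset.sum_const, Finset.card_erase_of_mem (Finset.mem_univ i), Finset.card_univ,
      Fintype.card_fin, Nat.add_sub_cancel, nsmul_eq_mul]

/-! ### Finite singular chains -/

/-- Finite singular chains. -/
abbrev FinChain (R : Type*) [CommRing R] (X : Type*) [TopologicalSpace X] (k : ℕ) : Type _ :=
  Simplex k X →₀ R

section FinChain

variable {R : Type*} [CommRing R] {X Y : Type*} [TopologicalSpace X] [TopologicalSpace Y]

/-- The boundary of a finite singular chain. -/
def finBoundary (k : ℕ) : FinChain R X (k + 1) →ₗ[R] FinChain R X k := altSum R face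

theorem finBoundary_finBoundary {k : ℕ} (c : FinChain R X (k + 2)) :
    finBoundary k (finBoundary (k + 1) c) = 0 :=
  altSum_altSum _ _ (fun _ _ h σ => face_face h σ) c

/-- The chain map induced by a continuous map. -/
def finPush (f : C(X, Y)) (k : ℕ) : FinChain R X k →ₗ[R] FinChain R Y k :=
  Finsupp.lmapDomain R R fun σ => f.comp σ

theorem finPush_single (f : C(X, Y)) {k : ℕ} (σ : Simplex k X) (r : R) :
    finPush f k (Finsupp.single σ r) = Finsupp.single (f.comp σ) r := by
  simp [finPush, Finsupp.mapDomain_single]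

theorem finBoundary_finPush (f : C(X, Y)) {k : ℕ} (c : FinChain R X (k + 1)) :
    finBoundary k (finPush f (k + 1) c) = finPush f k (finBoundary k c) := by
  rw [finBoundary, finPush, finPush, finBoundary]
  exact altSum_lmapDomain face face (fun σ => f.comp σ) (fun σ => f.comp σ) (fun _ _ => rfl) c

/-! ### Operators defined on models -/

section Model

variable {Z : ℕ → Type*} (ρ : ∀ k, Simplex k X → ∀ m, (Fin (m + 1) → Z k) → Simplex m Y)

/-- The operator sending a simplex `σ` to the realization along `σ` of a universal chain. -/
def modelOp {k m : ℕ} (θ : TupleChain R (Z k) m) : FinChain R X k →ₗ[R] FinChain R Y m :=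
  Finsupp.linearCombination R fun σ => Finsupp.lmapDomain R R (ρ k σ m) θ

theorem modelOp_single {k m : ℕ} (θ : TupleChain R (Z k) m) (σ : Simplex k X) :
    modelOp ρ θ (Finsupp.single σ 1) = Finsupp.lmapDomain R R (ρ k σ m) θ := by
  rw [modelOp, Finsupp.linearCombination_single, one_smul]

theorem finBoundary_realize
    (hρ : ∀ k σ m (v : Fin (m + 2) → Z k) p, face p (ρ k σ (m + 1) v) = ρ k σ m (v ∘ p.succAbove))
    {k m : ℕ} (σ : Simplex k X) (θ : TupleChain R (Z k) (m + 1)) :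
    finBoundary m (Finsupp.lmapDomain R R (ρ k σ (m + 1)) θ) =
      Finsupp.lmapDomain R R (ρ k σ m) (tupleBoundary m θ) :=
  altSum_lmapDomain _ _ _ _ (fun p v => hρ k σ m v p) θ

/-- If `θ`, transported along each face inclusion, is `G` of that face, then applying `θ` to the
faces of `σ` amounts to applying `G` to the boundary of the identity simplex of `Δ^{k+1}`.
Identities for singular chains thus reduce to identities for tuples in one model. -/
theorem modelOp_finBoundary (j : ∀ k, Fin (k + 2) → Z k → Z (k + 1))
    (hj : ∀ k σ p m (w : Fin (m + 1) → Z k), ρ k (face p σ) m w = ρ (k + 1) σ m (j k p ∘ w))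
    {k m : ℕ} (θ : TupleChain R (Z k) m)
    (G : TupleChain R (stdSimplex ℝ (Fin (k + 2))) k →ₗ[R] TupleChain R (Z (k + 1)) m)
    (hG : ∀ p, tupleMap (j k p) m θ = G (Finsupp.single (vertices (k + 1) ∘ p.succAbove) 1))
    (σ : Simplex (k + 1) X) :
    modelOp ρ θ (finBoundary k (Finsupp.single σ 1)) = Finsupp.lmapDomain R R (ρ (k + 1) σ m)
      (G (tupleBoundary k (Finsupp.single (vertices (k + 1)) 1))) := by
  simp only [finBoundary, tupleBoundary, altSum_single, map_sum, map_smul, modelOp_single, ← hG]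
  refine Finset.sum_congr rfl fun p _ => ?_
  congr 1
  rw [tupleMap, Finsupp.lmapDomain_apply, Finsupp.lmapDomain_apply, Finsupp.lmapDomain_apply,
    ← Finsupp.mapDomain_comp]
  congr 1
  funext w
  exact hj k σ p m w

end Model

/-! ### Carried operators -/

/-- An operator is carried if it sends every simplex to a chain in the image of that simplex. -/
def Carried {k m : ℕ} (Φ : FinChain R X k →ₗ[R] FinChain R X m) : Prop :=
  ∀ σ : Simplex k X, Φ (Finsupp.single σ 1) ∈
    Finsupp.supported R R {τ : Simplex m X | Set.range τ ⊆ Set.range σ}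

theorem Carried.mem_supported {k m : ℕ} {Φ : FinChain R X k →ₗ[R] FinChain R X m} (hΦ : Carried Φ)
    {P : Set (Simplex k X)} {Q : Set (Simplex m X)}
    (h : ∀ σ ∈ P, ∀ τ : Simplex m X, Set.range τ ⊆ Set.range σ → τ ∈ Q)
    {c : FinChain R X k} (hc : c ∈ Finsupp.supported R R P) : Φ c ∈ Finsupp.supported R R Q :=
  linearMap_mem_of_supported Φ _ (fun σ hσ => Finsupp.supported_mono (h σ hσ) (hΦ σ)) hc

theorem Carried.comp {k l m : ℕ} {Ψ : FinChain R X l →ₗ[R] FinChain R X m}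
    {Φ : FinChain R X k →ₗ[R] FinChain R X l} (hΨ : Carried Ψ) (hΦ : Carried Φ) :
    Carried (Ψ ∘ₗ Φ) := fun σ =>
  hΨ.mem_supported (fun _ h _ h' => h'.trans h) (hΦ σ)

theorem Carried.sub {k m : ℕ} {Φ Ψ : FinChain R X k →ₗ[R] FinChain R X m}
    (hΦ : Carried Φ) (hΨ : Carried Ψ) : Carried (Φ - Ψ) := fun σ =>
  Submodule.sub_mem _ (hΦ σ) (hΨ σ)

theorem Carried.sum {ι : Type*} (s : Finset ι) {k m : ℕ}
    {Φ : ι → FinChain R X k →ₗ[R] FinChain R X m} (hΦ : ∀ i, Carried (Φ i)) :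
    Carried (∑ i ∈ s, Φ i) := fun σ => by
  rw [LinearMap.sum_apply]
  exact Submodule.sum_mem _ fun i _ => hΦ i σ

theorem carried_id (k : ℕ) : Carried (LinearMap.id : FinChain R X k →ₗ[R] FinChain R X k) :=
  fun σ => Finsupp.single_mem_supported R 1 (Set.Subset.refl (Set.range σ))

theorem carried_finBoundary (k : ℕ) : Carried (finBoundary (R := R) (X := X) k) := fun σ =>
  altSum_mem_supported _ (P := {σ})
    (by rintro p _ rfl; exact range_face_subset p _) (Finsupp.single_mem_supported R 1 rfl)

theorem carried_modelOp {Z : ℕ → Type*}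
    (ρ : ∀ k, Simplex k X → ∀ m, (Fin (m + 1) → Z k) → Simplex m X)
    (hρ : ∀ k σ m w, Set.range (ρ k σ m w) ⊆ Set.range σ) {k m : ℕ} (θ : TupleChain R (Z k) m) :
    Carried (modelOp ρ θ) := fun σ => by
  rw [modelOp_single]
  refine linearMap_mem_of_supported _ (P := Set.univ) _ (fun w _ => ?_)
    (by rw [Finsupp.supported_univ]; trivial)
  rw [Finsupp.lmapDomain_apply, Finsupp.mapDomain_single]
  exact Finsupp.single_mem_supported R 1 (hρ k σ m w)

/-! ### Barycentric subdivision -/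

/-- The simplex obtained by restricting `σ` to the affine simplex with vertices `w`. -/
def subSimplex (k : ℕ) (σ : Simplex k X) (m : ℕ) (w : Fin (m + 1) → stdSimplex ℝ (Fin (k + 1))) :
    Simplex m X := σ.comp (affine w)

theorem range_subSimplex (k : ℕ) (σ : Simplex k X) (m : ℕ)
    (w : Fin (m + 1) → stdSimplex ℝ (Fin (k + 1))) :
    Set.range (subSimplex k σ m w) ⊆ Set.range σ := by
  rintro _ ⟨t, rfl⟩
  exact ⟨_, rfl⟩

theorem face_subSimplex (k : ℕ) (σ : Simplex k X) (m : ℕ)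
    (w : Fin (m + 2) → stdSimplex ℝ (Fin (k + 1))) (p : Fin (m + 2)) :
    face p (subSimplex k σ (m + 1) w) = subSimplex k σ m (w ∘ p.succAbove) := by
  ext t
  exact congrArg σ (affine_faceInclusion w p t)

theorem subSimplex_face (k : ℕ) (σ : Simplex (k + 1) X) (p : Fin (k + 2)) (m : ℕ)
    (w : Fin (m + 1) → stdSimplex ℝ (Fin (k + 1))) :
    subSimplex k (face p σ) m w = subSimplex (k + 1) σ m (faceInclusion k p ∘ w) := by
  ext t
  exact congrArg σ (faceInclusion_affine w p t)

theorem subSimplex_vertices (k : ℕ) (σ : Simplex k X) : subSimplex k σ k (vertices k) = σ := by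
  ext t
  exact congrArg σ (affine_vertices k t)

theorem subSimplex_subSimplex (k : ℕ) (σ : Simplex k X) (m : ℕ)
    (w : Fin (m + 1) → stdSimplex ℝ (Fin (k + 1))) (l : ℕ)
    (u : Fin (l + 1) → stdSimplex ℝ (Fin (m + 1))) :
    subSimplex m (subSimplex k σ m w) l u = subSimplex k σ l (affine w ∘ u) := by
  ext t
  exact congrArg σ (affine_affine w u t)

theorem modelOp_subSimplex_vertices (k : ℕ) (σ : Simplex k X) :
    modelOp subSimplex (Finsupp.single (vertices k) 1) (Finsupp.single σ (1 : R)) =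
      Finsupp.single σ 1 := by
  rw [modelOp_single, Finsupp.lmapDomain_apply, Finsupp.mapDomain_single, subSimplex_vertices]

variable (R X) in
/-- Barycentric subdivision of finite singular chains. -/
def subdivision (k : ℕ) : FinChain R X k →ₗ[R] FinChain R X k :=
  modelOp subSimplex (tupleSd (bary k) k (Finsupp.single (vertices k) 1))

/-- The chain homotopy from subdivision to the identity, on tuples. -/
def tupleSdHomotopy (k m : ℕ) : TupleChain R (stdSimplex ℝ (Fin (k + 1))) m →ₗ[R]
    TupleChain R (stdSimplex ℝ (Fin (k + 1))) (m + 1) :=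
  coneHomotopy (tupleSd (bary k)) (fun _ => LinearMap.id) (bary k) m

variable (R X) in
/-- The chain homotopy from subdivision to the identity. -/
def subdivisionHomotopy (k : ℕ) : FinChain R X k →ₗ[R] FinChain R X (k + 1) :=
  modelOp subSimplex (tupleSdHomotopy k k (Finsupp.single (vertices k) 1))

theorem carried_subdivision (k : ℕ) : Carried (subdivision R X k) :=
  carried_modelOp _ range_subSimplex _

theorem carried_subdivisionHomotopy (k : ℕ) : Carried (subdivisionHomotopy R X k) :=
  carried_modelOp _ range_subSimplex _

theorem affine_bary {j k m : ℕ} (u : Fin (k + 1) → stdSimplex ℝ (Fin (j + 1)))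
    (v : Fin (m + 1) → stdSimplex ℝ (Fin (k + 1))) :
    affine u (bary k m v) = bary j m (affine u ∘ v) :=
  affine_affine u v _

theorem faceInclusion_bary {k m : ℕ} (p : Fin (k + 2))
    (v : Fin (m + 1) → stdSimplex ℝ (Fin (k + 1))) :
    faceInclusion k p (bary k m v) = bary (k + 1) m (faceInclusion k p ∘ v) :=
  faceInclusion_affine v p _

/-- Both sides are realizations along `σ` of the same chain of tuples in the model simplex:
naturality handles the faces, and the identity itself is `tupleBoundary_tupleSd`. -/
theorem finBoundary_subdivision {k : ℕ} (c : FinChain R X (k + 1)) :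
    finBoundary k (subdivision R X (k + 1) c) = subdivision R X k (finBoundary k c) := by
  suffices h : finBoundary k ∘ₗ subdivision R X (k + 1) = subdivision R X k ∘ₗ finBoundary k from
    LinearMap.congr_fun h c
  refine Finsupp.lhom_ext' fun σ => LinearMap.ext_ring ?_
  have e1 := finBoundary_realize subSimplex face_subSimplex σ
    (tupleSd (R := R) (bary (k + 1)) (k + 1) (Finsupp.single (vertices (k + 1)) 1))
  have e2 := modelOp_finBoundary subSimplex (fun k p => ⇑(faceInclusion k p)) subSimplex_face
    (tupleSd (R := R) (bary k) k (Finsupp.single (vertices k) 1)) (tupleSd (bary (k + 1)) k)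
    (fun p => by
      rw [tupleMap_tupleSd _ _ _ (fun _ => faceInclusion_bary p), tupleMap_single,
        faceInclusion_comp_vertices]) σ
  rw [tupleBoundary_tupleSd] at e1
  rw [← modelOp_single] at e1
  exact e1.trans e2.symm

theorem subdivisionHomotopy_zero (c : FinChain R X 0) :
    finBoundary 0 (subdivisionHomotopy R X 0 c) = c - subdivision R X 0 c := by
  suffices h : finBoundary 0 ∘ₗ subdivisionHomotopy R X 0 = LinearMap.id - subdivision R X 0 from
    LinearMap.congr_fun h c
  refine Finsupp.lhom_ext' fun σ => LinearMap.ext_ring ?_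
  have e1 := finBoundary_realize subSimplex face_subSimplex σ
    (tupleSdHomotopy (R := R) 0 0 (Finsupp.single (vertices 0) 1))
  have e3 := tupleBoundary_coneHomotopy_zero (R := R) (tupleSd (bary 0))
    (fun _ => LinearMap.id) (bary 0) (fun _ => rfl) (Finsupp.single (vertices 0) 1)
  rw [← modelOp_single, tupleSdHomotopy, e3, map_sub, LinearMap.id_apply,
    Finsupp.lmapDomain_apply, Finsupp.mapDomain_single, subSimplex_vertices,
    ← modelOp_single] at e1
  exact e1

theorem subdivisionHomotopy_succ {k : ℕ} (c : FinChain R X (k + 1)) :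
    finBoundary (k + 1) (subdivisionHomotopy R X (k + 1) c) +
      subdivisionHomotopy R X k (finBoundary k c) = c - subdivision R X (k + 1) c := by
  suffices h : finBoundary (k + 1) ∘ₗ subdivisionHomotopy R X (k + 1) +
      subdivisionHomotopy R X k ∘ₗ finBoundary k = LinearMap.id - subdivision R X (k + 1) from
    LinearMap.congr_fun h c
  refine Finsupp.lhom_ext' fun σ => LinearMap.ext_ring ?_
  have e1 := finBoundary_realize subSimplex face_subSimplex σ
    (tupleSdHomotopy (R := R) (k + 1) (k + 1) (Finsupp.single (vertices (k + 1)) 1))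
  have e2 := modelOp_finBoundary subSimplex (fun k p => ⇑(faceInclusion k p)) subSimplex_face
    (tupleSdHomotopy (R := R) k k (Finsupp.single (vertices k) 1)) (tupleSdHomotopy (k + 1) k)
    (fun p => by
      rw [tupleSdHomotopy, tupleMap_coneHomotopy _ _ _ _ (faceInclusion k p)
        (tupleSd (bary (k + 1))) (fun _ => LinearMap.id) (bary (k + 1))
        (tupleMap_tupleSd _ _ _ (fun _ => faceInclusion_bary p)) (fun _ _ => rfl)
        (fun _ => faceInclusion_bary p), tupleMap_single, faceInclusion_comp_vertices]
      rfl) σ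
  have e3 := tupleBoundary_coneHomotopy_succ (R := R) (tupleSd (bary (k + 1)))
    (fun _ => LinearMap.id) (bary (k + 1)) (fun _ => rfl) (tupleBoundary_tupleSd _)
    (fun _ _ => rfl) k (Finsupp.single (vertices (k + 1)) 1)
  rw [← modelOp_single] at e1
  have e4 := congrArg₂ (· + ·) e1 e2
  simp only [← map_add, tupleSdHomotopy] at e4
  rw [e3, map_sub, LinearMap.id_apply, ← modelOp_single, ← modelOp_single,
    modelOp_subSimplex_vertices] at e4
  exact e4

/-- The finite chains all of whose simplices lie in some member of `𝒰`. -/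
def finSub (R : Type*) [CommRing R] {X : Type*} [TopologicalSpace X] (𝒰 : Set (Set X)) (k : ℕ) :
    Submodule R (FinChain R X k) :=
  Finsupp.supported R R {σ : Simplex k X | ∃ U ∈ 𝒰, Set.range σ ⊆ U}

theorem Carried.mem_finSub {k m : ℕ} {Φ : FinChain R X k →ₗ[R] FinChain R X m} (hΦ : Carried Φ)
    {𝒰 : Set (Set X)} {c : FinChain R X k} (hc : c ∈ finSub R 𝒰 k) : Φ c ∈ finSub R 𝒰 m :=
  hΦ.mem_supported (by rintro _ ⟨U, hU, h⟩ _ h'; exact ⟨U, hU, h'.trans h⟩) hc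

/-- Affine maps preserve barycenters. Hence iterated subdivision of `σ` can be computed inside
`Δ^k`, where distances make sense, and realized only at the end. -/
theorem subdivision_realize {k m : ℕ} (σ : Simplex k X)
    (θ : TupleChain R (stdSimplex ℝ (Fin (k + 1))) m) :
    subdivision R X m (Finsupp.lmapDomain R R (subSimplex k σ m) θ) =
      Finsupp.lmapDomain R R (subSimplex k σ m) (tupleSd (bary k) m θ) := by
  suffices h : subdivision R X m ∘ₗ Finsupp.lmapDomain R R (subSimplex k σ m) =
      Finsupp.lmapDomain R R (subSimplex k σ m) ∘ₗ tupleSd (bary k) m from LinearMap.congr_fun h θ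
  refine Finsupp.lhom_ext' fun w => LinearMap.ext_ring ?_
  simp only [LinearMap.coe_comp, Function.comp_apply, Finsupp.lsingle_apply]
  have hw : w = affine w ∘ vertices m := by
    funext i
    apply Subtype.ext
    simp [affine_apply, vertices, Pi.single_apply]
  conv_rhs => rw [hw, ← tupleMap_single,
    ← tupleMap_tupleSd _ (bary m) _ (fun _ => affine_bary w)]
  rw [Finsupp.lmapDomain_apply, Finsupp.mapDomain_single, subdivision, modelOp_single,
    Finsupp.lmapDomain_apply, Finsupp.lmapDomain_apply, tupleMap, Finsupp.lmapDomain_apply,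
    ← Finsupp.mapDomain_comp]
  congr 1
  funext u
  exact subSimplex_subSimplex k σ m w m u

/-- A Lebesgue number for the pulled-back cover of the compact simplex, against the geometric decay
of the mesh. -/
theorem exists_subdivision_pow_mem_finSub {𝒰 : Set (Set X)} (h𝒰 : ∀ U ∈ 𝒰, IsOpen U) {k : ℕ}
    (σ : Simplex k X) (hσ : Set.range σ ⊆ ⋃₀ 𝒰) :
    ∃ i, (subdivision R X k ^ i) (Finsupp.single σ 1) ∈ finSub R 𝒰 k := by
  obtain ⟨δ, hδ, hL⟩ := lebesgue_number_lemma_of_metric (s := (Set.univ : Set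
    (stdSimplex ℝ (Fin (k + 1))))) (c := fun U : 𝒰 => σ ⁻¹' U.1) isCompact_univ
    (fun U => (h𝒰 _ U.2).preimage σ.continuous) (fun t _ => by
      obtain ⟨U, hU, h⟩ := hσ ⟨t, rfl⟩
      exact Set.mem_iUnion.2 ⟨⟨U, hU⟩, h⟩)
  have hr : (k / (k + 1) : ℝ) < 1 := by
    rw [div_lt_one (by positivity)]
    linarith
  obtain ⟨i, hi⟩ := exists_pow_lt_of_lt_one hδ hr
  refine ⟨i, ?_⟩
  have h1 : ∀ i, (subdivision R X k ^ i) (Finsupp.single σ 1) = Finsupp.lmapDomain R R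
      (subSimplex k σ k) ((tupleSd (bary k) k ^ i) (Finsupp.single (vertices k) 1)) := by
    intro i
    induction i with
    | zero => simp [Finsupp.mapDomain_single, subSimplex_vertices]
    | succ i ih => rw [pow_succ', pow_succ', Module.End.mul_apply, Module.End.mul_apply, ih,
        subdivision_realize]
  have h2 : ∀ i, (tupleSd (R := R) (bary k) k ^ i) (Finsupp.single (vertices k) 1) ∈
      Finsupp.supported R R {v | ∀ a b, dist (v a) (v b) ≤ (k / (k + 1) : ℝ) ^ i} := by
    intro i
    induction i with
    | zero =>
      refine Finsupp.single_mem_supported R 1 fun a b => ?_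
      rw [pow_zero]
      exact (Metric.dist_le_diam_of_mem (bounded_stdSimplex _) (vertices k a).2
        (vertices k b).2).trans diam_stdSimplex_le
    | succ i ih =>
      rw [pow_succ' (tupleSd (bary k) k), Module.End.mul_apply, pow_succ' (k / (k + 1) : ℝ)]
      exact tupleSd_mem_supported_dist (bary k) (fun z r m v hv => affine_mem_closedBall hv _)
        (fun m v D => dist_bary_le k m v D) _ k ih
  rw [h1]
  refine linearMap_mem_of_supported _ _ (fun w hw => ?_) (h2 i)
  rw [Finsupp.lmapDomain_apply, Finsupp.mapDomain_single]
  -- All vertices lie in a closed ball about `w 0` of radius less than the Lebesgue number. By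
  -- convexity the whole affine simplex does.
  obtain ⟨U, hU⟩ := hL (w 0) trivial
  refine Finsupp.single_mem_supported R 1 ⟨U.1, U.2, ?_⟩
  rintro _ ⟨t, rfl⟩
  refine hU ?_
  have := affine_mem_closedBall (w := w) (z := w 0) (fun a => Metric.mem_closedBall.2 (hw a 0)) t
  exact Metric.closedBall_subset_ball hi this

end FinChain

section FinChain

variable {R : Type*} [CommRing R] {X Y : Type*} [TopologicalSpace X] [TopologicalSpace Y]

/-! ### Refinement with respect to an open cover -/

theorem finBoundary_subdivision_pow {k : ℕ} (i : ℕ) (c : FinChain R X (k + 1)) :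
    finBoundary k ((subdivision R X (k + 1) ^ i) c) =
      (subdivision R X k ^ i) (finBoundary k c) := by
  induction i with
  | zero => rfl
  | succ i ih => rw [pow_succ', pow_succ', Module.End.mul_apply, Module.End.mul_apply,
      finBoundary_subdivision, ih]

theorem carried_subdivision_pow (k i : ℕ) : Carried (subdivision R X k ^ i) := by
  induction i with
  | zero => exact carried_id k
  | succ i ih => rw [pow_succ']; exact (carried_subdivision k).comp ih

theorem subdivision_pow_mem_finSub {𝒰 : Set (Set X)} {k i j : ℕ} (hij : i ≤ j)
    {c : FinChain R X k} (h : (subdivision R X k ^ i) c ∈ finSub R 𝒰 k) :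
    (subdivision R X k ^ j) c ∈ finSub R 𝒰 k := by
  obtain ⟨l, rfl⟩ := Nat.exists_eq_add_of_le hij
  rw [add_comm, pow_add, Module.End.mul_apply]
  exact (carried_subdivision_pow k l).mem_finSub h

variable (R X) in
/-- The chain homotopy from the `i`-fold subdivision to the identity. -/
def iteratedHomotopy (k i : ℕ) : FinChain R X k →ₗ[R] FinChain R X (k + 1) :=
  ∑ j ∈ Finset.range i, subdivisionHomotopy R X k ∘ₗ (subdivision R X k ^ j)

theorem carried_iteratedHomotopy (k i : ℕ) : Carried (iteratedHomotopy R X k i) :=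
  Carried.sum _ fun j => (carried_subdivisionHomotopy k).comp (carried_subdivision_pow k j)

theorem iteratedHomotopy_succ (k i : ℕ) (c : FinChain R X k) :
    iteratedHomotopy R X k (i + 1) c = iteratedHomotopy R X k i c +
      subdivisionHomotopy R X k ((subdivision R X k ^ i) c) := by
  simp [iteratedHomotopy, Finset.sum_range_succ]

theorem finBoundary_iteratedHomotopy_zero (i : ℕ) (c : FinChain R X 0) :
    finBoundary 0 (iteratedHomotopy R X 0 i c) = c - (subdivision R X 0 ^ i) c := by
  induction i with
  | zero => simp [iteratedHomotopy]
  | succ i ih =>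
    rw [iteratedHomotopy_succ, map_add, ih, subdivisionHomotopy_zero, pow_succ',
      Module.End.mul_apply]
    abel

theorem finBoundary_iteratedHomotopy_succ {k : ℕ} (i : ℕ) (c : FinChain R X (k + 1)) :
    finBoundary (k + 1) (iteratedHomotopy R X (k + 1) i c) +
      iteratedHomotopy R X k i (finBoundary k c) = c - (subdivision R X (k + 1) ^ i) c := by
  induction i with
  | zero => simp [iteratedHomotopy]
  | succ i ih =>
    have h := subdivisionHomotopy_succ ((subdivision R X (k + 1) ^ i) c)
    rw [finBoundary_subdivision_pow] at h
    rw [iteratedHomotopy_succ, iteratedHomotopy_succ, map_add, pow_succ', Module.End.mul_apply,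
      add_add_add_comm, ih, h]
    abel

/-- The extra summands are homotopies of chains that are already small, and carried operators
preserve smallness. This absorbs the discrepancy between the depth of a simplex and the smaller
depths of its faces. -/
theorem iteratedHomotopy_sub_mem_finSub {𝒰 : Set (Set X)} {k i j : ℕ} (hij : i ≤ j)
    {c : FinChain R X k} (h : (subdivision R X k ^ i) c ∈ finSub R 𝒰 k) :
    iteratedHomotopy R X k j c - iteratedHomotopy R X k i c ∈ finSub R 𝒰 (k + 1) := by
  induction j, hij using Nat.le_induction with
  | base => rw [sub_self]; exact Submodule.zero_mem _
  | succ j hij ih =>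
    rw [iteratedHomotopy_succ, add_sub_right_comm]
    exact Submodule.add_mem _ ih
      ((carried_subdivisionHomotopy k).mem_finSub (subdivision_pow_mem_finSub hij h))

variable (R) in
/-- The least number of subdivisions that make a simplex small of order `𝒰`. -/
def smallDepth (𝒰 : Set (Set X)) {k : ℕ} (σ : Simplex k X) : ℕ :=
  sInf {i | (subdivision R X k ^ i) (Finsupp.single σ 1) ∈ finSub R 𝒰 k}

variable (R) in
/-- A number of subdivisions that makes a simplex small of order `𝒰` and that does not increase
on passing to a face. -/
def depth (𝒰 : Set (Set X)) : ∀ {k : ℕ}, Simplex k X → ℕ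
  | 0, σ => smallDepth R 𝒰 σ
  | _ + 1, σ => max (smallDepth R 𝒰 σ) (Finset.univ.sup fun p => depth 𝒰 (face p σ))

theorem smallDepth_le_depth (𝒰 : Set (Set X)) {k : ℕ} (σ : Simplex k X) :
    smallDepth R 𝒰 σ ≤ depth R 𝒰 σ := by
  cases k with
  | zero => exact le_rfl
  | succ k => exact le_max_left _ _

theorem depth_face_le (𝒰 : Set (Set X)) {k : ℕ} (σ : Simplex (k + 1) X) (p : Fin (k + 2)) :
    depth R 𝒰 (face p σ) ≤ depth R 𝒰 σ :=
  (Finset.le_sup (f := fun p => depth R 𝒰 (face p σ)) (Finset.mem_univ p)).trans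
    (le_max_right _ _)

theorem subdivision_pow_depth_mem {𝒰 : Set (Set X)} (h𝒰 : ∀ U ∈ 𝒰, IsOpen U) {k : ℕ}
    (σ : Simplex k X) (hσ : Set.range σ ⊆ ⋃₀ 𝒰) :
    (subdivision R X k ^ depth R 𝒰 σ) (Finsupp.single σ 1) ∈ finSub R 𝒰 k :=
  subdivision_pow_mem_finSub (smallDepth_le_depth 𝒰 σ)
    -- Covering of `σ` makes the set of admissible depths nonempty; were it empty, `smallDepth`
    -- would be the meaningless default `0`.
    (Nat.sInf_mem (exists_subdivision_pow_mem_finSub (R := R) h𝒰 σ hσ))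

/-- Small simplices need no subdivision, and neither do their faces. Hence the refinement homotopy
vanishes on small chains, which lets refinement leave a small boundary unchanged. -/
theorem depth_eq_zero {𝒰 : Set (Set X)} : ∀ {k : ℕ} (σ : Simplex k X),
    (∃ U ∈ 𝒰, Set.range σ ⊆ U) → depth R 𝒰 σ = 0 := by
  have h0 : ∀ {k : ℕ} (σ : Simplex k X), (∃ U ∈ 𝒰, Set.range σ ⊆ U) → smallDepth R 𝒰 σ = 0 :=
    fun σ h => Nat.sInf_eq_zero.2 (Or.inl (Finsupp.single_mem_supported R 1 h))
  intro k
  induction k with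
  | zero => exact fun σ h => h0 σ h
  | succ k ih =>
    intro σ h
    obtain ⟨U, hU, hσ⟩ := h
    rw [depth, h0 σ ⟨U, hU, hσ⟩]
    simp only [ih _ ⟨U, hU, (range_face_subset _ σ).trans hσ⟩]
    simp

variable (R) in
/-- The chain homotopy from the identity to a refinement operator for `𝒰`. -/
def refineHomotopy (𝒰 : Set (Set X)) (k : ℕ) : FinChain R X k →ₗ[R] FinChain R X (k + 1) :=
  Finsupp.linearCombination R fun σ =>
    iteratedHomotopy R X k (depth R 𝒰 σ) (Finsupp.single σ 1)

theorem refineHomotopy_single (𝒰 : Set (Set X)) {k : ℕ} (σ : Simplex k X) :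
    refineHomotopy R 𝒰 k (Finsupp.single σ 1) =
      iteratedHomotopy R X k (depth R 𝒰 σ) (Finsupp.single σ 1) := by
  rw [refineHomotopy, Finsupp.linearCombination_single, one_smul]

theorem carried_refineHomotopy (𝒰 : Set (Set X)) (k : ℕ) : Carried (refineHomotopy R 𝒰 k) :=
  fun σ => by
    rw [refineHomotopy_single]
    exact carried_iteratedHomotopy k _ σ

theorem refineHomotopy_eq_zero {𝒰 : Set (Set X)} {k : ℕ} {c : FinChain R X k}
    (hc : c ∈ finSub R 𝒰 k) : refineHomotopy R 𝒰 k c = 0 := by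
  have : refineHomotopy R 𝒰 k c ∈ (⊥ : Submodule R (FinChain R X (k + 1))) := by
    refine linearMap_mem_of_supported _ _ (fun σ hσ => ?_) hc
    rw [refineHomotopy_single, depth_eq_zero σ hσ]
    simp [iteratedHomotopy]
  simpa using this

theorem mem_finSub_sUnion_iff {𝒰 : Set (Set X)} {k : ℕ} {σ : Simplex k X} :
    (∃ U ∈ ({⋃₀ 𝒰} : Set (Set X)), Set.range σ ⊆ U) ↔ Set.range σ ⊆ ⋃₀ 𝒰 := by
  simp

theorem refineHomotopy_zero {𝒰 : Set (Set X)} (h𝒰 : ∀ U ∈ 𝒰, IsOpen U) {c : FinChain R X 0}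
    (hc : c ∈ finSub R {⋃₀ 𝒰} 0) :
    c - finBoundary 0 (refineHomotopy R 𝒰 0 c) ∈ finSub R 𝒰 0 := by
  refine linearMap_mem_of_supported (LinearMap.id - finBoundary 0 ∘ₗ refineHomotopy R 𝒰 0) _
    (fun σ hσ => ?_) hc
  rw [LinearMap.sub_apply, LinearMap.comp_apply, refineHomotopy_single,
    finBoundary_iteratedHomotopy_zero, LinearMap.id_apply, sub_sub_cancel]
  exact subdivision_pow_depth_mem h𝒰 σ (mem_finSub_sUnion_iff.1 hσ)

/-- With the depth of `σ` used throughout, the remainder would be an iterated subdivision of `σ`,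
which is small. The faces use their own depths instead, and the error made is small because faces
have no greater depth. -/
theorem refineHomotopy_succ {𝒰 : Set (Set X)} (h𝒰 : ∀ U ∈ 𝒰, IsOpen U) {k : ℕ}
    {c : FinChain R X (k + 1)} (hc : c ∈ finSub R {⋃₀ 𝒰} (k + 1)) :
    c - finBoundary (k + 1) (refineHomotopy R 𝒰 (k + 1) c) -
      refineHomotopy R 𝒰 k (finBoundary k c) ∈ finSub R 𝒰 (k + 1) := by
  refine linearMap_mem_of_supported (LinearMap.id - finBoundary (k + 1) ∘ₗ
    refineHomotopy R 𝒰 (k + 1) - refineHomotopy R 𝒰 k ∘ₗ finBoundary k) _ (fun σ hσ => ?_) hc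
  have hσ' := mem_finSub_sUnion_iff.1 hσ
  rw [LinearMap.sub_apply, LinearMap.sub_apply, LinearMap.comp_apply, LinearMap.comp_apply,
    refineHomotopy_single, LinearMap.id_apply]
  have h1 := finBoundary_iteratedHomotopy_succ (depth R 𝒰 σ) (Finsupp.single σ (1 : R))
  have h2 : Finsupp.single σ (1 : R) - finBoundary (k + 1)
      (iteratedHomotopy R X (k + 1) (depth R 𝒰 σ) (Finsupp.single σ 1)) -
      refineHomotopy R 𝒰 k (finBoundary k (Finsupp.single σ 1)) =
      (subdivision R X (k + 1) ^ depth R 𝒰 σ) (Finsupp.single σ 1) +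
      (iteratedHomotopy R X k (depth R 𝒰 σ) (finBoundary k (Finsupp.single σ 1)) -
        refineHomotopy R 𝒰 k (finBoundary k (Finsupp.single σ 1))) := by
    rw [eq_sub_of_add_eq h1]
    abel
  rw [h2]
  refine Submodule.add_mem _ (subdivision_pow_depth_mem h𝒰 σ hσ') ?_
  simp only [finBoundary, altSum_single, map_sum, map_smul, refineHomotopy_single,
    ← Finset.sum_sub_distrib, ← smul_sub]
  exact Submodule.sum_mem _ fun p _ => Submodule.smul_mem _ _
    (iteratedHomotopy_sub_mem_finSub (depth_face_le 𝒰 σ p)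
      (subdivision_pow_depth_mem h𝒰 _ ((range_face_subset p σ).trans hσ')))

/-! ### The prism operator -/

variable (H : C(X × stdSimplex ℝ (Fin (1 + 1)), Y))

/-- The realization in the image of a homotopy of a tuple of points of `Δ^k × Δ^1`. -/
def prismSimplex (k : ℕ) (σ : Simplex k X) (m : ℕ)
    (w : Fin (m + 1) → stdSimplex ℝ (Fin (k + 1)) × stdSimplex ℝ (Fin (1 + 1))) : Simplex m Y :=
  H.comp ((σ.comp (affine (Prod.fst ∘ w))).prodMk (affine (Prod.snd ∘ w)))

theorem face_prismSimplex (k : ℕ) (σ : Simplex k X) (m : ℕ)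
    (w : Fin (m + 2) → stdSimplex ℝ (Fin (k + 1)) × stdSimplex ℝ (Fin (1 + 1)))
    (p : Fin (m + 2)) :
    face p (prismSimplex H k σ (m + 1) w) = prismSimplex H k σ m (w ∘ p.succAbove) := by
  ext t
  exact congrArg H (Prod.ext (congrArg σ (affine_faceInclusion _ p t))
    (affine_faceInclusion _ p t))

theorem prismSimplex_face (k : ℕ) (σ : Simplex (k + 1) X) (p : Fin (k + 2)) (m : ℕ)
    (w : Fin (m + 1) → stdSimplex ℝ (Fin (k + 1)) × stdSimplex ℝ (Fin (1 + 1))) :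
    prismSimplex H k (face p σ) m w =
      prismSimplex H (k + 1) σ m (Prod.map (faceInclusion k p) id ∘ w) := by
  ext t
  exact congrArg H (Prod.ext (congrArg σ (faceInclusion_affine _ p t)) rfl)

/-- The tuple version of the prism operator. -/
def tuplePrism (k m : ℕ) : TupleChain R (stdSimplex ℝ (Fin (k + 1))) m →ₗ[R]
    TupleChain R (stdSimplex ℝ (Fin (k + 1)) × stdSimplex ℝ (Fin (1 + 1))) (m + 1) :=
  coneHomotopy (tupleMap fun z => (z, vertices 1 0)) (tupleMap fun z => (z, vertices 1 1))
    (fun _ v => (v 0, vertices 1 0)) m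

/-- The prism operator of a homotopy. -/
def prism (k : ℕ) : FinChain R X k →ₗ[R] FinChain R Y (k + 1) :=
  modelOp (prismSimplex H) (tuplePrism k k (Finsupp.single (vertices k) 1))

/-- The endpoint of a homotopy at a point of `Δ^1`. -/
def homotopyAt (z : stdSimplex ℝ (Fin (1 + 1))) : C(X, Y) :=
  H.comp ((ContinuousMap.id X).prodMk (ContinuousMap.const X z))

theorem modelOp_prismSimplex_vertices (z : stdSimplex ℝ (Fin (1 + 1))) {k : ℕ}
    (σ : Simplex k X) :
    Finsupp.lmapDomain R R (prismSimplex H k σ k) (tupleMap (fun y => (y, z)) k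
      (Finsupp.single (vertices k) 1)) = finPush (homotopyAt H z) k (Finsupp.single σ 1) := by
  rw [tupleMap_single, Finsupp.lmapDomain_apply, Finsupp.mapDomain_single, finPush_single]
  congr 1
  ext t
  exact congrArg H (Prod.ext (congrArg σ (affine_vertices k t)) (affine_const z t))

theorem augmentation_tupleMap {Z Z' : Type*} (f : Z → Z') (c : TupleChain R Z 0) :
    augmentation (tupleMap f 0 c) = augmentation c := by
  simp only [augmentation, tupleMap, Finsupp.lmapDomain_apply]
  rw [Finsupp.linearCombination_mapDomain]
  rfl

theorem finBoundary_prism_zero (c : FinChain R X 0) :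
    finBoundary 0 (prism H 0 c) =
      finPush (homotopyAt H (vertices 1 1)) 0 c - finPush (homotopyAt H (vertices 1 0)) 0 c := by
  suffices h : finBoundary 0 ∘ₗ prism H 0 = finPush (R := R) (homotopyAt H (vertices 1 1)) 0 -
      finPush (homotopyAt H (vertices 1 0)) 0 from LinearMap.congr_fun h c
  refine Finsupp.lhom_ext' fun σ => LinearMap.ext_ring ?_
  have e1 := finBoundary_realize (prismSimplex H) (face_prismSimplex H) σ
    (tuplePrism (R := R) 0 0 (Finsupp.single (vertices 0) 1))
  have e3 := tupleBoundary_coneHomotopy_zero (R := R)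
    (tupleMap fun z : stdSimplex ℝ (Fin (0 + 1)) => (z, vertices 1 0))
    (tupleMap fun z => (z, vertices 1 1)) (fun _ v => (v 0, vertices 1 0))
    (fun c => by rw [augmentation_tupleMap, augmentation_tupleMap])
    (Finsupp.single (vertices 0) 1)
  rw [← modelOp_single, tuplePrism, e3, map_sub, modelOp_prismSimplex_vertices,
    modelOp_prismSimplex_vertices] at e1
  exact e1

/-- No explicit triangulation of the prism is needed: the universal chain in `Δ^k × Δ^1` is the cone
homotopy between the two end inclusions, so naturality and the acyclic models formula give the
identity as for subdivision. -/
theorem finBoundary_prism_succ {k : ℕ} (c : FinChain R X (k + 1)) :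
    finBoundary (k + 1) (prism H (k + 1) c) + prism H k (finBoundary k c) =
      finPush (homotopyAt H (vertices 1 1)) (k + 1) c -
        finPush (homotopyAt H (vertices 1 0)) (k + 1) c := by
  suffices h : finBoundary (k + 1) ∘ₗ prism H (k + 1) + prism H k ∘ₗ finBoundary k =
      finPush (R := R) (homotopyAt H (vertices 1 1)) (k + 1) -
      finPush (homotopyAt H (vertices 1 0)) (k + 1) from LinearMap.congr_fun h c
  refine Finsupp.lhom_ext' fun σ => LinearMap.ext_ring ?_
  have e1 := finBoundary_realize (prismSimplex H) (face_prismSimplex H) σ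
    (tuplePrism (R := R) (k + 1) (k + 1) (Finsupp.single (vertices (k + 1)) 1))
  have e2 := modelOp_finBoundary (prismSimplex H)
    (fun k p => Prod.map (faceInclusion k p) id) (prismSimplex_face H)
    (tuplePrism (R := R) k k (Finsupp.single (vertices k) 1)) (tuplePrism (k + 1) k)
    (fun p => by
      rw [tuplePrism, tupleMap_coneHomotopy _ _ _ (faceInclusion k p)
        (Prod.map (faceInclusion k p) id)
        (tupleMap fun z => (z, vertices 1 0)) (tupleMap fun z => (z, vertices 1 1))
        (fun _ v => (v 0, vertices 1 0)), tupleMap_single, faceInclusion_comp_vertices]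
      · rfl
      · intro m c
        simp only [tupleMap, Finsupp.lmapDomain_apply, ← Finsupp.mapDomain_comp]
        rfl
      · intro m c
        simp only [tupleMap, Finsupp.lmapDomain_apply, ← Finsupp.mapDomain_comp]
        rfl
      · exact fun _ _ => rfl) σ
  have e3 := tupleBoundary_coneHomotopy_succ (R := R)
    (tupleMap fun z : stdSimplex ℝ (Fin (k + 1 + 1)) => (z, vertices 1 0))
    (tupleMap fun z => (z, vertices 1 1)) (fun _ v => (v 0, vertices 1 0))
    (fun c => by rw [augmentation_tupleMap, augmentation_tupleMap])
    (fun _ _ => tupleBoundary_tupleMap _ _) (fun _ _ => tupleBoundary_tupleMap _ _)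
    k (Finsupp.single (vertices (k + 1)) 1)
  rw [← modelOp_single] at e1
  have e4 := congrArg₂ (· + ·) e1 e2
  simp only [← map_add, tuplePrism] at e4
  rw [e3, map_sub, modelOp_prismSimplex_vertices, modelOp_prismSimplex_vertices] at e4
  exact e4

theorem prism_mem_finSub {U : Set X} {V : Set Y} (hUV : ∀ x ∈ U, ∀ t, H (x, t) ∈ V) {k : ℕ}
    {c : FinChain R X k} (hc : c ∈ finSub R {U} k) : prism H k c ∈ finSub R {V} (k + 1) := by
  refine linearMap_mem_of_supported _ _ (fun σ hσ => ?_) hc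
  obtain ⟨_, rfl, hσ⟩ := hσ
  rw [prism, modelOp_single]
  refine linearMap_mem_of_supported _ (P := Set.univ) _ (fun w _ => ?_)
    (by rw [Finsupp.supported_univ]; trivial)
  rw [Finsupp.lmapDomain_apply, Finsupp.mapDomain_single]
  refine Finsupp.single_mem_supported R 1 ⟨V, rfl, ?_⟩
  rintro _ ⟨t, rfl⟩
  exact hUV _ (hσ ⟨_, rfl⟩) _

theorem finPush_mem_finSub (f : C(X, Y)) {U : Set X} {V : Set Y} (hUV : Set.MapsTo f U V) {k : ℕ}
    {c : FinChain R X k} (hc : c ∈ finSub R {U} k) : finPush f k c ∈ finSub R {V} k := by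
  refine linearMap_mem_of_supported _ _ (fun σ hσ => ?_) hc
  obtain ⟨_, rfl, hσ⟩ := hσ
  rw [finPush_single]
  refine Finsupp.single_mem_supported R 1 ⟨V, rfl, ?_⟩
  rintro _ ⟨t, rfl⟩
  exact hUV (hσ ⟨t, rfl⟩)

end FinChain

/-! ### Extension of carried operators to locally finite chains -/

section LocallyFinite

variable {R : Type*} [CommRing R] {X : Type*} [TopologicalSpace X]

open scoped Classical in
/-- The finite part of a locally finite chain consisting of the simplices that meet a given
compact set. -/
def truncate {k : ℕ} {K : Set X} (hK : IsCompact K) : chains R X k →ₗ[R] FinChain R X k where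
  toFun c := Finsupp.onFinset (c.2.finite_meets hK).toFinset
    (fun σ => if (Set.range σ ∩ K).Nonempty then c.1 σ else 0) fun σ h => by
      rw [Set.Finite.mem_toFinset]
      by_cases hσ : (Set.range σ ∩ K).Nonempty
      · exact ⟨by simpa [hσ] using h, hσ⟩
      · simp [hσ] at h
  map_add' a b := by
    ext σ
    by_cases hσ : (Set.range σ ∩ K).Nonempty <;> simp [hσ]
  map_smul' r a := by
    ext σ
    by_cases hσ : (Set.range σ ∩ K).Nonempty <;> simp [hσ]

theorem truncate_apply_of_meets {k : ℕ} {K : Set X} (hK : IsCompact K) (c : chains R X k)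
    {σ : Simplex k X} (hσ : (Set.range σ ∩ K).Nonempty) : truncate hK c σ = c.1 σ := by
  simp [truncate, hσ]

theorem truncate_apply_of_not_meets {k : ℕ} {K : Set X} (hK : IsCompact K) (c : chains R X k)
    {σ : Simplex k X} (hσ : ¬ (Set.range σ ∩ K).Nonempty) : truncate hK c σ = 0 := by
  simp [truncate, hσ]

theorem isCompact_range_simplex {k : ℕ} (σ : Simplex k X) : IsCompact (Set.range σ) :=
  isCompact_range σ.continuous

theorem Carried.apply_eq_zero {k m : ℕ} {Φ : FinChain R X k →ₗ[R] FinChain R X m}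
    (hΦ : Carried Φ) {τ : Simplex m X} {a : FinChain R X k}
    (ha : ∀ σ : Simplex k X, Set.range τ ⊆ Set.range σ → a σ = 0) : Φ a τ = 0 := by
  have h1 : a ∈ Finsupp.supported R R {σ : Simplex k X | ¬ Set.range τ ⊆ Set.range σ} :=
    (Finsupp.mem_supported' R a).2 fun σ hσ => ha σ (not_not.1 hσ)
  have h2 := hΦ.mem_supported (Q := {τ' | τ' ≠ τ})
    (by rintro σ hσ _ h rfl; exact hσ h) h1
  exact (Finsupp.mem_supported' R _).1 h2 τ (by simp)

/-- The coefficient of `τ` sees only simplices whose image contains that of `τ`. These all meet a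
fixed compact set, which is why carried operators make sense on locally finite chains. -/
theorem Carried.apply_congr {k m : ℕ} {Φ : FinChain R X k →ₗ[R] FinChain R X m}
    (hΦ : Carried Φ) {τ : Simplex m X} {a b : FinChain R X k}
    (h : ∀ σ : Simplex k X, Set.range τ ⊆ Set.range σ → a σ = b σ) : Φ a τ = Φ b τ := by
  rw [← sub_eq_zero, ← Finsupp.sub_apply, ← map_sub]
  exact hΦ.apply_eq_zero fun σ hσ => by rw [Finsupp.sub_apply, h σ hσ, sub_self]

/-- The extension of a carried operator to locally finite chains. -/
def lfExtend {k m : ℕ} (Φ : FinChain R X k →ₗ[R] FinChain R X m) (hΦ : Carried Φ) :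
    chains R X k →ₗ[R] chains R X m where
  toFun c := ⟨fun τ => Φ (truncate (isCompact_range_simplex τ) c) τ, fun x => by
    obtain ⟨U, hU, hxU, hfU⟩ := c.2 x
    refine ⟨U, hU, hxU, (hfU.biUnion fun σ _ =>
      (Φ (Finsupp.single σ 1)).support.finite_toSet).subset ?_⟩
    rintro τ ⟨h0, y, hyτ, hyU⟩
    by_contra hcon
    refine h0 ?_
    simp only [Set.mem_iUnion, not_exists, SetLike.mem_coe, Finsupp.mem_support_iff,
      not_not] at hcon
    -- A contributing `σ` has image containing that of `τ`, so it meets `U` as well. Only finitely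
    -- many such `σ` exist, and each yields finitely many `τ`.
    have h1 : truncate (isCompact_range_simplex τ) c ∈
        Finsupp.supported R R {σ | Φ (Finsupp.single σ 1) τ = 0} := by
      refine (Finsupp.mem_supported' R _).2 fun σ hσ => ?_
      by_cases hm : (Set.range σ ∩ Set.range τ).Nonempty
      · rw [truncate_apply_of_meets _ _ hm]
        by_contra hc0
        by_cases hsub : Set.range τ ⊆ Set.range σ
        · exact hσ (hcon σ ⟨hc0, y, hsub hyτ, hyU⟩)
        · exact hσ ((Finsupp.mem_supported' R _).1 (hΦ σ) τ hsub)
      · exact truncate_apply_of_not_meets _ _ hm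
    have h2 := linearMap_mem_of_supported Φ (Finsupp.supported R R {τ' | τ' ≠ τ})
      (fun σ hσ => (Finsupp.mem_supported' R _).2 fun τ' hτ' => by
        rw [not_not.1 hτ']; exact hσ) h1
    exact (Finsupp.mem_supported' R _).1 h2 τ (by simp)⟩
  map_add' a b := by
    ext τ
    simp
  map_smul' r a := by
    ext τ
    simp

/-- Any compact set meeting `τ` may serve for truncation. This freedom is what makes extension
compatible with composition. -/
theorem lfExtend_apply {k m : ℕ} (Φ : FinChain R X k →ₗ[R] FinChain R X m) (hΦ : Carried Φ)
    (c : chains R X k) {τ : Simplex m X} {K : Set X} (hK : IsCompact K)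
    (hτ : (Set.range τ ∩ K).Nonempty) : (lfExtend Φ hΦ c).1 τ = Φ (truncate hK c) τ := by
  refine hΦ.apply_congr fun σ hσ => ?_
  rw [truncate_apply_of_meets, truncate_apply_of_meets]
  · exact hτ.mono (Set.inter_subset_inter_left _ hσ)
  · rw [Set.inter_eq_right.2 hσ]; exact Set.range_nonempty τ

theorem meets_self {k : ℕ} (τ : Simplex k X) : (Set.range τ ∩ Set.range τ).Nonempty := by
  rw [Set.inter_self]; exact Set.range_nonempty τ

theorem lfExtend_comp {k l m : ℕ} (Ψ : FinChain R X l →ₗ[R] FinChain R X m)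
    (Φ : FinChain R X k →ₗ[R] FinChain R X l) (hΨ : Carried Ψ) (hΦ : Carried Φ)
    (c : chains R X k) :
    lfExtend Ψ hΨ (lfExtend Φ hΦ c) = lfExtend (Ψ ∘ₗ Φ) (hΨ.comp hΦ) c := by
  ext τ
  refine hΨ.apply_congr fun ρ hρ => ?_
  have hm : (Set.range ρ ∩ Set.range τ).Nonempty := by
    rw [Set.inter_eq_right.2 hρ]; exact Set.range_nonempty τ
  rw [truncate_apply_of_meets _ _ hm, lfExtend_apply Φ hΦ c (isCompact_range_simplex τ) hm]

theorem lfExtend_sub {k m : ℕ} {Φ Ψ : FinChain R X k →ₗ[R] FinChain R X m} (hΦ : Carried Φ)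
    (hΨ : Carried Ψ) (c : chains R X k) :
    lfExtend (Φ - Ψ) (hΦ.sub hΨ) c = lfExtend Φ hΦ c - lfExtend Ψ hΨ c := rfl

theorem lfExtend_id {k : ℕ} (c : chains R X k) :
    lfExtend LinearMap.id (carried_id k) c = c := by
  ext τ
  exact truncate_apply_of_meets (isCompact_range_simplex τ) c (meets_self τ)

/-- With the boundary itself an extended carried operator, operator identities for finite chains
pass to locally finite ones. -/
theorem boundary_eq_lfExtend (k : ℕ) (c : chains R X (k + 1)) :
    boundary R X k c = lfExtend (finBoundary k) (carried_finBoundary k) c := by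
  classical
  ext τ
  change (boundary R X k c).1 τ = finBoundary k (truncate (isCompact_range_simplex τ) c) τ
  simp only [boundary, finBoundary, altSum, LinearMap.sum_apply, LinearMap.smul_apply,
    Submodule.coe_sum, Submodule.coe_smul, Finset.sum_apply, Pi.smul_apply, Finsupp.coe_finsetSum,
    Finsupp.coe_smul, Finsupp.lmapDomain_apply]
  refine Finset.sum_congr rfl fun p _ => ?_
  congr 1
  change pushFun (face p) c.1 τ = _
  have hmem : ∀ σ, face p σ = τ → (Set.range σ ∩ Set.range τ).Nonempty := by
    rintro σ rfl
    rw [Set.inter_eq_right.2 (range_face_subset p σ)]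
    exact Set.range_nonempty _
  rw [pushFun_eq_sum (face p) c.1 τ (truncate (isCompact_range_simplex τ) c).support,
    Finsupp.mapDomain, Finsupp.sum, Finsupp.coe_finsetSum, Finset.sum_apply]
  · refine Finset.sum_congr rfl fun σ _ => ?_
    rw [Finsupp.single_apply]
    split_ifs with h
    · rw [truncate_apply_of_meets _ _ (hmem σ h)]
    · rfl
  · intro σ h0 hσ
    rw [Finsupp.mem_support_iff, truncate_apply_of_meets _ _ (hmem σ hσ)]
    exact h0

theorem truncate_mem_finSub {𝒰 : Set (Set X)} {k : ℕ} {K : Set X} (hK : IsCompact K)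
    {c : chains R X k} (hc : c ∈ subchains R X 𝒰 k) : truncate hK c ∈ finSub R 𝒰 k := by
  refine (Finsupp.mem_supported' R _).2 fun σ hσ => ?_
  by_cases hm : (Set.range σ ∩ K).Nonempty
  · rw [truncate_apply_of_meets _ _ hm]
    by_contra h0
    exact hσ (hc σ h0)
  · exact truncate_apply_of_not_meets _ _ hm

theorem lfExtend_mem_subchains {𝒰 𝒱 : Set (Set X)} {k m : ℕ}
    {Φ : FinChain R X k →ₗ[R] FinChain R X m} {hΦ : Carried Φ}
    (h : ∀ c ∈ finSub R 𝒰 k, Φ c ∈ finSub R 𝒱 m) {c : chains R X k}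
    (hc : c ∈ subchains R X 𝒰 k) : lfExtend Φ hΦ c ∈ subchains R X 𝒱 m := by
  intro τ h0
  by_contra hcon
  exact h0 ((Finsupp.mem_supported' R _).1 (h _ (truncate_mem_finSub _ hc)) τ hcon)

theorem lfExtend_eq_zero {𝒰 : Set (Set X)} {k m : ℕ}
    {Φ : FinChain R X k →ₗ[R] FinChain R X m} {hΦ : Carried Φ}
    (h : ∀ c ∈ finSub R 𝒰 k, Φ c = 0) {c : chains R X k}
    (hc : c ∈ subchains R X 𝒰 k) : lfExtend Φ hΦ c = 0 := by
  ext τ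
  change Φ _ τ = 0
  rw [h _ (truncate_mem_finSub _ hc)]
  rfl

end LocallyFinite

/-! ### Chain theories with supports -/

section BoundaryIn

variable {R : Type*} [CommRing R] {C : ℕ → Type*} [∀ k, AddCommGroup (C k)] [∀ k, Module R (C k)]

/-- The chains whose boundary (if there is one) lies in given submodules. -/
def boundaryIn (d : ∀ k, C (k + 1) →ₗ[R] C k) (P : ∀ k, Submodule R (C k)) :
    ∀ k, Submodule R (C k)
  | 0 => ⊤
  | k + 1 => (P k).comap (d k)

variable {d : ∀ k, C (k + 1) →ₗ[R] C k} {P Q : ∀ k, Submodule R (C k)}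

theorem boundaryIn_mono (h : ∀ k, P k ≤ Q k) : ∀ k, boundaryIn d P k ≤ boundaryIn d Q k
  | 0 => le_rfl
  | k + 1 => Submodule.comap_mono (h k)

theorem boundaryIn_inf_le : ∀ k, boundaryIn d P k ⊓ boundaryIn d Q k ≤
    boundaryIn d (fun k => P k ⊓ Q k) k
  | 0 => le_top
  | _ + 1 => le_rfl

theorem le_boundaryIn (h : ∀ k, P (k + 1) ≤ (P k).comap (d k)) : ∀ k, P k ≤ boundaryIn d P k
  | 0 => le_top
  | k + 1 => h k

theorem boundary_mem_boundaryIn (hdd : ∀ k c, d k (d (k + 1) c) = 0)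
    (P : ∀ k, Submodule R (C k)) : ∀ k c, d k c ∈ boundaryIn d P k
  | 0, _ => trivial
  | k + 1, c => by
    change d k (d (k + 1) c) ∈ P k
    rw [hdd]
    exact Submodule.zero_mem _

end BoundaryIn

/-- Modules of chains on `X` with boundary homomorphisms and submodules of chains supported in a
subset, satisfying excision. -/
structure ChainTheory (R : Type*) [CommRing R] (X : Type*) [TopologicalSpace X] where
  /-- The chains. -/
  C : ℕ → Type*
  [grp : ∀ k, AddCommGroup (C k)]
  [mod : ∀ k, Module R (C k)]
  /-- The boundary. -/
  d : ∀ k, C (k + 1) →ₗ[R] C k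
  d_d : ∀ k c, d k (d (k + 1) c) = 0
  /-- The chains supported in a subset. -/
  S : Set X → ∀ k, Submodule R (C k)
  S_mono : ∀ {U V : Set X}, U ⊆ V → ∀ k, S U k ≤ S V k
  S_inf : ∀ (U V : Set X) k, S U k ⊓ S V k ≤ S (U ∩ V) k
  d_mem : ∀ U k, S U (k + 1) ≤ (S U k).comap (d k)
  excise : ∀ {U V : Set X}, IsOpen U → IsOpen V → ∀ {k} {g : C k}, g ∈ S (U ∪ V) k →
    g ∈ boundaryIn d (fun k => S U k ⊔ S V k) k →
    ∃ g₁ ∈ S U k, ∃ g₂ ∈ S V k, ∃ w ∈ S (U ∪ V) (k + 1), g = g₁ + g₂ + d k w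

attribute [instance] ChainTheory.grp ChainTheory.mod

namespace ChainTheory

variable {R : Type*} [CommRing R] {X : Type*} [TopologicalSpace X] (T : ChainTheory R X)

/-- The cycles relative to the complement of `A`. -/
def cyc (A : Set X) (k : ℕ) : Submodule R (T.C k) := boundaryIn T.d (T.S Aᶜ) k

/-- The boundaries relative to the complement of `A`. -/
def bnd (A : Set X) (k : ℕ) : Submodule R (T.C k) := T.S Aᶜ k ⊔ LinearMap.range (T.d k)

variable {T} {A B : Set X} {k : ℕ}

theorem mem_bnd_iff {c : T.C k} : c ∈ T.bnd A k ↔ ∃ b, c - T.d k b ∈ T.S Aᶜ k := by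
  rw [bnd, Submodule.mem_sup]
  constructor
  · rintro ⟨e, he, _, ⟨b, rfl⟩, rfl⟩
    exact ⟨b, by rwa [add_sub_cancel_right]⟩
  · rintro ⟨b, hb⟩
    exact ⟨_, hb, _, ⟨b, rfl⟩, sub_add_cancel _ _⟩

theorem boundary_mem_bnd (b : T.C (k + 1)) : T.d k b ∈ T.bnd A k :=
  Submodule.mem_sup_right ⟨b, rfl⟩

theorem S_le_bnd : T.S Aᶜ k ≤ T.bnd A k := le_sup_left

theorem boundary_mem_cyc (b : T.C (k + 1)) : T.d k b ∈ T.cyc A k :=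
  boundary_mem_boundaryIn T.d_d _ k b

theorem S_le_cyc : T.S Aᶜ k ≤ T.cyc A k := le_boundaryIn (T.d_mem _) k

theorem bnd_le_cyc : T.bnd A k ≤ T.cyc A k := by
  refine sup_le S_le_cyc ?_
  rintro _ ⟨b, rfl⟩
  exact boundary_mem_cyc b

theorem cyc_mono (h : A ⊆ B) : T.cyc B k ≤ T.cyc A k :=
  boundaryIn_mono (T.S_mono (Set.compl_subset_compl.2 h)) k

theorem bnd_mono (h : A ⊆ B) : T.bnd B k ≤ T.bnd A k :=
  sup_le_sup_right (T.S_mono (Set.compl_subset_compl.2 h) k) _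

theorem cyc_inf_le : T.cyc A k ⊓ T.cyc B k ≤ T.cyc (A ∪ B) k := by
  refine (boundaryIn_inf_le k).trans (boundaryIn_mono (fun k => ?_) k)
  rw [Set.compl_union]
  exact T.S_inf _ _ k

theorem mem_cyc_succ_iff {c : T.C (k + 1)} : c ∈ T.cyc A (k + 1) ↔ T.d k c ∈ T.S Aᶜ k := Iff.rfl

/-- Excision for the complements of two closed sets. -/
theorem excise_compl (hA : IsClosed A) (hB : IsClosed B) {g : T.C k} (hg : g ∈ T.S (A ∩ B)ᶜ k)
    (hg' : g ∈ boundaryIn T.d (fun k => T.S Aᶜ k ⊔ T.S Bᶜ k) k) :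
    ∃ g₁ ∈ T.S Aᶜ k, ∃ g₂ ∈ T.S Bᶜ k, ∃ w ∈ T.S (A ∩ B)ᶜ (k + 1), g = g₁ + g₂ + T.d k w := by
  rw [Set.compl_inter] at hg ⊢
  exact T.excise hA.isOpen_compl hB.isOpen_compl hg hg'

/-- Mayer-Vietoris: a class on `A ∪ B` that vanishes on `A` and on `B` vanishes if there is no
homology one degree up on `A ∩ B`. -/
theorem mem_bnd_union (hA : IsClosed A) (hB : IsClosed B)
    (hv : T.cyc (A ∩ B) (k + 1) ≤ T.bnd (A ∩ B) (k + 1)) {c : T.C k}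
    (hcA : c ∈ T.bnd A k) (hcB : c ∈ T.bnd B k) : c ∈ T.bnd (A ∪ B) k := by
  obtain ⟨b₁, h₁⟩ := mem_bnd_iff.1 hcA
  obtain ⟨b₂, h₂⟩ := mem_bnd_iff.1 hcB
  have hd : T.d k (b₁ - b₂) = (c - T.d k b₂) - (c - T.d k b₁) := by
    rw [map_sub]; abel
  have hd' : T.d k (b₁ - b₂) ∈ T.S Aᶜ k ⊔ T.S Bᶜ k := by
    rw [hd]
    exact Submodule.sub_mem _ (Submodule.mem_sup_right h₂) (Submodule.mem_sup_left h₁)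
  have hcyc : b₁ - b₂ ∈ T.cyc (A ∩ B) (k + 1) := by
    refine mem_cyc_succ_iff.2 (sup_le (T.S_mono ?_ k) (T.S_mono ?_ k) hd')
    · exact Set.compl_subset_compl.2 Set.inter_subset_left
    · exact Set.compl_subset_compl.2 Set.inter_subset_right
  obtain ⟨f, hf⟩ := mem_bnd_iff.1 (hv hcyc)
  -- Splitting the difference of the two bounding chains makes `b₁ - g₁` and `b₂ + g₂` have the same
  -- boundary. That boundary differs from `c` by a chain avoiding `A` and also by one avoiding `B`.
  obtain ⟨g₁, hg₁, g₂, hg₂, w, -, hw⟩ := excise_compl hA hB hf (k := k + 1) (by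
    change T.d k (b₁ - b₂ - T.d (k + 1) f) ∈ T.S Aᶜ k ⊔ T.S Bᶜ k
    rw [map_sub, T.d_d, sub_zero]
    exact hd')
  refine mem_bnd_iff.2 ⟨b₁ - g₁, ?_⟩
  have e₁ : c - T.d k (b₁ - g₁) = (c - T.d k b₁) + T.d k g₁ := by
    rw [map_sub]; abel
  have e₂ : c - T.d k (b₁ - g₁) = (c - T.d k b₂) - T.d k g₂ := by
    have h3 := congrArg (T.d k) hw
    rw [map_sub, T.d_d, sub_zero, map_add, map_add, T.d_d, add_zero, map_sub] at h3
    rw [map_sub, sub_eq_iff_eq_add.1 h3]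
    abel
  rw [Set.compl_union]
  refine T.S_inf _ _ k ⟨?_, ?_⟩
  · rw [e₁]; exact Submodule.add_mem _ h₁ (T.d_mem _ _ hg₁)
  · rw [e₂]; exact Submodule.sub_mem _ h₂ (T.d_mem _ _ hg₂)

/-- Mayer-Vietoris: classes on `A` and `B` that agree on `A ∩ B` come from a class on `A ∪ B`. -/
theorem exists_glue (hA : IsClosed A) (hB : IsClosed B) {c₁ c₂ : T.C k}
    (h₁ : c₁ ∈ T.cyc A k) (h₂ : c₂ ∈ T.cyc B k) (h : c₁ - c₂ ∈ T.bnd (A ∩ B) k) :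
    ∃ c ∈ T.cyc (A ∪ B) k, c - c₁ ∈ T.bnd A k ∧ c - c₂ ∈ T.bnd B k := by
  obtain ⟨f, hf⟩ := mem_bnd_iff.1 h
  have hsum : c₁ - c₂ - T.d k f ∈ boundaryIn T.d (fun k => T.S Aᶜ k ⊔ T.S Bᶜ k) k := by
    refine Submodule.sub_mem _ (Submodule.sub_mem _ ?_ ?_) (boundary_mem_boundaryIn T.d_d _ k f)
    · exact boundaryIn_mono (fun _ => le_sup_left) k h₁
    · exact boundaryIn_mono (fun _ => le_sup_right) k h₂
  -- The glued chain is `c₂ + g₂ = c₁ - g₁ - ∂(f + w)`: the first form compares it with `c₂`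
  -- relative to `B`, the second with `c₁` relative to `A`.
  obtain ⟨g₁, hg₁, g₂, hg₂, w, -, hw⟩ := excise_compl hA hB hf hsum
  have hc₁ : c₂ + g₂ - c₁ ∈ T.bnd A k := by
    refine mem_bnd_iff.2 ⟨-(f + w), ?_⟩
    have : c₂ + g₂ - c₁ - T.d k (-(f + w)) = -g₁ := by
      rw [map_neg, map_add, ← sub_eq_zero]
      have h3 := sub_eq_zero.2 hw
      rw [← neg_eq_zero, ← h3]
      abel
    rw [this]
    exact Submodule.neg_mem _ hg₁
  have hc₂ : c₂ + g₂ - c₂ ∈ T.bnd B k := by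
    rw [add_sub_cancel_left]
    exact S_le_bnd hg₂
  refine ⟨c₂ + g₂, cyc_inf_le ⟨?_, Submodule.add_mem _ h₂ (S_le_cyc hg₂)⟩, hc₁, hc₂⟩
  have := Submodule.add_mem _ (bnd_le_cyc hc₁) h₁
  rwa [sub_add_cancel] at this

/-- Mayer-Vietoris: vanishing on `A ∩ B` follows from vanishing on `A` and `B` and vanishing one
degree down on `A ∪ B`. -/
theorem cyc_le_bnd_inter (hA : IsClosed A) (hB : IsClosed B)
    (hvA : T.cyc A (k + 1) ≤ T.bnd A (k + 1)) (hvB : T.cyc B (k + 1) ≤ T.bnd B (k + 1))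
    (hv : T.cyc (A ∪ B) k ≤ T.bnd (A ∪ B) k) :
    T.cyc (A ∩ B) (k + 1) ≤ T.bnd (A ∩ B) (k + 1) := by
  intro c hc
  obtain ⟨g₁, hg₁, g₂, hg₂, w, hwS, hw⟩ := excise_compl hA hB (g := T.d k c) hc
    (boundary_mem_boundaryIn T.d_d _ k c)
  -- This is the connecting homomorphism: the part `g₁` of the boundary of `c` avoids `A`, while up
  -- to a boundary it is `-g₂`, which avoids `B`.
  have hg : g₁ ∈ T.cyc (A ∪ B) k := by
    refine cyc_inf_le ⟨S_le_cyc hg₁, ?_⟩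
    have : g₁ = T.d k (c - w) - g₂ := by rw [map_sub, hw]; abel
    rw [this]
    exact Submodule.sub_mem _ (boundary_mem_cyc _) (S_le_cyc hg₂)
  -- A chain bounding `g₁` splits `c - w` into `f`, a cycle relative to `A`, and `c - w - f`, a
  -- cycle relative to `B`.
  obtain ⟨f, hf⟩ := mem_bnd_iff.1 (hv hg)
  rw [Set.compl_union] at hf
  have hfA : f ∈ T.bnd (A ∩ B) (k + 1) := by
    refine bnd_mono Set.inter_subset_left (hvA (mem_cyc_succ_iff.2 ?_))
    have : T.d k f = g₁ - (g₁ - T.d k f) := by abel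
    rw [this]
    exact Submodule.sub_mem _ hg₁ (T.S_mono Set.inter_subset_left k hf)
  have hfB : c - w - f ∈ T.bnd (A ∩ B) (k + 1) := by
    refine bnd_mono Set.inter_subset_right (hvB (mem_cyc_succ_iff.2 ?_))
    have : T.d k (c - w - f) = g₂ + (g₁ - T.d k f) := by
      rw [map_sub, map_sub, hw]; abel
    rw [this]
    exact Submodule.add_mem _ hg₂ (T.S_mono Set.inter_subset_right k hf)
  have : c = (c - w - f) + f + w := by abel
  rw [this]
  exact Submodule.add_mem _ (Submodule.add_mem _ hfB hfA) (S_le_bnd hwS)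

theorem cyc_le_bnd_union (hA : IsClosed A) (hB : IsClosed B)
    (hvA : T.cyc A k ≤ T.bnd A k) (hvB : T.cyc B k ≤ T.bnd B k)
    (hv : T.cyc (A ∩ B) (k + 1) ≤ T.bnd (A ∩ B) (k + 1)) :
    T.cyc (A ∪ B) k ≤ T.bnd (A ∪ B) k := fun _ hc =>
  mem_bnd_union hA hB hv (hvA (cyc_mono Set.subset_union_left hc))
    (hvB (cyc_mono Set.subset_union_right hc))

end ChainTheory

/-! ### The finite and the locally finite theories -/

section Theories

variable {R : Type*} [CommRing R] {X : Type*} [TopologicalSpace X]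

/-- Refinement of finite chains. -/
theorem exists_refine_fin {𝒰 : Set (Set X)} (h𝒰 : ∀ U ∈ 𝒰, IsOpen U) {k : ℕ} {g : FinChain R X k}
    (hg : g ∈ finSub R {⋃₀ 𝒰} k) (hg' : g ∈ boundaryIn finBoundary (finSub R 𝒰) k) :
    ∃ g' ∈ finSub R 𝒰 k, ∃ w ∈ finSub R {⋃₀ 𝒰} (k + 1), g = g' + finBoundary k w := by
  refine ⟨g - finBoundary k (refineHomotopy R 𝒰 k g), ?_, refineHomotopy R 𝒰 k g,
    (carried_refineHomotopy 𝒰 k).mem_finSub hg, (sub_add_cancel _ _).symm⟩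
  cases k with
  | zero => exact refineHomotopy_zero h𝒰 hg
  | succ k =>
    have := refineHomotopy_succ h𝒰 hg
    rwa [refineHomotopy_eq_zero (c := finBoundary k g) hg', sub_zero] at this

/-- Refinement of locally finite chains. -/
theorem exists_refine {𝒰 : Set (Set X)} (h𝒰 : ∀ U ∈ 𝒰, IsOpen U) {k : ℕ} {g : chains R X k}
    (hg : g ∈ subchains R X {⋃₀ 𝒰} k)
    (hg' : g ∈ boundaryIn (boundary R X) (subchains R X 𝒰) k) :
    ∃ g' ∈ subchains R X 𝒰 k, ∃ w ∈ subchains R X {⋃₀ 𝒰} (k + 1), g = g' + boundary R X k w := by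
  have hD := carried_refineHomotopy (R := R) (X := X) 𝒰
  refine ⟨g - boundary R X k (lfExtend _ (hD k) g), ?_, lfExtend _ (hD k) g,
    lfExtend_mem_subchains (fun c hc => (hD k).mem_finSub hc) hg, (sub_add_cancel _ _).symm⟩
  rw [boundary_eq_lfExtend, lfExtend_comp]
  cases k with
  | zero =>
    have h2 := lfExtend_mem_subchains
      (hΦ := (carried_id 0).sub ((carried_finBoundary 0).comp (hD 0)))
      (fun c hc => refineHomotopy_zero h𝒰 hc) hg
    rwa [lfExtend_sub (carried_id 0) ((carried_finBoundary 0).comp (hD 0)), lfExtend_id] at h2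
  | succ k =>
    -- The boundary of `g` is already small, so the homotopy term on it disappears and the remainder
    -- is `g` minus a boundary.
    have h1 : lfExtend _ (hD k) (boundary R X k g) = 0 :=
      lfExtend_eq_zero (fun c hc => refineHomotopy_eq_zero hc) hg'
    rw [boundary_eq_lfExtend, lfExtend_comp] at h1
    have h2 := lfExtend_mem_subchains (hΦ := ((carried_id (k + 1)).sub
      ((carried_finBoundary (k + 1)).comp (hD (k + 1)))).sub ((hD k).comp (carried_finBoundary k)))
      (fun c hc => refineHomotopy_succ h𝒰 hc) hg
    rwa [lfExtend_sub ((carried_id (k + 1)).sub ((carried_finBoundary (k + 1)).comp (hD (k + 1))))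
      ((hD k).comp (carried_finBoundary k)), h1, sub_zero, lfExtend_sub (carried_id (k + 1))
      ((carried_finBoundary (k + 1)).comp (hD (k + 1))), lfExtend_id] at h2

theorem finSub_pair_le (U V : Set X) (k : ℕ) :
    finSub R {U, V} k ≤ finSub R {U} k ⊔ finSub R {V} k := by
  rw [finSub, finSub, finSub, ← Finsupp.supported_union]
  refine Finsupp.supported_mono ?_
  rintro σ ⟨W, rfl | rfl, hW⟩
  · exact Or.inl ⟨W, rfl, hW⟩
  · exact Or.inr ⟨W, rfl, hW⟩

theorem finSub_le_pair (U V : Set X) (k : ℕ) :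
    finSub R {U} k ⊔ finSub R {V} k ≤ finSub R {U, V} k := by
  rw [finSub, finSub, finSub, ← Finsupp.supported_union]
  refine Finsupp.supported_mono ?_
  rintro σ (⟨_, rfl, hW⟩ | ⟨_, rfl, hW⟩)
  · exact ⟨_, Or.inl rfl, hW⟩
  · exact ⟨_, Or.inr rfl, hW⟩

theorem subchains_le_pair (U V : Set X) (k : ℕ) :
    subchains R X {U} k ⊔ subchains R X {V} k ≤ subchains R X {U, V} k := by
  refine sup_le (fun c hc σ h => ?_) (fun c hc σ h => ?_)
  · obtain ⟨_, rfl, hW⟩ := hc σ h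
    exact ⟨_, Or.inl rfl, hW⟩
  · obtain ⟨_, rfl, hW⟩ := hc σ h
    exact ⟨_, Or.inr rfl, hW⟩

open scoped Classical in
/-- The part of a locally finite chain consisting of the simplices in a given set. -/
def restrictTo (P : ∀ k, Set (Simplex k X)) (k : ℕ) (c : chains R X k) : chains R X k :=
  ⟨fun σ => if σ ∈ P k then c.1 σ else 0, fun x => by
    obtain ⟨U, hU, hxU, hfU⟩ := c.2 x
    refine ⟨U, hU, hxU, hfU.subset ?_⟩
    rintro σ ⟨h0, hσ⟩
    exact ⟨fun h => h0 (by simp [h]), hσ⟩⟩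

/-- Simplices inside `U` form one part and the rest the other. Selecting simplices keeps local
finiteness. -/
theorem subchains_pair_le (U V : Set X) (k : ℕ) :
    subchains R X {U, V} k ≤ subchains R X {U} k ⊔ subchains R X {V} k := by
  classical
  intro c hc
  have h1 : restrictTo (fun _ => {σ | Set.range σ ⊆ U}) k c ∈ subchains R X {U} k := by
    intro σ h
    by_cases hσ : Set.range σ ⊆ U
    · exact ⟨U, rfl, hσ⟩
    · exact absurd (if_neg hσ) h
  have h2 : c - restrictTo (fun _ => {σ | Set.range σ ⊆ U}) k c ∈ subchains R X {V} k := by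
    intro σ h
    change c.1 σ - (if Set.range σ ⊆ U then c.1 σ else 0) ≠ 0 at h
    by_cases hσ : Set.range σ ⊆ U
    · rw [if_pos hσ, sub_self] at h
      exact absurd rfl h
    · rw [if_neg hσ, sub_zero] at h
      obtain ⟨W, rfl | rfl, hW⟩ := hc σ h
      · exact absurd hW hσ
      · exact ⟨_, rfl, hW⟩
  have := Submodule.add_mem_sup h1 h2
  rwa [add_sub_cancel] at this

theorem mem_subchains_singleton {U : Set X} {k : ℕ} {c : chains R X k} :
    c ∈ subchains R X {U} k ↔ ∀ σ, c.1 σ ≠ 0 → Set.range σ ⊆ U := by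
  constructor
  · intro h σ hσ
    obtain ⟨_, rfl, h'⟩ := h σ hσ
    exact h'
  · exact fun h σ hσ => ⟨U, rfl, h σ hσ⟩

theorem finSub_singleton (U : Set X) (k : ℕ) :
    finSub R {U} k = Finsupp.supported R R {σ : Simplex k X | Set.range σ ⊆ U} := by
  simp [finSub]

variable (R X) in
/-- Finite singular chains. -/
abbrev finTheory : ChainTheory R X where
  C := FinChain R X
  d := finBoundary
  d_d _ := finBoundary_finBoundary
  S U := finSub R {U}
  S_mono {U V} h k := by
    rw [finSub_singleton, finSub_singleton]
    exact Finsupp.supported_mono fun σ hσ => hσ.trans h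
  S_inf U V k := by
    rw [finSub_singleton, finSub_singleton, finSub_singleton, ← Finsupp.supported_inter]
    exact Finsupp.supported_mono fun σ hσ => Set.subset_inter hσ.1 hσ.2
  d_mem U k := fun _ hc => (carried_finBoundary k).mem_finSub hc
  excise {U V} hU hV k g hg hg' := by
    rw [← Set.sUnion_pair] at hg ⊢
    obtain ⟨g', h', w, hw, rfl⟩ := exists_refine_fin (𝒰 := {U, V})
      (by rintro _ (rfl | rfl) <;> assumption) hg (boundaryIn_mono (finSub_le_pair U V) k hg')
    obtain ⟨g₁, h₁, g₂, h₂, rfl⟩ := Submodule.mem_sup.1 (finSub_pair_le U V k h')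
    exact ⟨g₁, h₁, g₂, h₂, w, hw, rfl⟩

variable (R X) in
/-- Locally finite singular chains. -/
abbrev lfTheory : ChainTheory R X where
  C k := chains R X k
  d := boundary R X
  d_d := boundary_boundary R X
  S U := subchains R X {U}
  S_mono h k := subchains_mono R h k
  S_inf U V k := fun c hc => mem_subchains_singleton.2 fun σ hσ =>
    Set.subset_inter (mem_subchains_singleton.1 hc.1 σ hσ) (mem_subchains_singleton.1 hc.2 σ hσ)
  d_mem U k := subchains_le_comap_boundary R X {U} k
  excise {U V} hU hV k g hg hg' := by
    rw [← Set.sUnion_pair] at hg ⊢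
    obtain ⟨g', h', w, hw, rfl⟩ := exists_refine (𝒰 := {U, V})
      (by rintro _ (rfl | rfl) <;> assumption) hg (boundaryIn_mono (subchains_le_pair U V) k hg')
    obtain ⟨g₁, h₁, g₂, h₂, rfl⟩ := Submodule.mem_sup.1 (subchains_pair_le U V k h')
    exact ⟨g₁, h₁, g₂, h₂, w, hw, rfl⟩

end Theories

/-! ### Consequences of homotopy invariance for finite chains -/

section Deformation

variable {R : Type*} [CommRing R] {X Y : Type*} [TopologicalSpace X] [TopologicalSpace Y]

theorem mem_finSub_univ {k : ℕ} (c : FinChain R X k) : c ∈ finSub R {Set.univ} k := by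
  simp [finSub_singleton]

theorem finTheory_bnd_empty (k : ℕ) : (finTheory R X).bnd ∅ k = ⊤ := by
  refine top_le_iff.1 fun c _ => ChainTheory.S_le_bnd ?_
  rw [Set.compl_empty]
  exact mem_finSub_univ c

theorem finSub_empty {k : ℕ} {c : FinChain R X k} (hc : c ∈ finSub R {∅} k) : c = 0 := by
  ext σ
  rw [finSub_singleton] at hc
  refine (Finsupp.mem_supported' R _).1 hc σ fun h => ?_
  exact (Set.range_nonempty σ).ne_empty (Set.subset_empty_iff.1 h)

theorem finPush_id {k : ℕ} (c : FinChain R X k) : finPush (ContinuousMap.id X) k c = c := by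
  have : (fun σ : Simplex k X => (ContinuousMap.id X).comp σ) = id := rfl
  rw [finPush, this, Finsupp.lmapDomain_id, LinearMap.id_apply]

/-- If the identity deforms to a map into the complement of `A`, through maps preserving this
complement, then there is no homology relative to the complement of `A`. -/
theorem cyc_le_bnd_of_homotopy (H : C(X × stdSimplex ℝ (Fin (1 + 1)), X)) {A : Set X}
    (h0 : ∀ x, H (x, vertices 1 0) = x) (h1 : ∀ x, H (x, vertices 1 1) ∉ A)
    (hA : ∀ x, x ∉ A → ∀ t, H (x, t) ∉ A) (k : ℕ) :
    (finTheory R X).cyc A k ≤ (finTheory R X).bnd A k := by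
  intro (c : FinChain R _ _) hc
  have e0 : homotopyAt H (vertices 1 0) = ContinuousMap.id X := ContinuousMap.ext h0
  have hpush : finPush (homotopyAt H (vertices 1 1)) k c ∈ finSub R {Aᶜ} k :=
    finPush_mem_finSub _ (fun x _ => h1 x) (mem_finSub_univ c)
  refine ChainTheory.mem_bnd_iff.2 ⟨-prism H k c, ?_⟩
  change c - finBoundary k (-prism H k c) ∈ finSub R {Aᶜ} k
  rw [map_neg, sub_neg_eq_add]
  cases k with
  | zero =>
    rw [finBoundary_prism_zero, e0, finPush_id, add_sub_cancel]
    exact hpush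
  | succ k =>
    have h2 := finBoundary_prism_succ H c
    rw [e0, finPush_id] at h2
    rw [eq_sub_of_add_eq h2, sub_right_comm, add_sub_cancel]
    refine Submodule.sub_mem _ ?_ (prism_mem_finSub H hA hc)
    simpa using hpush

theorem finPush_const (x₀ : X) {k : ℕ} (c : FinChain R Y k) :
    finPush (ContinuousMap.const Y x₀) k c =
      Finsupp.single (ContinuousMap.const _ x₀) (Finsupp.linearCombination R (fun _ => (1 : R)) c) := by
  induction c using Finsupp.induction_linear with
  | zero => simp
  | add x y hx hy => rw [map_add, hx, hy, map_add, Finsupp.single_add]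
  | single σ r =>
    rw [finPush_single, Finsupp.linearCombination_single, smul_eq_mul, mul_one]
    rfl

theorem finBoundary_const (x₀ : X) (k : ℕ) (r : R) :
    finBoundary k (Finsupp.single (ContinuousMap.const _ x₀) r) =
      Finsupp.single (ContinuousMap.const _ x₀) (if Even k then 0 else r) := by
  have hf : ∀ p, face p (ContinuousMap.const (stdSimplex ℝ (Fin (k + 1 + 1))) x₀) =
      ContinuousMap.const _ x₀ := fun p => rfl
  rw [finBoundary, altSum_single]
  simp only [hf]
  rw [← Finset.sum_smul, Fin.sum_neg_one_pow]
  have h2 : Even (k + 2) ↔ Even k := by simp [Nat.even_add]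
  by_cases hk : Even k
  · rw [if_pos (h2.2 hk), if_pos hk]; simp
  · rw [if_neg (fun h => hk (h2.1 h)), if_neg hk]; simp

/-- A contractible space has no homology in positive degrees. -/
theorem cyc_univ_le_bnd_univ (H : C(X × stdSimplex ℝ (Fin (1 + 1)), X)) (x₀ : X)
    (h0 : ∀ x, H (x, vertices 1 0) = x) (h1 : ∀ x, H (x, vertices 1 1) = x₀) {k : ℕ}
    (hk : 0 < k) :
    (finTheory R X).cyc Set.univ k ≤ (finTheory R X).bnd Set.univ k := by
  obtain ⟨k, rfl⟩ := Nat.exists_eq_succ_of_ne_zero hk.ne'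
  intro (c : FinChain R _ _) hc
  have e0 : homotopyAt H (vertices 1 0) = ContinuousMap.id X := ContinuousMap.ext h0
  have e1 : homotopyAt H (vertices 1 1) = ContinuousMap.const X x₀ := ContinuousMap.ext h1
  have hdc : finBoundary k c = 0 := by
    refine finSub_empty ?_
    rw [← Set.compl_univ]
    exact hc
  have h2 := finBoundary_prism_succ H c
  rw [e0, e1, finPush_id, hdc, map_zero, add_zero] at h2
  have h3 : c = finPush (ContinuousMap.const X x₀) (k + 1) c -
      finBoundary (k + 1) (prism H (k + 1) c) := by rw [h2, sub_sub_cancel]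
  rw [h3]
  refine Submodule.sub_mem _ ?_ (ChainTheory.boundary_mem_bnd (T := finTheory R X) _)
  rw [finPush_const]
  set r := Finsupp.linearCombination R (fun _ => (1 : R)) c with hr
  -- The cycle is now a multiple of a constant simplex. For even `k` that simplex is the boundary of
  -- the next constant one. For odd `k` its own boundary is the constant simplex one degree down, so
  -- being a cycle forces the coefficient to be zero.
  by_cases hev : Even k
  · have h4 := finBoundary_const x₀ (k + 1) r
    rw [if_neg (by simpa [Nat.even_add_one] using hev)] at h4
    rw [← h4]
    exact ChainTheory.boundary_mem_bnd (T := finTheory R X) _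
  · have h4 := finBoundary_const x₀ k r
    rw [if_neg hev, hr, ← finPush_const, finBoundary_finPush, hdc, map_zero] at h4
    rw [← hr, eq_comm, Finsupp.single_eq_zero] at h4
    rw [h4, Finsupp.single_zero]
    exact Submodule.zero_mem _

theorem exists_isOpen_of_mem_finSub_compl [T2Space X] {A : Set X} {k : ℕ} {e : FinChain R X k}
    (he : e ∈ finSub R {Aᶜ} k) : ∃ W : Set X, IsOpen W ∧ A ⊆ W ∧ e ∈ finSub R {Wᶜ} k := by
  rw [finSub_singleton] at he
  refine ⟨(⋃ σ ∈ e.support, Set.range σ)ᶜ, ?_, ?_, ?_⟩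
  · exact (e.support.finite_toSet.isCompact_biUnion fun σ _ =>
      isCompact_range_simplex σ).isClosed.isOpen_compl
  · rw [Set.subset_compl_comm]
    exact Set.iUnion₂_subset fun σ hσ => he hσ
  · rw [finSub_singleton, compl_compl]
    exact fun σ hσ => Set.subset_biUnion_of_mem (u := fun σ : Simplex k X => Set.range σ) hσ

end Deformation

/-! ### Vanishing in Euclidean space -/

section Euclidean

variable {R : Type*} [CommRing R] {n : ℕ}

/-- The homotopy moving one coordinate linearly to its image under a function. -/
def coordinateHomotopy (j : Fin n) (g : C(ℝ, ℝ)) :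
    C((Fin n → ℝ) × stdSimplex ℝ (Fin (1 + 1)), Fin n → ℝ) where
  toFun p := Function.update p.1 j (p.1 j + p.2.1 1 * (g (p.1 j) - p.1 j))
  continuous_toFun := by
    have h1 : Continuous fun p : (Fin n → ℝ) × stdSimplex ℝ (Fin (1 + 1)) => p.2.1 1 :=
      (continuous_apply 1).comp (continuous_subtype_val.comp continuous_snd)
    have h2 : Continuous fun p : (Fin n → ℝ) × stdSimplex ℝ (Fin (1 + 1)) => p.1 j :=
      (continuous_apply j).comp continuous_fst
    exact continuous_fst.update j (h2.add (h1.mul ((g.continuous.comp h2).sub h2)))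

theorem coordinateHomotopy_zero (j : Fin n) (g : C(ℝ, ℝ)) (x : Fin n → ℝ) :
    coordinateHomotopy j g (x, vertices 1 0) = x := by
  simp [coordinateHomotopy, vertices]

theorem coordinateHomotopy_one (j : Fin n) (g : C(ℝ, ℝ)) (x : Fin n → ℝ) :
    coordinateHomotopy j g (x, vertices 1 1) = Function.update x j (g (x j)) := by
  simp [coordinateHomotopy, vertices]

/-- The set of points with some coordinates constrained to lie in intervals. -/
def slab (s : Finset (Fin n)) (a b : Fin n → ℝ) : Set (Fin n → ℝ) :=
  {x | ∀ i ∈ s, a i ≤ x i ∧ x i ≤ b i}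

theorem isClosed_slab (s : Finset (Fin n)) (a b : Fin n → ℝ) : IsClosed (slab s a b) := by
  simp only [slab, Set.ofPred_forall]
  exact isClosed_biInter fun i _ => (isClosed_le continuous_const (continuous_apply i)).inter
    (isClosed_le (continuous_apply i) continuous_const)

theorem update_mem_slab_iff {s : Finset (Fin n)} {a b : Fin n → ℝ} {j : Fin n} (hj : j ∉ s)
    {x : Fin n → ℝ} {r : ℝ} : Function.update x j r ∈ slab s a b ↔ x ∈ slab s a b := by
  refine forall₂_congr fun i hi => ?_
  rw [Function.update_of_ne (by rintro rfl; exact hj hi)]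

/-- Pushing coordinate `j` out of `P` leaves the constraints in `s` untouched because `j ∉ s`, so
complements are preserved during the deformation. -/
theorem cyc_le_bnd_slab_inter {s : Finset (Fin n)} {a b : Fin n → ℝ} {j : Fin n} (hj : j ∉ s)
    (P : Set ℝ) (g : C(ℝ, ℝ)) (hg : ∀ r, g r ∉ P)
    (hP : ∀ r ∉ P, ∀ t : ℝ, 0 ≤ t → t ≤ 1 → r + t * (g r - r) ∉ P) (k : ℕ) :
    (finTheory R (Fin n → ℝ)).cyc (slab s a b ∩ {x | x j ∈ P}) k ≤
      (finTheory R (Fin n → ℝ)).bnd (slab s a b ∩ {x | x j ∈ P}) k := by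
  refine cyc_le_bnd_of_homotopy (coordinateHomotopy j g) (coordinateHomotopy_zero j g)
    (fun x hx => ?_) (fun x hx t ht => ?_) k
  · rw [coordinateHomotopy_one] at hx
    refine hg (x j) ?_
    simpa using hx.2
  · refine hx ⟨(update_mem_slab_iff hj).1 ht.1, ?_⟩
    by_contra hxP
    refine hP (x j) hxP (t.1 1) (t.2.1 1) (stdSimplex.le_one t 1) ?_
    have := ht.2
    simpa [coordinateHomotopy] using this

/-- A new constraint `a j ≤ x j ≤ b j` is the intersection of two half-slabs whose union is the old
slab, since `a j ≤ b j`. The half-slabs have no homology, so Mayer-Vietoris raises the vanishing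
bound by exactly one per coordinate. With no constraints the statement is contractibility of `ℝⁿ`.
-/
theorem cyc_le_bnd_slab {a b : Fin n → ℝ} (hab : a ≤ b) (s : Finset (Fin n)) :
    ∀ k, s.card < k → (finTheory R (Fin n → ℝ)).cyc (slab s a b) k ≤
      (finTheory R (Fin n → ℝ)).bnd (slab s a b) k := by
  induction s using Finset.induction_on with
  | empty =>
    intro k hk
    have huniv : slab (∅ : Finset (Fin n)) a b = Set.univ := by simp [slab]
    rw [huniv]
    refine cyc_univ_le_bnd_univ ⟨fun p => p.1 + p.2.1 1 • (0 - p.1), ?_⟩ 0 (fun x => ?_)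
      (fun x => ?_) hk
    · have h1 : Continuous fun p : (Fin n → ℝ) × stdSimplex ℝ (Fin (1 + 1)) => p.2.1 1 :=
        (continuous_apply 1).comp (continuous_subtype_val.comp continuous_snd)
      exact continuous_fst.add (h1.smul (continuous_const.sub continuous_fst))
    · simp [vertices]
    · simp [vertices]
  | insert j s hj ih =>
    intro k hk
    rw [Finset.card_insert_of_notMem hj] at hk
    obtain ⟨k, rfl⟩ := Nat.exists_eq_succ_of_ne_zero (Nat.ne_of_gt (Nat.zero_lt_of_lt hk))
    have hinter : slab (insert j s) a b = (slab s a b ∩ {x | x j ∈ Set.Ici (a j)}) ∩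
        (slab s a b ∩ {x | x j ∈ Set.Iic (b j)}) := by
      ext x
      simp only [slab, Finset.forall_mem_insert, Set.mem_inter_iff, Set.mem_ofPred_eq, Set.mem_Ici,
        Set.mem_Iic]
      tauto
    have hunion : (slab s a b ∩ {x | x j ∈ Set.Ici (a j)}) ∪
        (slab s a b ∩ {x | x j ∈ Set.Iic (b j)}) = slab s a b := by
      rw [← Set.inter_union_distrib_left]
      refine Set.inter_eq_left.2 fun x _ => ?_
      rcases le_total (a j) (x j) with h | h
      · exact Or.inl h
      · exact Or.inr (h.trans (hab j))
    rw [hinter]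
    refine ChainTheory.cyc_le_bnd_inter ?_ ?_ ?_ ?_ ?_
    · exact (isClosed_slab s a b).inter (isClosed_Ici.preimage (continuous_apply j))
    · exact (isClosed_slab s a b).inter (isClosed_Iic.preimage (continuous_apply j))
    -- The target `min r (a j - 1)` is strictly below `a j`, and a coordinate already below only
    -- moves downwards.
    · refine cyc_le_bnd_slab_inter hj _ ⟨fun r => min r (a j - 1), by fun_prop⟩ (fun r => ?_)
        (fun r hr t ht _ => ?_) _
      · simp
      · rw [Set.mem_Ici, not_le] at hr ⊢
        have : min r (a j - 1) - r ≤ 0 := by linarith [min_le_left r (a j - 1)]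
        have := mul_nonpos_of_nonneg_of_nonpos ht this
        change r + t * (min r (a j - 1) - r) < a j
        linarith
    · refine cyc_le_bnd_slab_inter hj _ ⟨fun r => max r (b j + 1), by fun_prop⟩ (fun r => ?_)
        (fun r hr t ht _ => ?_) _
      · simp
      · rw [Set.mem_Iic, not_le] at hr ⊢
        have : 0 ≤ max r (b j + 1) - r := by linarith [le_max_left r (b j + 1)]
        have := mul_nonneg ht this
        change b j < r + t * (max r (b j + 1) - r)
        linarith
    · rw [hunion]
      exact ih k (Nat.lt_of_succ_lt_succ hk)

theorem cyc_le_bnd_Icc (a b : Fin n → ℝ) {k : ℕ} (hk : n < k) :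
    (finTheory R (Fin n → ℝ)).cyc (Set.Icc a b) k ≤
      (finTheory R (Fin n → ℝ)).bnd (Set.Icc a b) k := by
  by_cases hab : a ≤ b
  · have : Set.Icc a b = slab Finset.univ a b := by
      ext x
      simp [slab, Pi.le_def, forall_and]
    rw [this]
    exact cyc_le_bnd_slab hab _ k (by simpa using hk)
  · rw [Set.Icc_eq_empty hab, finTheory_bnd_empty]
    exact le_top

/-- The intersection of a box with a union of boxes is again a union of as many boxes. The induction
hypothesis must therefore cover all families of endpoints. -/
theorem cyc_le_bnd_biUnion_Icc {ι : Type*} (s : Finset ι) :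
    ∀ (a b : ι → Fin n → ℝ) (k : ℕ), n < k →
      (finTheory R (Fin n → ℝ)).cyc (⋃ i ∈ s, Set.Icc (a i) (b i)) k ≤
      (finTheory R (Fin n → ℝ)).bnd (⋃ i ∈ s, Set.Icc (a i) (b i)) k := by
  classical
  induction s using Finset.induction_on with
  | empty =>
    intro a b k _
    simp only [Finset.notMem_empty, Set.iUnion_of_empty, Set.iUnion_empty, finTheory_bnd_empty,
      le_top]
  | insert j s hj ih =>
    intro a b k hk
    rw [Finset.set_biUnion_insert]
    refine ChainTheory.cyc_le_bnd_union isClosed_Icc ?_ (cyc_le_bnd_Icc _ _ hk) (ih a b k hk) ?_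
    · exact s.finite_toSet.isClosed_biUnion fun i _ => isClosed_Icc
    · simp only [Set.inter_iUnion, Set.Icc_inter_Icc]
      exact ih _ _ _ (Nat.lt_succ_of_lt hk)

/-- Compact subsets of `ℝⁿ` have no relative homology in degrees greater than `n`. -/
theorem cyc_le_bnd_of_isCompact_pi {K : Set (Fin n → ℝ)} (hK : IsCompact K) {k : ℕ} (hk : n < k) :
    (finTheory R (Fin n → ℝ)).cyc K k ≤ (finTheory R (Fin n → ℝ)).bnd K k := by
  obtain ⟨k, rfl⟩ := Nat.exists_eq_succ_of_ne_zero (Nat.ne_of_gt (Nat.zero_lt_of_lt hk))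
  intro (c : FinChain R _ _) hc
  -- The boundary of the finite cycle avoids a neighborhood `W` of `K`. Finitely many boxes inside
  -- `W` cover `K`; over their union `c` is still a cycle, hence bounds, and this restricts to `K`.
  obtain ⟨W, hW, hKW, hcW⟩ := exists_isOpen_of_mem_finSub_compl (ChainTheory.mem_cyc_succ_iff.1 hc)
  have hbox : ∀ x ∈ K, ∃ ε : ℝ, 0 < ε ∧
      Set.Icc (x - fun _ => ε) (x + fun _ => ε) ⊆ W := fun x hx => by
    obtain ⟨ε, hε, h⟩ := Metric.nhds_basis_closedBall.mem_iff.1 (hW.mem_nhds (hKW hx))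
    refine ⟨ε, hε, fun y hy => h ?_⟩
    rw [Metric.mem_closedBall, dist_pi_le_iff hε.le]
    intro i
    have h1 := hy.1 i
    have h2 := hy.2 i
    simp only [Pi.sub_apply, Pi.add_apply] at h1 h2
    rw [Real.dist_eq, abs_le]
    constructor <;> linarith
  choose! ε hε hεW using hbox
  obtain ⟨t, htK, ht⟩ := hK.elim_nhds_subcover
    (fun x => Set.Icc (x - fun _ => ε x) (x + fun _ => ε x)) (fun x hx =>
      pi_Icc_mem_nhds (fun i => by simpa using hε x hx) (fun i => by simpa using hε x hx))
  refine ChainTheory.bnd_mono ht (cyc_le_bnd_biUnion_Icc t _ _ _ hk ?_)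
  refine ChainTheory.mem_cyc_succ_iff.2 ((finTheory R (Fin n → ℝ)).S_mono ?_ _ hcW)
  exact Set.compl_subset_compl.2 (Set.iUnion₂_subset fun x hx => hεW x (htK x hx))

end Euclidean

/-! ### Open embeddings -/

theorem range_union_compl_image {X Y : Type*} (f : Y → X) (K : Set Y) :
    Set.range f ∪ (f '' K)ᶜ = Set.univ :=
  Set.eq_univ_of_forall fun x => by
    by_cases hx : x ∈ f '' K
    · exact Or.inl (Set.image_subset_range f K hx)
    · exact Or.inr hx

section Embedding

variable {R : Type*} [CommRing R] {X Y : Type*} [TopologicalSpace X] [TopologicalSpace Y]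

theorem finPush_mem_finSub_iff (f : C(Y, X)) (hf : Function.Injective f) {U : Set X} {k : ℕ}
    {c : FinChain R Y k} : finPush f k c ∈ finSub R {U} k ↔ c ∈ finSub R {f ⁻¹' U} k := by
  refine ⟨fun h => ?_, finPush_mem_finSub f (Set.mapsTo_preimage f U)⟩
  rw [finSub_singleton] at h ⊢
  refine (Finsupp.mem_supported' R _).2 fun σ hσ => ?_
  have hinj : Function.Injective fun σ : Simplex k Y => f.comp σ := fun σ τ h =>
    ContinuousMap.ext fun t => hf (DFunLike.congr_fun h t)
  rw [← Finsupp.mapDomain_apply hinj c σ]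
  refine (Finsupp.mem_supported' R _).1 h _ fun hσ' => hσ ?_
  rintro _ ⟨t, rfl⟩
  exact hσ' ⟨t, rfl⟩

theorem exists_finPush_eq (f : C(Y, X)) (hf : Topology.IsEmbedding f) {k : ℕ} {c : FinChain R X k}
    (hc : c ∈ finSub R {Set.range f} k) : ∃ b, finPush f k b = c := by
  suffices h : c ∈ LinearMap.range (finPush (R := R) f k) from h
  rw [finSub_singleton] at hc
  refine linearMap_mem_of_supported LinearMap.id _ (fun σ hσ => ?_) hc
  have hσ' : ∀ t, σ t ∈ Set.range f := fun t => hσ ⟨t, rfl⟩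
  choose g hg using hσ'
  have hgc : Continuous g := by
    rw [hf.continuous_iff]
    have : f ∘ g = σ := funext hg
    rw [this]
    exact σ.continuous
  refine ⟨Finsupp.single ⟨g, hgc⟩ 1, ?_⟩
  rw [finPush_single]
  congr 1
  exact ContinuousMap.ext hg

theorem preimage_compl_image (f : C(Y, X)) (hf : Function.Injective f) (K : Set Y) :
    f ⁻¹' (f '' K)ᶜ = Kᶜ := by
  rw [Set.preimage_compl, Set.preimage_image_eq K hf]

/-- A bounding chain in `X` is excised into a part in the open image of `Y`, which lifts, and a part
avoiding the image of `K`, which can be dropped. -/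
theorem cyc_le_bnd_of_image (f : C(Y, X)) (hf : Topology.IsOpenEmbedding f) {K : Set Y}
    (hK : IsClosed (f '' K)) {k : ℕ}
    (h : (finTheory R X).cyc (f '' K) k ≤ (finTheory R X).bnd (f '' K) k) :
    (finTheory R Y).cyc K k ≤ (finTheory R Y).bnd K k := by
  intro (c : FinChain R _ _) hc
  have hpre := preimage_compl_image f hf.injective K
  have hpush : ∀ {k : ℕ} {c : FinChain R Y k}, c ∈ finSub R {Kᶜ} k ↔
      finPush f k c ∈ finSub R {(f '' K)ᶜ} k := by
    intro k c
    rw [finPush_mem_finSub_iff f hf.injective, hpre]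
  have hcyc : finPush f k c ∈ (finTheory R X).cyc (f '' K) k := by
    cases k with
    | zero => trivial
    | succ k =>
      refine ChainTheory.mem_cyc_succ_iff.2 ?_
      change finBoundary k _ ∈ finSub R _ k
      rw [finBoundary_finPush, ← hpush]
      exact hc
  obtain ⟨b, hb⟩ := ChainTheory.mem_bnd_iff.1 (h hcyc)
  have hU := range_union_compl_image f K
  obtain ⟨b₁, hb₁, b₂, hb₂, w, -, rfl⟩ := (finTheory R X).excise hf.isOpen_range
    hK.isOpen_compl (g := b) (by rw [hU]; exact mem_finSub_univ b) (by
      change finBoundary k b ∈ finSub R {Set.range f} k ⊔ finSub R {(f '' K)ᶜ} k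
      have : finBoundary k b = finPush f k c - (finPush f k c - finBoundary k b) :=
        (sub_sub_cancel _ _).symm
      rw [this]
      exact Submodule.sub_mem _ (Submodule.mem_sup_left (finPush_mem_finSub f
        (fun x _ => Set.mem_range_self x) (mem_finSub_univ c))) (Submodule.mem_sup_right hb))
  obtain ⟨b₁, rfl⟩ := exists_finPush_eq f hf.isEmbedding hb₁
  refine ChainTheory.mem_bnd_iff.2 ⟨b₁, hpush.2 ?_⟩
  rw [map_sub]
  change finPush f k c - finPush f k (finBoundary k b₁) ∈ _
  change finPush f k c - finBoundary k (finPush f (k + 1) b₁ + b₂ + finBoundary (k + 1) w) ∈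
    finSub R {(f '' K)ᶜ} k at hb
  rw [map_add, map_add, finBoundary_finBoundary, add_zero] at hb
  have h2 := Submodule.add_mem _ hb ((finTheory R X).d_mem _ _ hb₂)
  rw [← finBoundary_finPush]
  convert h2 using 1
  change _ = _ + finBoundary k b₂
  abel

/-- A finite chain as a locally finite chain. -/
def ofFin (k : ℕ) : FinChain R X k →ₗ[R] chains R X k where
  toFun c := ⟨c, fun _ => ⟨Set.univ, isOpen_univ, trivial,
    c.hasFiniteSupport.subset fun _ h => h.1⟩⟩
  map_add' _ _ := rfl
  map_smul' _ _ := rfl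

theorem boundary_ofFin {k : ℕ} (c : FinChain R X (k + 1)) :
    boundary R X k (ofFin (k + 1) c) = ofFin k (finBoundary k c) := by
  rw [boundary_eq_lfExtend]
  ext τ
  refine (carried_finBoundary k).apply_congr fun σ hσ => ?_
  exact truncate_apply_of_meets _ _ (by
    rw [Set.inter_eq_right.2 hσ]; exact Set.range_nonempty τ)

theorem ofFin_mem_subchains {U : Set X} {k : ℕ} {c : FinChain R X k} :
    ofFin k c ∈ subchains R X {U} k ↔ c ∈ finSub R {U} k := by
  rw [mem_subchains_singleton, finSub_singleton, Finsupp.mem_supported]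
  exact ⟨fun h σ hσ => h σ (Finsupp.mem_support_iff.1 hσ),
    fun h σ hσ => h (Finsupp.mem_support_iff.2 hσ)⟩

/-- Excision puts the essential part of `c` in the range of `f`; discarding simplices that miss the
compact set leaves a finite chain, which lifts to `Y`. This is the passage from finite to locally
finite homology. -/
theorem cyc_le_bnd_image (f : C(Y, X)) (hf : Topology.IsOpenEmbedding f) {K : Set Y}
    (hKc : IsCompact (f '' K)) (hK : IsClosed (f '' K)) {k : ℕ}
    (h : (finTheory R Y).cyc K k ≤ (finTheory R Y).bnd K k) :
    (lfTheory R X).cyc (f '' K) k ≤ (lfTheory R X).bnd (f '' K) k := by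
  intro (c : chains R X k) hc
  have hpre := preimage_compl_image f hf.injective K
  have hpush : ∀ {k : ℕ} {c : FinChain R Y k}, c ∈ finSub R {Kᶜ} k ↔
      ofFin k (finPush f k c) ∈ subchains R X {(f '' K)ᶜ} k := by
    intro k c
    rw [ofFin_mem_subchains, finPush_mem_finSub_iff f hf.injective, hpre]
  have hU := range_union_compl_image f K
  obtain ⟨g₁, hg₁, g₂, hg₂, w, -, hw⟩ := (lfTheory R X).excise hf.isOpen_range
    hK.isOpen_compl (g := c) (by
      rw [hU]; exact mem_subchains_singleton.2 fun σ _ => Set.subset_univ _)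
    (boundaryIn_mono (fun _ => le_sup_right) k hc)
  obtain ⟨t, ht⟩ := exists_finPush_eq f hf.isEmbedding (truncate_mem_finSub hKc hg₁)
  have hdiff : g₁ - ofFin k (finPush f k t) ∈ (lfTheory R X).S (f '' K)ᶜ k := by
    refine mem_subchains_singleton.2 fun σ hσ => ?_
    by_contra hcon
    have hm : (Set.range σ ∩ f '' K).Nonempty := by
      rwa [← Set.not_disjoint_iff_nonempty_inter, ← Set.subset_compl_iff_disjoint_right]
    refine hσ ?_
    change g₁.1 σ - finPush f k t σ = 0
    rw [ht, truncate_apply_of_meets hKc _ hm, sub_self]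
  have hcdiff : c - ofFin k (finPush f k t) ∈ (lfTheory R X).bnd (f '' K) k := by
    have : c - ofFin k (finPush f k t) =
        (g₁ - ofFin k (finPush f k t)) + g₂ + (lfTheory R X).d k w := by rw [hw]; abel
    rw [this]
    exact Submodule.add_mem _ (Submodule.add_mem _ (ChainTheory.S_le_bnd hdiff)
      (ChainTheory.S_le_bnd hg₂)) (ChainTheory.boundary_mem_bnd w)
  have htcyc : ofFin k (finPush f k t) ∈ (lfTheory R X).cyc (f '' K) k := by
    have := Submodule.sub_mem _ hc (ChainTheory.bnd_le_cyc hcdiff)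
    rwa [sub_sub_cancel] at this
  have htY : t ∈ (finTheory R Y).cyc K k := by
    cases k with
    | zero => trivial
    | succ k =>
      refine ChainTheory.mem_cyc_succ_iff.2 (hpush.2 ?_)
      have h2 := ChainTheory.mem_cyc_succ_iff.1 htcyc
      change boundary R X k _ ∈ subchains R X _ k at h2
      rw [boundary_ofFin, finBoundary_finPush] at h2
      exact h2
  obtain ⟨b, hb⟩ := ChainTheory.mem_bnd_iff.1 (h htY)
  have htb : ofFin k (finPush f k t) ∈ (lfTheory R X).bnd (f '' K) k := by
    refine ChainTheory.mem_bnd_iff.2 ⟨ofFin (k + 1) (finPush f (k + 1) b), ?_⟩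
    change _ - boundary R X k _ ∈ subchains R X _ k
    rw [boundary_ofFin, finBoundary_finPush, ← map_sub, ← map_sub]
    exact hpush.1 hb
  have := Submodule.add_mem _ hcdiff htb
  rwa [sub_add_cancel] at this

/-- Compact subsets of chart domains of an `n`-manifold have no relative homology in degrees
greater than `n`. -/
theorem cyc_le_bnd_of_subset_chart {n : ℕ} [T2Space X]
    (φ : OpenPartialHomeomorph X (EuclideanSpace ℝ (Fin n))) {K : Set X} (hK : IsCompact K)
    (hKφ : K ⊆ φ.source) {k : ℕ} (hk : n < k) :
    (lfTheory R X).cyc K k ≤ (lfTheory R X).bnd K k := by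
  let f : C(φ.source, X) := ⟨Subtype.val, continuous_subtype_val⟩
  have hf : Topology.IsOpenEmbedding f := φ.open_source.isOpenEmbedding_subtypeVal
  let e := (EuclideanSpace.equiv (Fin n) ℝ).toHomeomorph
  -- The chart domain embeds openly both in `X` and in `ℝⁿ`, so it mediates between the two
  -- vanishing statements.
  have hg' : Topology.IsOpenEmbedding (e ∘ Subtype.val ∘ φ.toHomeomorphSourceTarget) :=
    e.isOpenEmbedding.comp (φ.open_target.isOpenEmbedding_subtypeVal.comp
      φ.toHomeomorphSourceTarget.isOpenEmbedding)
  let g : C(φ.source, Fin n → ℝ) := ⟨_, hg'.continuous⟩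
  have himage : f '' (f ⁻¹' K) = K := by
    rw [Set.image_preimage_eq_iff]
    exact fun x hx => ⟨⟨x, hKφ hx⟩, rfl⟩
  have hc : IsCompact (f ⁻¹' K) := by
    rw [hf.isEmbedding.isCompact_iff, himage]
    exact hK
  rw [← himage]
  refine cyc_le_bnd_image f hf (by rwa [himage]) (by rw [himage]; exact hK.isClosed) ?_
  have hgc := hc.image g.continuous
  exact cyc_le_bnd_of_image g hg' hgc.isClosed (cyc_le_bnd_of_isCompact_pi hgc hk)

end Embedding

/-! ### Locally finite chains and supports -/

section Support

variable {R : Type*} [CommRing R] {X : Type*} [TopologicalSpace X]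

theorem lfTheory_bnd_empty (k : ℕ) : (lfTheory R X).bnd ∅ k = ⊤ := by
  refine top_le_iff.1 fun c _ => ChainTheory.S_le_bnd ?_
  rw [Set.compl_empty]
  exact mem_subchains_singleton.2 fun σ _ => Set.subset_univ _

/-- A locally finite union of compact images is closed, so its complement is the required
neighborhood. -/
theorem exists_isOpen_of_mem_subchains_compl [T2Space X] {A : Set X} {k : ℕ} {e : chains R X k}
    (he : e ∈ subchains R X {Aᶜ} k) :
    ∃ W : Set X, IsOpen W ∧ A ⊆ W ∧ e ∈ subchains R X {Wᶜ} k := by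
  rw [mem_subchains_singleton] at he
  refine ⟨(⋃ σ : {σ : Simplex k X // e.1 σ ≠ 0}, Set.range σ.1)ᶜ, ?_, ?_, ?_⟩
  · refine (LocallyFinite.isClosed_iUnion (fun x => ?_) fun σ : {σ : Simplex k X // e.1 σ ≠ 0} =>
      (isCompact_range_simplex σ.1).isClosed).isOpen_compl
    obtain ⟨U, hU, hxU, hfU⟩ := e.2 x
    refine ⟨U, hU.mem_nhds hxU, (hfU.preimage Subtype.val_injective.injOn).subset ?_⟩
    exact fun σ hσ => ⟨σ.2, hσ⟩
  · rw [Set.subset_compl_comm]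
    exact Set.iUnion_subset fun σ : {σ : Simplex k X // e.1 σ ≠ 0} => he σ.1 σ.2
  · rw [mem_subchains_singleton, compl_compl]
    exact fun σ hσ => Set.subset_iUnion (fun σ : {σ : Simplex k X // e.1 σ ≠ 0} => Set.range σ.1) ⟨σ, hσ⟩

theorem exists_isOpen_of_mem_bnd [T2Space X] {A : Set X} {k : ℕ} {c : chains R X k}
    (hc : c ∈ (lfTheory R X).bnd A k) :
    ∃ W : Set X, IsOpen W ∧ A ⊆ W ∧ c ∈ (lfTheory R X).bnd W k := by
  obtain ⟨b, hb⟩ := ChainTheory.mem_bnd_iff.1 hc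
  obtain ⟨W, hW, hAW, h⟩ := exists_isOpen_of_mem_subchains_compl hb
  exact ⟨W, hW, hAW, ChainTheory.mem_bnd_iff.2 ⟨b, h⟩⟩

end Support

/-! ### Discrete unions -/

section Discrete

theorem union_compl_eq_univ {X : Type*} {U B : Set X} (h : B ⊆ U) : U ∪ Bᶜ = Set.univ :=
  Set.eq_univ_of_forall fun x => by
    by_cases hx : x ∈ B
    · exact Or.inl (h hx)
    · exact Or.inr hx

variable {R : Type*} [CommRing R] {X : Type*} [TopologicalSpace X] {ι : Type*} {U B : ι → Set X}

/-- A simplex lies in at most one `U i`, so its coefficient can be taken from the corresponding `d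
i`. Near a point only finitely many `U i` matter, which gives local finiteness. -/
theorem exists_patch (hU : LocallyFinite U) (hdisj : Pairwise (Function.onFun Disjoint U)) {k : ℕ}
    (d : ι → chains R X k) (hd : ∀ i, d i ∈ subchains R X {U i} k) :
    ∃ D : chains R X k, ∀ i, D - d i ∈ subchains R X {(U i)ᶜ} k := by
  classical
  let D : Simplex k X → R := fun σ =>
    if h : ∃ i, Set.range σ ⊆ U i then (d h.choose).1 σ else 0
  have hD : IsLocallyFinite D := by
    intro x
    obtain ⟨V, hV, hfin⟩ := hU x
    choose W hW hxW hfW using fun i => (d i).2 x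
    -- Inside `V` only finitely many indices occur, so the intersection of the neighborhoods adapted
    -- to the corresponding `d i` is still open.
    refine ⟨interior V ∩ ⋂ i ∈ {i | (U i ∩ V).Nonempty}, W i,
      isOpen_interior.inter (hfin.isOpen_biInter fun i _ => hW i),
      ⟨mem_interior_iff_mem_nhds.2 hV, Set.mem_iInter₂.2 fun i _ => hxW i⟩,
      (hfin.biUnion fun i _ => hfW i).subset ?_⟩
    rintro σ ⟨h0, y, hyσ, hyV, hyW⟩
    by_cases h : ∃ i, Set.range σ ⊆ U i
    · have hD0 : D σ = (d h.choose).1 σ := dif_pos h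
      have hi : (U h.choose ∩ V).Nonempty := ⟨y, h.choose_spec hyσ, interior_subset hyV⟩
      exact Set.mem_biUnion hi ⟨by rwa [← hD0], y, hyσ, Set.mem_iInter₂.1 hyW _ hi⟩
    · exact absurd (dif_neg h) h0
  refine ⟨⟨D, hD⟩, fun i => mem_subchains_singleton.2 fun σ hσ => ?_⟩
  change D σ - (d i).1 σ ≠ 0 at hσ
  by_cases h : ∃ i, Set.range σ ⊆ U i
  · have hD0 : D σ = (d h.choose).1 σ := dif_pos h
    by_cases hi : h.choose = i
    · rw [hD0, hi, sub_self] at hσ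
      exact absurd rfl hσ
    · exact h.choose_spec.trans (hdisj hi).subset_compl_right
  · have hD0 : D σ = 0 := dif_neg h
    have hd0 : (d i).1 σ = 0 := by
      by_contra hne
      exact h ⟨i, mem_subchains_singleton.1 (hd i) σ hne⟩
    rw [hD0, hd0, sub_self] at hσ
    exact absurd rfl hσ

theorem mem_subchains_compl_iUnion {k : ℕ} {c : chains R X k}
    (h : ∀ i, c ∈ subchains R X {(B i)ᶜ} k) : c ∈ subchains R X {(⋃ i, B i)ᶜ} k := by
  refine mem_subchains_singleton.2 fun σ hσ => ?_
  rw [Set.compl_iUnion]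
  exact Set.subset_iInter fun i => mem_subchains_singleton.1 (h i) σ hσ

theorem mem_subchains_univ {k : ℕ} (c : chains R X k) : c ∈ subchains R X {Set.univ} k :=
  mem_subchains_singleton.2 fun _ _ => Set.subset_univ _

/-- After refinement every simplex lies in a single `U i` or misses all the `B i`. The bounding
chains can then be excised into the separate `U i` and patched. -/
theorem mem_bnd_iUnion (hU : LocallyFinite U) (hdisj : Pairwise (Function.onFun Disjoint U))
    (hUo : ∀ i, IsOpen (U i)) (hB : ∀ i, IsClosed (B i)) (hBU : ∀ i, B i ⊆ U i) {k : ℕ}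
    {c : chains R X k} (hc : c ∈ (lfTheory R X).cyc (⋃ i, B i) k)
    (h : ∀ i, c ∈ (lfTheory R X).bnd (B i) k) : c ∈ (lfTheory R X).bnd (⋃ i, B i) k := by
  have hBc : IsClosed (⋃ i, B i) := (hU.subset hBU).isClosed_iUnion hB
  set 𝒰 : Set (Set X) := insert (⋃ i, B i)ᶜ (Set.range U) with h𝒰
  have hcover : ⋃₀ 𝒰 = Set.univ := by
    rw [h𝒰, Set.sUnion_insert, Set.sUnion_range, Set.union_comm]
    exact union_compl_eq_univ (Set.iUnion_mono hBU)
  obtain ⟨c', hc', w, -, rfl⟩ := exists_refine (𝒰 := 𝒰)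
    (by
      rintro _ (rfl | ⟨i, rfl⟩)
      · exact hBc.isOpen_compl
      · exact hUo i)
    (by rw [hcover]; exact mem_subchains_univ c)
    (boundaryIn_mono (P := subchains R X {(⋃ i, B i)ᶜ}) (Q := subchains R X 𝒰) (fun k c hc σ hσ =>
      ⟨_, Set.mem_insert _ _, mem_subchains_singleton.1 hc σ hσ⟩) k hc)
  refine Submodule.add_mem _ ?_ (ChainTheory.boundary_mem_bnd (T := lfTheory R X) w)
  -- A simplex in another `U j` is disjoint from `U i`, so it avoids `B i`.
  have hsmall : ∀ i, c' ∈ subchains R X {U i} k ⊔ subchains R X {(B i)ᶜ} k := fun i => by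
    refine subchains_pair_le _ _ k fun σ hσ => ?_
    obtain ⟨_, rfl | ⟨j, rfl⟩, h'⟩ := hc' σ hσ
    · exact ⟨(B i)ᶜ, by simp, h'.trans (Set.compl_subset_compl.2 (Set.subset_iUnion B i))⟩
    · by_cases hij : i = j
      · exact ⟨U i, by simp, hij ▸ h'⟩
      · exact ⟨(B i)ᶜ, by simp, h'.trans ((hdisj hij).subset_compl_left.trans
          (Set.compl_subset_compl.2 (hBU i)))⟩
  have hloc : ∀ i, ∃ d ∈ subchains R X {U i} (k + 1),
      c' - boundary R X k d ∈ subchains R X {(B i)ᶜ} k := fun i => by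
    have hci : c' ∈ (lfTheory R X).bnd (B i) k := by
      have := Submodule.sub_mem _ (h i) (ChainTheory.boundary_mem_bnd (T := lfTheory R X) w)
      rwa [add_sub_cancel_right] at this
    obtain ⟨b, hb⟩ := ChainTheory.mem_bnd_iff.1 hci
    obtain ⟨b₁, hb₁, b₂, hb₂, v, -, rfl⟩ := (lfTheory R X).excise (hUo i) (hB i).isOpen_compl
      (g := b) (by rw [union_compl_eq_univ (hBU i)]; exact mem_subchains_univ b) (by
        change boundary R X k b ∈ subchains R X {U i} k ⊔ subchains R X {(B i)ᶜ} k
        have : boundary R X k b = c' - (c' - boundary R X k b) := (sub_sub_cancel _ _).symm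
        rw [this]
        exact Submodule.sub_mem _ (hsmall i) (Submodule.mem_sup_right hb))
    refine ⟨b₁, hb₁, ?_⟩
    have h2 := Submodule.add_mem _ hb ((lfTheory R X).d_mem _ _ hb₂)
    rw [map_add, map_add, (lfTheory R X).d_d, add_zero] at h2
    convert h2 using 1
    abel
  choose d hd hd' using hloc
  obtain ⟨D, hD⟩ := exists_patch hU hdisj d hd
  refine ChainTheory.mem_bnd_iff.2 ⟨D, mem_subchains_compl_iUnion fun i => ?_⟩
  have h3 := (lfTheory R X).d_mem _ _
    (subchains_mono R (Set.compl_subset_compl.2 (hBU i)) (k + 1) (hD i))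
  have h4 := Submodule.sub_mem _ (hd' i) h3
  convert h4 using 1
  rw [map_sub]
  abel

/-- Each cycle may be replaced, within its class, by a chain inside `U i`. The patched chain agrees
with that one off `(U i)ᶜ`, hence represents the same class over `B i`. -/
theorem exists_cyc_iUnion (hU : LocallyFinite U) (hdisj : Pairwise (Function.onFun Disjoint U))
    (hUo : ∀ i, IsOpen (U i)) (hB : ∀ i, IsClosed (B i)) (hBU : ∀ i, B i ⊆ U i) {k : ℕ}
    {c : ι → chains R X k} (hc : ∀ i, c i ∈ (lfTheory R X).cyc (B i) k) :
    ∃ c' ∈ (lfTheory R X).cyc (⋃ i, B i) k, ∀ i, c' - c i ∈ (lfTheory R X).bnd (B i) k := by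
  have hloc : ∀ i, ∃ d ∈ subchains R X {U i} k, d - c i ∈ (lfTheory R X).bnd (B i) k := fun i => by
    obtain ⟨b₁, hb₁, b₂, hb₂, v, -, hv⟩ := (lfTheory R X).excise (hUo i) (hB i).isOpen_compl
      (g := c i) (by rw [union_compl_eq_univ (hBU i)]; exact mem_subchains_univ _)
      (boundaryIn_mono (fun _ => le_sup_right) k (hc i))
    refine ⟨b₁, hb₁, ?_⟩
    have : b₁ - c i = -(b₂ + (lfTheory R X).d k v) := by rw [hv]; abel
    rw [this]
    exact Submodule.neg_mem _ (Submodule.add_mem _ (ChainTheory.S_le_bnd hb₂)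
      (ChainTheory.boundary_mem_bnd v))
  choose d hd hd' using hloc
  obtain ⟨D, hD⟩ := exists_patch hU hdisj d hd
  have hDc : ∀ i, D - c i ∈ (lfTheory R X).bnd (B i) k := fun i => by
    have := Submodule.add_mem _ (ChainTheory.S_le_bnd (T := lfTheory R X)
      (subchains_mono R (Set.compl_subset_compl.2 (hBU i)) k (hD i))) (hd' i)
    rwa [sub_add_sub_cancel] at this
  refine ⟨D, ?_, hDc⟩
  have hDcyc : ∀ i, D ∈ (lfTheory R X).cyc (B i) k := fun i => by
    have := Submodule.add_mem _ (ChainTheory.bnd_le_cyc (hDc i)) (hc i)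
    rwa [sub_add_cancel] at this
  cases k with
  | zero => trivial
  | succ k => exact mem_subchains_compl_iUnion hDcyc

end Discrete

/-- A union of compact sets with pairwise disjoint open neighborhoods that form a locally finite
family. -/
def IsDiscreteUnion {X : Type*} [TopologicalSpace X] (E : Set X) : Prop :=
  ∃ K U : ℕ → Set X, (∀ i, IsCompact (K i)) ∧ (∀ i, IsOpen (U i)) ∧ (∀ i, K i ⊆ U i) ∧
    Pairwise (Function.onFun Disjoint U) ∧ LocallyFinite U ∧ E = ⋃ i, K i

section DiscreteUnion

variable {X : Type*} [TopologicalSpace X]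

theorem IsDiscreteUnion.isClosed [T2Space X] {E : Set X} (hE : IsDiscreteUnion E) : IsClosed E := by
  obtain ⟨K, U, hK, -, hKU, -, hU, rfl⟩ := hE
  exact (hU.subset hKU).isClosed_iUnion fun i => (hK i).isClosed

theorem IsDiscreteUnion.decompose {A E : Set X} (hE : IsDiscreteUnion E) (hA : IsClosed A) (hAE : A ⊆ E) :
    ∃ K U : ℕ → Set X, (∀ i, IsCompact (K i)) ∧ (∀ i, IsOpen (U i)) ∧ (∀ i, K i ⊆ U i) ∧
    Pairwise (Function.onFun Disjoint U) ∧ LocallyFinite U ∧ A = ⋃ i, K i := by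
  obtain ⟨K, U, hK, hU, hKU, hdisj, hlf, rfl⟩ := hE
  refine ⟨fun i => A ∩ K i, U, fun i => (hK i).inter_left hA, hU,
    fun i => Set.inter_subset_right.trans (hKU i), hdisj, hlf, ?_⟩
  rw [← Set.inter_iUnion, Set.inter_eq_left.2 hAE]

/-- A second countable locally compact Hausdorff space is the union of two discrete unions of
compact sets. -/
theorem exists_isDiscreteUnion (X : Type*) [TopologicalSpace X] [T2Space X]
    [WeaklyLocallyCompactSpace X] [SigmaCompactSpace X] :
    ∃ E F : Set X, IsDiscreteUnion E ∧ IsDiscreteUnion F ∧ E ∪ F = Set.univ := by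
  let K := (CompactExhaustion.choice X).shiftr
  have hK0 : K 0 = ∅ := rfl
  let Q : ℕ → Set X := fun i => K (3 * i + 3) \ interior (K (3 * i))
  -- Thickened shells overlap only when their indices differ by at most one, so even and odd indices
  -- give the two discrete unions. For `i = 0` the truncated subtraction gives `K 0 = ∅`, the reason
  -- for shifting the exhaustion.
  let U : ℕ → Set X := fun i => interior (K (3 * i + 4)) \ K (3 * i - 1)
  have hQ : ∀ i, IsCompact (Q i) := fun i => (K.isCompact _).diff isOpen_interior
  have hU : ∀ i, IsOpen (U i) := fun i => isOpen_interior.sdiff (K.isCompact _).isClosed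
  have hQU : ∀ i, Q i ⊆ U i := by
    rintro i x ⟨hx, hx'⟩
    refine ⟨K.subset_interior_succ _ hx, fun h => ?_⟩
    rcases Nat.eq_zero_or_pos i with rfl | hi
    · rw [Nat.mul_zero, Nat.zero_sub, hK0] at h
      exact h
    · exact hx' (K.subset_interior (by lia) h)
  have hdisj : ∀ i j, i + 2 ≤ j → Disjoint (U i) (U j) := fun i j hij => by
    rw [Set.disjoint_left]
    rintro x ⟨hx, -⟩ ⟨-, hx'⟩
    exact hx' (K.subset (by lia) (interior_subset hx))
  have hlf : LocallyFinite U := fun x => by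
    refine ⟨interior (K (K.find x + 1)),
      isOpen_interior.mem_nhds (K.subset_interior_succ _ (K.mem_find x)),
      (Set.finite_le_nat (K.find x + 1)).subset ?_⟩
    rintro i ⟨y, ⟨-, hy⟩, hy'⟩
    by_contra hi
    rw [Set.mem_ofPred_eq, not_le] at hi
    exact hy (K.subset (by lia) (interior_subset hy'))
  have hcover : ∀ x, ∃ i, x ∈ Q i := fun x => by
    have hpos : 0 < K.find x := by
      rw [Nat.pos_iff_ne_zero]
      intro h
      have := K.mem_find x
      rw [h, hK0] at this
      exact this
    -- The first stage containing `x` is at least `1`, and it lies between `3 * i + 1` and `3 * i +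
    -- 3` for this index.
    refine ⟨(K.find x - 1) / 3, K.subset (by lia) (K.mem_find x), fun h => ?_⟩
    have := K.mem_iff_find_le.1 (interior_subset h)
    lia
  have key : ∀ e : ℕ → ℕ, (∀ i j, i < j → e i + 2 ≤ e j) → IsDiscreteUnion (⋃ i, Q (e i)) :=
    fun e he => by
      have hinj : Function.Injective e := by
        intro i j hij
        rcases lt_trichotomy i j with h | h | h
        · have := he _ _ h; lia
        · exact h
        · have := he _ _ h; lia
      refine ⟨fun i => Q (e i), fun i => U (e i), fun i => hQ _, fun i => hU _, fun i => hQU _,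
        fun i j hij => ?_, hlf.comp_injective hinj, rfl⟩
      rcases lt_or_gt_of_ne hij with h | h
      · exact hdisj _ _ (he _ _ h)
      · exact (hdisj _ _ (he _ _ h)).symm
  refine ⟨_, _, key (fun i => 2 * i) (fun i j h => by lia),
    key (fun i => 2 * i + 1) (fun i j h => by lia), Set.eq_univ_of_forall fun x => ?_⟩
  obtain ⟨i, hi⟩ := hcover x
  rcases Nat.even_or_odd' i with ⟨j, rfl | rfl⟩
  · exact Or.inl (Set.mem_iUnion.2 ⟨j, hi⟩)
  · exact Or.inr (Set.mem_iUnion.2 ⟨j, hi⟩)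

end DiscreteUnion

/-! ### Manifolds -/

section Manifold

theorem exists_isDiscreteUnion_of_manifold (n : ℕ) (X : Type*) [TopologicalSpace X] [T2Space X]
    [SecondCountableTopology X] [ChartedSpace (EuclideanSpace ℝ (Fin n)) X] :
    ∃ E F : Set X, IsDiscreteUnion E ∧ IsDiscreteUnion F ∧ E ∪ F = Set.univ := by
  have := ChartedSpace.locallyCompactSpace (EuclideanSpace ℝ (Fin n)) X
  exact exists_isDiscreteUnion X

theorem eq_inter_union_inter {X : Type*} {E F : Set X} (h : E ∪ F = Set.univ) (A : Set X) :
    A = (A ∩ E) ∪ (A ∩ F) := by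
  rw [← Set.inter_union_distrib_left, h, Set.inter_univ]

variable {R : Type*} [CommRing R] {n : ℕ} {X : Type*} [TopologicalSpace X] [T2Space X]
  [ChartedSpace (EuclideanSpace ℝ (Fin n)) X]

theorem exists_isCompact_nhds_subset (n : ℕ) {X : Type*} [TopologicalSpace X]
    [ChartedSpace (EuclideanSpace ℝ (Fin n)) X] {x : X} {W : Set X} (hW : W ∈ 𝓝 x) :
    ∃ K ∈ 𝓝 x, IsCompact K ∧ K ⊆ W := by
  have := ChartedSpace.locallyCompactSpace (EuclideanSpace ℝ (Fin n)) X
  obtain ⟨K, ⟨hK, hKc⟩, hKW⟩ := (compact_basis_nhds x).mem_iff.1 hW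
  exact ⟨K, hK, hKc, hKW⟩

theorem cyc_le_bnd_of_isCompact {K : Set X} (hK : IsCompact K) {k : ℕ} (hk : n < k) :
    (lfTheory R X).cyc K k ≤ (lfTheory R X).bnd K k := by
  obtain ⟨t, -, hKt, ht⟩ : ∃ t : Set X, IsCompact t ∧ K ⊆ t ∧ ∀ L ⊆ t, IsClosed L →
      ∀ k, n < k → (lfTheory R X).cyc L k ≤ (lfTheory R X).bnd L k := by
    -- The property is made hereditary for closed subsets and uniform in the degree, because
    -- Mayer-Vietoris also needs vanishing on the intersection, one degree up.
    refine hK.induction_on (p := fun s => ∃ t : Set X, IsCompact t ∧ s ⊆ t ∧ ∀ L ⊆ t, IsClosed L →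
      ∀ k, n < k → (lfTheory R X).cyc L k ≤ (lfTheory R X).bnd L k) ?_ ?_ ?_ ?_
    · refine ⟨∅, isCompact_empty, le_rfl, fun L hL _ k _ => ?_⟩
      rw [Set.subset_empty_iff.1 hL, lfTheory_bnd_empty]
      exact le_top
    · rintro s s' hs ⟨t, ht, hst, h⟩
      exact ⟨t, ht, hs.trans hst, h⟩
    · rintro s₁ s₂ ⟨t₁, ht₁, hst₁, h₁⟩ ⟨t₂, ht₂, hst₂, h₂⟩
      refine ⟨t₁ ∪ t₂, ht₁.union ht₂, Set.union_subset_union hst₁ hst₂, fun L hL hLc k hk => ?_⟩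
      have hLu : L = (L ∩ t₁) ∪ (L ∩ t₂) := by
        rw [← Set.inter_union_distrib_left, Set.inter_eq_left.2 hL]
      have c₁ := hLc.inter ht₁.isClosed
      have c₂ := hLc.inter ht₂.isClosed
      rw [hLu]
      refine ChainTheory.cyc_le_bnd_union c₁ c₂ (h₁ _ Set.inter_subset_right c₁ k hk)
        (h₂ _ Set.inter_subset_right c₂ k hk)
        (h₁ _ (Set.inter_subset_left.trans Set.inter_subset_right) (c₁.inter c₂) _
          (Nat.lt_succ_of_lt hk))
    · intro x _
      obtain ⟨t, htx, ht, hts⟩ := exists_isCompact_nhds_subset n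
        (chart_source_mem_nhds (EuclideanSpace ℝ (Fin n)) x)
      exact ⟨t, mem_nhdsWithin_of_mem_nhds htx, t, ht, le_rfl, fun L hL hLc k hk =>
        cyc_le_bnd_of_subset_chart _ (ht.of_isClosed_subset hLc hL) (hL.trans hts) hk⟩
  exact ht K hKt hK.isClosed k hk

/-- Vanishing at a point spreads to a neighborhood, and the obstruction to combining two pieces lies
in degree `n + 1` of their intersection, which is zero. -/
theorem mem_bnd_of_isCompact {K : Set X} (hK : IsCompact K) {c : chains R X n}
    (hc : ∀ x ∈ K, c ∈ (lfTheory R X).bnd {x} n) : c ∈ (lfTheory R X).bnd K n := by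
  obtain ⟨t, -, hKt, ht⟩ : ∃ t : Set X, IsCompact t ∧ K ⊆ t ∧ c ∈ (lfTheory R X).bnd t n := by
    refine hK.induction_on (p := fun s => ∃ t : Set X, IsCompact t ∧ s ⊆ t ∧
      c ∈ (lfTheory R X).bnd t n) ?_ ?_ ?_ ?_
    · refine ⟨∅, isCompact_empty, le_rfl, ?_⟩
      rw [lfTheory_bnd_empty]
      trivial
    · rintro s s' hs ⟨t, ht, hst, h⟩
      exact ⟨t, ht, hs.trans hst, h⟩
    · rintro s₁ s₂ ⟨t₁, ht₁, hst₁, h₁⟩ ⟨t₂, ht₂, hst₂, h₂⟩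
      exact ⟨t₁ ∪ t₂, ht₁.union ht₂, Set.union_subset_union hst₁ hst₂,
        ChainTheory.mem_bnd_union ht₁.isClosed ht₂.isClosed
          (cyc_le_bnd_of_isCompact (ht₁.inter ht₂) (Nat.lt_succ_self n)) h₁ h₂⟩
    · intro x hx
      obtain ⟨W, hW, hxW, hcW⟩ := exists_isOpen_of_mem_bnd (hc x hx)
      obtain ⟨t, htx, ht, hts⟩ := exists_isCompact_nhds_subset n
        (hW.mem_nhds (Set.singleton_subset_iff.1 hxW))
      exact ⟨t, mem_nhdsWithin_of_mem_nhds htx, t, ht, le_rfl, ChainTheory.bnd_mono hts hcW⟩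
  exact ChainTheory.bnd_mono hKt ht

variable (n) in
/-- A family of local chains that is locally represented by a relative cycle. -/
def IsLocallyConsistent (z : X → chains R X n) : Prop :=
  ∀ x : X, ∃ U ∈ 𝓝 x, ∃ c ∈ (lfTheory R X).cyc U n, ∀ y ∈ U, c - z y ∈ (lfTheory R X).bnd {y} n

/-- On an overlap two local solutions agree at every point, hence agree as classes by detection at
points. This is the hypothesis for gluing. -/
theorem exists_cyc_of_isCompact {z : X → chains R X n} (hz : IsLocallyConsistent n z)
    {K : Set X} (hK : IsCompact K) :
    ∃ c ∈ (lfTheory R X).cyc K n, ∀ y ∈ K, c - z y ∈ (lfTheory R X).bnd {y} n := by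
  obtain ⟨t, -, hKt, c, hct, hc⟩ : ∃ t : Set X, IsCompact t ∧ K ⊆ t ∧
      ∃ c ∈ (lfTheory R X).cyc t n, ∀ y ∈ t, c - z y ∈ (lfTheory R X).bnd {y} n := by
    refine hK.induction_on (p := fun s => ∃ t : Set X, IsCompact t ∧ s ⊆ t ∧
      ∃ c ∈ (lfTheory R X).cyc t n, ∀ y ∈ t, c - z y ∈ (lfTheory R X).bnd {y} n) ?_ ?_ ?_ ?_
    · exact ⟨∅, isCompact_empty, le_rfl, 0, Submodule.zero_mem _, fun y hy => hy.elim⟩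
    · rintro s s' hs ⟨t, ht, hst, h⟩
      exact ⟨t, ht, hs.trans hst, h⟩
    · rintro s₁ s₂ ⟨t₁, ht₁, hst₁, c₁, hc₁, h₁⟩ ⟨t₂, ht₂, hst₂, c₂, hc₂, h₂⟩
      obtain ⟨c, hc, hcc₁, hcc₂⟩ := ChainTheory.exists_glue ht₁.isClosed ht₂.isClosed hc₁ hc₂
        (mem_bnd_of_isCompact (ht₁.inter ht₂) fun x hx => by
          have := Submodule.sub_mem _ (h₁ x hx.1) (h₂ x hx.2)
          rwa [sub_sub_sub_cancel_right] at this)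
      refine ⟨t₁ ∪ t₂, ht₁.union ht₂, Set.union_subset_union hst₁ hst₂, c, hc, fun y hy => ?_⟩
      rcases hy with hy | hy
      · have := Submodule.add_mem _ (ChainTheory.bnd_mono (Set.singleton_subset_iff.2 hy) hcc₁)
          (h₁ y hy)
        rwa [sub_add_sub_cancel] at this
      · have := Submodule.add_mem _ (ChainTheory.bnd_mono (Set.singleton_subset_iff.2 hy) hcc₂)
          (h₂ y hy)
        rwa [sub_add_sub_cancel] at this
    · intro x _
      obtain ⟨U, hU, c, hc, h⟩ := hz x
      obtain ⟨t, htx, ht, hts⟩ := exists_isCompact_nhds_subset n hU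
      exact ⟨t, mem_nhdsWithin_of_mem_nhds htx, t, ht, le_rfl, c, ChainTheory.cyc_mono hts hc,
        fun y hy => h y (hts hy)⟩
  exact ⟨c, ChainTheory.cyc_mono hKt hct, fun y hy => hc y (hKt hy)⟩

/-! ### From compact to closed subsets -/

section Closed

variable {A E : Set X}

theorem IsDiscreteUnion.cyc_le_bnd (hE : IsDiscreteUnion E) (hA : IsClosed A) (hAE : A ⊆ E)
    {k : ℕ} (hk : n < k) : (lfTheory R X).cyc A k ≤ (lfTheory R X).bnd A k := by
  obtain ⟨K, U, hK, hU, hKU, hdisj, hlf, rfl⟩ := hE.decompose hA hAE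
  exact fun c hc => mem_bnd_iUnion hlf hdisj hU (fun i => (hK i).isClosed) hKU hc fun i =>
    cyc_le_bnd_of_isCompact (hK i) hk (ChainTheory.cyc_mono (Set.subset_iUnion K i) hc)

theorem IsDiscreteUnion.mem_bnd (hE : IsDiscreteUnion E) (hA : IsClosed A) (hAE : A ⊆ E)
    {c : chains R X n} (hcyc : c ∈ (lfTheory R X).cyc A n)
    (hc : ∀ x ∈ A, c ∈ (lfTheory R X).bnd {x} n) : c ∈ (lfTheory R X).bnd A n := by
  obtain ⟨K, U, hK, hU, hKU, hdisj, hlf, rfl⟩ := hE.decompose hA hAE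
  exact mem_bnd_iUnion hlf hdisj hU (fun i => (hK i).isClosed) hKU hcyc fun i =>
    mem_bnd_of_isCompact (hK i) fun x hx => hc x (Set.mem_iUnion.2 ⟨i, hx⟩)

theorem IsDiscreteUnion.exists_cyc (hE : IsDiscreteUnion E) (hA : IsClosed A) (hAE : A ⊆ E)
    {z : X → chains R X n} (hz : IsLocallyConsistent n z) :
    ∃ c ∈ (lfTheory R X).cyc A n, ∀ y ∈ A, c - z y ∈ (lfTheory R X).bnd {y} n := by
  obtain ⟨K, U, hK, hU, hKU, hdisj, hlf, rfl⟩ := hE.decompose hA hAE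
  choose c hc hcz using fun i => exists_cyc_of_isCompact hz (hK i)
  obtain ⟨c', hc', h⟩ := exists_cyc_iUnion hlf hdisj hU (fun i => (hK i).isClosed) hKU hc
  refine ⟨c', hc', fun y hy => ?_⟩
  obtain ⟨i, hi⟩ := Set.mem_iUnion.1 hy
  have := Submodule.add_mem _ (ChainTheory.bnd_mono (Set.singleton_subset_iff.2 hi) (h i))
    (hcz i y hi)
  rwa [sub_add_sub_cancel] at this

variable [SecondCountableTopology X]

/-- Vanishing above the dimension. -/
theorem cyc_le_bnd_of_isClosed (hA : IsClosed A) {k : ℕ} (hk : n < k) :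
    (lfTheory R X).cyc A k ≤ (lfTheory R X).bnd A k := by
  obtain ⟨E, F, hE, hF, hEF⟩ := exists_isDiscreteUnion_of_manifold n X
  -- The pieces `A ∩ E` and `A ∩ F` and their intersection are closed subsets of discrete unions, so
  -- the previous results cover all the inputs to Mayer-Vietoris.
  have c₁ := hA.inter hE.isClosed
  have c₂ := hA.inter hF.isClosed
  rw [eq_inter_union_inter hEF A]
  exact ChainTheory.cyc_le_bnd_union c₁ c₂ (hE.cyc_le_bnd c₁ Set.inter_subset_right hk)
    (hF.cyc_le_bnd c₂ Set.inter_subset_right hk)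
    (hE.cyc_le_bnd (c₁.inter c₂) (Set.inter_subset_left.trans Set.inter_subset_right)
      (Nat.lt_succ_of_lt hk))

/-- A relative class in the top degree is detected at points. -/
theorem mem_bnd_of_isClosed (hA : IsClosed A) {c : chains R X n}
    (hcyc : c ∈ (lfTheory R X).cyc A n)
    (hc : ∀ x ∈ A, c ∈ (lfTheory R X).bnd {x} n) : c ∈ (lfTheory R X).bnd A n := by
  obtain ⟨E, F, hE, hF, hEF⟩ := exists_isDiscreteUnion_of_manifold n X
  have c₁ := hA.inter hE.isClosed
  have c₂ := hA.inter hF.isClosed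
  rw [eq_inter_union_inter hEF A]
  exact ChainTheory.mem_bnd_union c₁ c₂
    (hE.cyc_le_bnd (c₁.inter c₂) (Set.inter_subset_left.trans Set.inter_subset_right)
      (Nat.lt_succ_self n))
    (hE.mem_bnd c₁ Set.inter_subset_right (ChainTheory.cyc_mono Set.inter_subset_left hcyc)
      fun x hx => hc x hx.1)
    (hF.mem_bnd c₂ Set.inter_subset_right (ChainTheory.cyc_mono Set.inter_subset_left hcyc)
      fun x hx => hc x hx.1)

/-- A locally consistent family of local classes comes from a relative class. -/
theorem exists_cyc_of_isClosed (hA : IsClosed A) {z : X → chains R X n}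
    (hz : IsLocallyConsistent n z) :
    ∃ c ∈ (lfTheory R X).cyc A n, ∀ y ∈ A, c - z y ∈ (lfTheory R X).bnd {y} n := by
  obtain ⟨E, F, hE, hF, hEF⟩ := exists_isDiscreteUnion_of_manifold n X
  have d₁ := hA.inter hE.isClosed
  have d₂ := hA.inter hF.isClosed
  obtain ⟨c₁, hc₁, h₁⟩ := hE.exists_cyc d₁ Set.inter_subset_right hz
  obtain ⟨c₂, hc₂, h₂⟩ := hF.exists_cyc d₂ Set.inter_subset_right hz
  have hcyc : c₁ - c₂ ∈ (lfTheory R X).cyc (A ∩ E ∩ (A ∩ F)) n :=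
    Submodule.sub_mem _ (ChainTheory.cyc_mono Set.inter_subset_left hc₁)
      (ChainTheory.cyc_mono Set.inter_subset_right hc₂)
  obtain ⟨c, hc, hcc₁, hcc₂⟩ := ChainTheory.exists_glue d₁ d₂ hc₁ hc₂
    (hE.mem_bnd (d₁.inter d₂) (Set.inter_subset_left.trans Set.inter_subset_right) hcyc
      fun x hx => by
        have := Submodule.sub_mem _ (h₁ x hx.1) (h₂ x hx.2)
        rwa [sub_sub_sub_cancel_right] at this)
  rw [← eq_inter_union_inter hEF A] at hc
  refine ⟨c, hc, fun y hy => ?_⟩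
  rw [eq_inter_union_inter hEF A] at hy
  rcases hy with hy | hy
  · have := Submodule.add_mem _ (ChainTheory.bnd_mono (Set.singleton_subset_iff.2 hy) hcc₁)
      (h₁ y hy)
    rwa [sub_add_sub_cancel] at this
  · have := Submodule.add_mem _ (ChainTheory.bnd_mono (Set.singleton_subset_iff.2 hy) hcc₂)
      (h₂ y hy)
    rwa [sub_add_sub_cancel] at this

end Closed

end Manifold

/-! ### Homology classes and representing chains -/

section ModuleComplex

universe u v

variable {R : Type u} [CommRing R] (K : ChainComplex (ModuleCat.{v} R) ℕ)

theorem exists_iCycles_eq {k : ℕ} (y : K.X k) (hy : ∀ j, K.d k j y = 0) :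
    ∃ z : K.cycles k, K.iCycles k z = y :=
  ⟨(K.sc k).moduleCatCyclesIso.inv ⟨y, hy _⟩,
    ConcreteCategory.congr_hom (K.sc k).moduleCatCyclesIso_inv_iCycles ⟨y, hy _⟩⟩

theorem d_iCycles {k : ℕ} (z : K.cycles k) (j : ℕ) : K.d k j (K.iCycles k z) = 0 :=
  ConcreteCategory.congr_hom (K.iCycles_d k j) z

theorem shortComplex_homologyπ_eq_zero_iff (S : ShortComplex (ModuleCat.{v} R)) (z : S.cycles) :
    S.homologyπ z = 0 ↔ ∃ x : S.X₁, S.f x = S.iCycles z := by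
  have h1 : S.moduleCatHomologyIso.hom (S.homologyπ z) =
      (LinearMap.range S.moduleCatToCycles).mkQ (S.moduleCatCyclesIso.hom z) :=
    ConcreteCategory.congr_hom S.π_moduleCatCyclesIso_hom z
  have h2 : (LinearMap.ker S.g.hom).subtype (S.moduleCatCyclesIso.hom z) = S.iCycles z :=
    ConcreteCategory.congr_hom S.moduleCatCyclesIso_hom_i z
  have hinj : Function.Injective S.moduleCatHomologyIso.hom :=
    (ModuleCat.mono_iff_injective _).1 inferInstance
  rw [← hinj.eq_iff, map_zero, h1, ← h2]
  refine (Submodule.Quotient.mk_eq_zero _).trans ⟨?_, ?_⟩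
  · rintro ⟨x, hx⟩
    exact ⟨x, congrArg Subtype.val hx⟩
  · rintro ⟨x, hx⟩
    exact ⟨x, Subtype.ext hx⟩

theorem homologyπ_eq_zero_iff {k : ℕ} (z : K.cycles k) :
    K.homologyπ k z = 0 ↔ ∃ x : K.X (k + 1), K.d (k + 1) k x = K.iCycles k z := by
  have hprev : (ComplexShape.down ℕ).prev k = k + 1 := ChainComplex.prev ℕ k
  rw [← hprev]
  exact shortComplex_homologyπ_eq_zero_iff (K.sc k) z

theorem homologyπ_surjective {k : ℕ} : Function.Surjective (K.homologyπ k) :=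
  (ModuleCat.epi_iff_surjective _).1 inferInstance

end ModuleComplex

section Represents

variable {R : Type*} [CommRing R] {X : Type*} [TopologicalSpace X] {A B : Set X} {k : ℕ}

/-- The relative chain `c` is a cycle representing the class `μ`. -/
def Represents (c : chains R X k) (μ : relHomology R X {Aᶜ} k) : Prop :=
  ∃ z : (relComplex R X {Aᶜ}).cycles k, (relComplex R X {Aᶜ}).iCycles k z =
    (Submodule.Quotient.mk c : chains R X k ⧸ subchains R X {Aᶜ} k) ∧
    (relComplex R X {Aᶜ}).homologyπ k z = μ

theorem relComplex_d_mk (c : chains R X (k + 1)) :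
    (relComplex R X {Aᶜ}).d (k + 1) k
      (Submodule.Quotient.mk c : chains R X (k + 1) ⧸ subchains R X {Aᶜ} (k + 1)) =
    (Submodule.Quotient.mk (boundary R X k c) : chains R X k ⧸ subchains R X {Aᶜ} k) := by
  rw [relComplex_d]
  rfl

/-- All differentials except the one to the preceding degree vanish by shape. In degree `0` none
remains, matching the convention that every `0`-chain lies in `cyc`. -/
theorem relComplex_d_mk_eq_zero_iff (c : chains R X k) :
    (∀ j, (relComplex R X {Aᶜ}).d k j
      (Submodule.Quotient.mk c : chains R X k ⧸ subchains R X {Aᶜ} k) = 0) ↔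
    c ∈ (lfTheory R X).cyc A k := by
  have hshape : ∀ j, j + 1 ≠ k → (relComplex R X {Aᶜ}).d k j
      (Submodule.Quotient.mk c : chains R X k ⧸ subchains R X {Aᶜ} k) = 0 := fun j hj => by
    rw [(relComplex R X {Aᶜ}).shape k j hj]
    rfl
  cases k with
  | zero => exact ⟨fun _ => trivial, fun _ j => hshape j (Nat.succ_ne_zero j)⟩
  | succ k =>
    have h0 : (relComplex R X {Aᶜ}).d (k + 1) k
        (Submodule.Quotient.mk c : chains R X (k + 1) ⧸ subchains R X {Aᶜ} (k + 1)) = 0 ↔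
        c ∈ (lfTheory R X).cyc A (k + 1) := by
      rw [relComplex_d_mk]
      exact Submodule.Quotient.mk_eq_zero _
    refine ⟨fun h => h0.1 (h k), fun h j => ?_⟩
    by_cases hj : j + 1 = k + 1
    · obtain rfl : j = k := Nat.succ_injective hj
      exact h0.2 h
    · exact hshape j hj

theorem Represents.mem_cyc {c : chains R X k} {μ : relHomology R X {Aᶜ} k}
    (h : Represents c μ) : c ∈ (lfTheory R X).cyc A k := by
  obtain ⟨z, hz, -⟩ := h
  rw [← relComplex_d_mk_eq_zero_iff, ← hz]
  exact d_iCycles _ z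

theorem exists_represents (μ : relHomology R X {Aᶜ} k) :
    ∃ c : chains R X k, Represents c μ := by
  obtain ⟨z, rfl⟩ := homologyπ_surjective _ μ
  obtain ⟨c, hc⟩ := Submodule.Quotient.mk_surjective (subchains R X {Aᶜ} k)
    ((relComplex R X {Aᶜ}).iCycles k z)
  exact ⟨c, z, hc.symm, rfl⟩

theorem exists_represents_of_mem_cyc {c : chains R X k} (hc : c ∈ (lfTheory R X).cyc A k) :
    ∃ μ : relHomology R X {Aᶜ} k, Represents c μ := by
  obtain ⟨z, hz⟩ := exists_iCycles_eq _ _ (relComplex_d_mk_eq_zero_iff c |>.2 hc)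
  exact ⟨_, z, hz, rfl⟩

theorem Represents.sub {c c' : chains R X k} {μ μ' : relHomology R X {Aᶜ} k}
    (h : Represents c μ) (h' : Represents c' μ') : Represents (c - c') (μ - μ') := by
  obtain ⟨z, hz, rfl⟩ := h
  obtain ⟨z', hz', rfl⟩ := h'
  refine ⟨z - z', ?_, map_sub _ _ _⟩
  rw [map_sub, hz, hz']
  rfl

theorem Represents.eq_zero_iff {c : chains R X k} {μ : relHomology R X {Aᶜ} k}
    (h : Represents c μ) : μ = 0 ↔ c ∈ (lfTheory R X).bnd A k := by
  obtain ⟨z, hz, rfl⟩ := h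
  rw [homologyπ_eq_zero_iff, hz, ChainTheory.mem_bnd_iff]
  constructor
  · rintro ⟨x, hx⟩
    obtain ⟨b, rfl⟩ := Submodule.Quotient.mk_surjective (subchains R X {Aᶜ} (k + 1)) x
    rw [relComplex_d_mk] at hx
    exact ⟨b, (Submodule.Quotient.eq _).1 hx.symm⟩
  · rintro ⟨b, hb⟩
    refine ⟨Submodule.Quotient.mk b, ?_⟩
    rw [relComplex_d_mk]
    exact ((Submodule.Quotient.eq _).2 hb).symm

/-- With `Represents.restrict`, this turns equalities between restricted classes into membership of
differences of unchanged chains in `bnd`. -/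
theorem Represents.eq_iff {c c' : chains R X k} {μ μ' : relHomology R X {Aᶜ} k}
    (h : Represents c μ) (h' : Represents c' μ') :
    μ = μ' ↔ c - c' ∈ (lfTheory R X).bnd A k := by
  rw [← sub_eq_zero, (h.sub h').eq_zero_iff]

theorem Represents.restrict (hAB : A ⊆ B) {c : chains R X k} {μ : relHomology R X {Bᶜ} k}
    (h : Represents c μ) : Represents c (restrict R hAB k μ) := by
  obtain ⟨z, hz, rfl⟩ := h
  let f := relComplexMap R (Set.compl_subset_compl.2 hAB)
  refine ⟨HomologicalComplex.cyclesMap f k z, ?_, ?_⟩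
  · have h1 := ConcreteCategory.congr_hom (HomologicalComplex.cyclesMap_i f k) z
    refine h1.trans ?_
    change f.f k ((relComplex R X {Bᶜ}).iCycles k z) = _
    rw [hz]
    rfl
  · exact (ConcreteCategory.congr_hom (HomologicalComplex.homologyπ_naturality f k) z).symm

end Represents

/-! ### Absolute classes -/

section Absolute

variable {R : Type*} [CommRing R] {X : Type*} [TopologicalSpace X]

theorem restrict_restrictAbs {A B : Set X} (h : A ⊆ B) (k : ℕ) (μ : homology R X k) :
    restrict R h k (restrictAbs R B k μ) = restrictAbs R A k μ := by
  have hcomp : toRelComplex R X {Bᶜ} ≫ relComplexMap R (Set.compl_subset_compl.2 h) =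
      toRelComplex R X {Aᶜ} := by
    ext k : 1
    rfl
  have := ConcreteCategory.congr_hom (HomologicalComplex.homologyMap_comp (toRelComplex R X {Bᶜ})
    (relComplexMap R (Set.compl_subset_compl.2 h)) k) μ
  rw [hcomp] at this
  exact this.symm

/-- No singular simplex has empty image, so the subcomplex divided out is zero and the quotient map
is an isomorphism of complexes. -/
theorem restrictAbs_univ_bijective (k : ℕ) :
    Function.Bijective (restrictAbs R (Set.univ : Set X) k) := by
  have hf : ∀ k, IsIso ((toRelComplex R X {(Set.univ : Set X)ᶜ}).f k) := fun k => by
    rw [ConcreteCategory.isIso_iff_bijective]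
    change Function.Bijective (subchains R X {(Set.univ : Set X)ᶜ} k).mkQ
    refine ⟨?_, Submodule.mkQ_surjective _⟩
    rw [← LinearMap.ker_eq_bot, Submodule.ker_mkQ, eq_bot_iff]
    intro c hc
    ext σ
    by_contra hσ
    have := mem_subchains_singleton.1 hc σ hσ
    rw [Set.compl_univ] at this
    exact (Set.range_nonempty σ).ne_empty (Set.subset_empty_iff.1 this)
  have : IsIso (toRelComplex R X {(Set.univ : Set X)ᶜ}) :=
    HomologicalComplex.Hom.isIso_of_components _
  exact (ConcreteCategory.isIso_iff_bijective
    (HomologicalComplex.homologyMap (toRelComplex R X {(Set.univ : Set X)ᶜ}) k)).1 inferInstance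

end Absolute

/-! ### The assertions in homology -/

section Fundamental

variable {R : Type*} [CommRing R] {n : ℕ} {X : Type*} [TopologicalSpace X] [T2Space X]
  [SecondCountableTopology X] [ChartedSpace (EuclideanSpace ℝ (Fin n)) X] {A : Set X}

theorem subsingleton_relHomology (hA : IsClosed A) {k : ℕ} (hk : n < k) :
    Subsingleton (relHomology R X {Aᶜ} k) := by
  refine subsingleton_of_forall_eq 0 fun μ => ?_
  obtain ⟨c, hc⟩ := exists_represents μ
  exact hc.eq_zero_iff.2 (cyc_le_bnd_of_isClosed hA hk hc.mem_cyc)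

theorem relHomology_eq_zero_iff (hA : IsClosed A) (μ : relHomology R X {Aᶜ} n) :
    μ = 0 ↔ ∀ (x : X) (hx : x ∈ A), restrict R (Set.singleton_subset_iff.2 hx) n μ = 0 := by
  refine ⟨fun h x hx => by rw [h, map_zero], fun h => ?_⟩
  obtain ⟨c, hc⟩ := exists_represents μ
  exact hc.eq_zero_iff.2 (mem_bnd_of_isClosed hA hc.mem_cyc fun x hx =>
    (hc.restrict _).eq_zero_iff.1 (h x hx))

/-- Representing chains turn the orientation into a locally consistent family, which extends over
`A`. Two solutions differ by a class vanishing at every point of `A`, hence by zero. -/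
theorem existsUnique_relHomology (hA : IsClosed A) (o : Orientation R X n) :
    ∃! μ : relHomology R X {Aᶜ} n, ∀ (x : X) (hx : x ∈ A),
      restrict R (Set.singleton_subset_iff.2 hx) n μ = o.loc x := by
  choose z hz using fun x => exists_represents (o.loc x)
  have hcons : IsLocallyConsistent n z := fun x => by
    obtain ⟨U, hU, μ, hμ⟩ := o.locally_consistent x
    obtain ⟨c, hc⟩ := exists_represents μ
    exact ⟨U, hU, c, hc.mem_cyc, fun y hy =>
      ((hc.restrict (Set.singleton_subset_iff.2 hy)).eq_iff (hz y)).1 (hμ y hy)⟩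
  obtain ⟨c, hc, hcz⟩ := exists_cyc_of_isClosed hA hcons
  obtain ⟨μ, hμ⟩ := exists_represents_of_mem_cyc hc
  have hμz : ∀ (x : X) (hx : x ∈ A),
      restrict R (Set.singleton_subset_iff.2 hx) n μ = o.loc x := fun x hx =>
    ((hμ.restrict _).eq_iff (hz x)).2 (hcz x hx)
  refine ⟨μ, hμz, fun ν hν => ?_⟩
  rw [← sub_eq_zero, relHomology_eq_zero_iff hA]
  intro x hx
  rw [map_sub, hν x hx, hμz x hx, sub_self]

theorem existsUnique_homology (o : Orientation R X n) :
    ∃! μ : homology R X n, ∀ x : X, restrictAbs R {x} n μ = o.loc x := by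
  obtain ⟨ν, hν, huniq⟩ := existsUnique_relHomology isClosed_univ o
  obtain ⟨hinj, hsurj⟩ := restrictAbs_univ_bijective (R := R) (X := X) n
  obtain ⟨μ, rfl⟩ := hsurj ν
  refine ⟨μ, fun x => ?_, fun μ' hμ' => hinj (huniq _ fun x hx => ?_)⟩
  · rw [← hν x trivial, restrict_restrictAbs]
  · rw [restrict_restrictAbs, hμ']

end Fundamental

end

end BorelMoore

theorem proposition2p10 (R : Type*) [CommRing R] (n : ℕ)
    (X : Type*) [TopologicalSpace X] [T2Space X] [SecondCountableTopology X]
    [ChartedSpace (EuclideanSpace ℝ (Fin n)) X] [IsManifold (𝓡 n) ∞ X]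
    (A : Set X) (hA : IsClosed A) :
    (∀ k : ℕ, n < k → Subsingleton (BorelMoore.relHomology R X {Aᶜ} k)) ∧
    (∀ μ : BorelMoore.relHomology R X {Aᶜ} n,
      μ = 0 ↔ ∀ (x : X) (hx : x ∈ A),
        BorelMoore.restrict R (Set.singleton_subset_iff.2 hx) n μ = 0) ∧
    (∀ o : BorelMoore.Orientation R X n,
      ∃! μ : BorelMoore.relHomology R X {Aᶜ} n, ∀ (x : X) (hx : x ∈ A),
        BorelMoore.restrict R (Set.singleton_subset_iff.2 hx) n μ = o.loc x) ∧
    (∀ o : BorelMoore.Orientation R X n,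
      ∃! μ : BorelMoore.homology R X n, ∀ x : X,
        BorelMoore.restrictAbs R {x} n μ = o.loc x) := by
  exact ⟨fun k hk => BorelMoore.subsingleton_relHomology hA hk,
    BorelMoore.relHomology_eq_zero_iff hA, BorelMoore.existsUnique_relHomology hA,
    BorelMoore.existsUnique_homology⟩
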